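/- **Setting.** Everything is smooth ($C^\infty$, up to the boundary). Let $M$ be an oriented 7-manifold with a closed positive 3-form $\varphi$ (at each point $\varphi$ is identified with $$\varphi_0=dx_{123}+dx_{145}+dx_{167}+dx_{246}-dx_{257}-dx_{347}-dx_{356}$$ by an orientation preserving isomorphism $T_xM\cong\mathbb R^7$), and let $g$ and $*\varphi$ be the induced metric and dual 4-form. A 4-dimensional submanifold $P$ of $M$ is *coassociative* if $\varphi|_P=0$. Let $N\subset M$ be a compact embedded coassociative 4-fold with boundary $\partial N$, oriented so that $*\varphi|_N>0$; self-dual forms on $N$, the Hodge star and $d^*_+=\frac12(d^*+*d^*):\Omega^3(N)\to\Omega^2_+(N)$ are taken with respect to $g|_N$. Let $S\subset M$ be a scaffold for $N$: an embedded 6-dimensional submanifold containing $\partial N$, with a unit normal field $\mathbf n_S$ such that $\omega_0=(\mathbf n_S\lrcorner\varphi)|_S$ is closed and $\mathbf n=\mathbf n_S|_{\partial N}$ is tangent to $N$ and points into $N$. A 3-dimensional submanifold $L\subset S$ is *special Lagrangian* if $\omega_0|_L=0$ and $\varphi|_L=0$. Let $\hat g$ be a metric on $M$ which equals $g$ outside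 a tubular neighbourhood of $S$, and which near $S$ is the product metric $g|_S+ds^2$ in tubular coordinates $(x,s)$ with $S=\{s=0\}$ and $\partial/\partial s=\mathbf n_S$ on $S$; so $S$ is totally geodesic for $\hat g$. Let $\hat\nu_M(N)$ be the normal bundle of $N$ with respect to $\hat g$, and let $\jmath_N:\hat\nu_M(N)\to\Lambda^2_+T^*N$, $\jmath_N(\mathbf v)=(\mathbf v\lrcorner\varphi)|_{TN}$. Let $\mathcal V_N\subset\hat\nu_M(N)$ be an open neighbourhood of the zero section with fibres star-shaped about $0$, which $\widehat{\exp}_M$ (the exponential map of $\hat g$) maps diffeomorphically onto its image, the fibres over $\partial N$ being mapped into $S$. Put $\mathcal U_N=\jmath_N(\mathcal V_N)$, and let $\Gamma(\mathcal U_N)$ be the set of smooth self-dual 2-forms on $N$ with values in $\mathcal U_N$. For $\alpha\in\Gamma(\mathcal U_N)$ with $\mathbf v=\jmath_N^{-1}(\alpha)$ put $$N_\alpha=\widehat{\exp}_{\mathbf v}(N),\qquad \hat F(\alpha)=\widehat{\exp}_{\mathbf v}^*(\varphi|_{N_\alpha})\in\Omega^3(N),\qquad G(\alpha)=d^*_+\hat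 F(\alpha).$$ On the boundary, let $\hat\nu_S(\partial N)$ be the normal bundle of $\partial N$ in $S$ with respect to $\hat g$, let $\jmath_{\partial N}:\hat\nu_S(\partial N)\to T^*\partial N$, $\jmath_{\partial N}(\mathbf w)=(\mathbf w\lrcorner\omega_0)|_{\partial N}$, and put $\beta=-(\mathbf n\lrcorner\alpha)|_{\partial N}$, $\mathbf w=\jmath_{\partial N}^{-1}(\beta)$, $$(\partial N)_\beta=\widehat{\exp}_{\mathbf w}(\partial N)\subset S,\qquad \hat F_{\partial N}(\beta)=\widehat{\exp}_{\mathbf w}^*\big((\mathbf n_S\lrcorner\varphi)|_{(\partial N)_\beta}\big)\in\Omega^2(\partial N).$$ Let $\Gamma(\mathcal U_N)_{\rm bc}$ be the set of $\alpha\in\Gamma(\mathcal U_N)$ with $\hat F_{\partial N}(\beta)=0$ and $\mathbf n\lrcorner\hat F(\alpha)=0$ on $\partial N$. **Proposition.** Let $\alpha\in\Gamma(\mathcal U_N)_{\rm bc}$. Then $G(\alpha)=0$ if and only if $N_\alpha$ is a coassociative submanifold of $M$. If $G(\alpha)=0$, then the induced deformation of the boundary, $(\partial N)_\beta=\partial N_\alpha\subset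 S$ (the two parametrisations by $\partial N$ agree), is a special Lagrangian submanifold of $S$. -/

import Mathlib

open Set Function Bundle
open scoped Manifold ContDiff Topology

noncomputable section

namespace CoassocBdry

/-- The model spaces. -/
abbrev Euc (n : ℕ) := EuclideanSpace ℝ (Fin n)

/-! ### Differential forms, pullback, exterior derivative -/

section Forms

variable {E : Type*} [NormedAddCommGroup E] [NormedSpace ℝ E]
  {H : Type*} [TopologicalSpace H] (I : ModelWithCorners ℝ E H)
  {X : Type*} [TopologicalSpace X] [ChartedSpace H X]
  {E' : Type*} [NormedAddCommGroup E'] [NormedSpace ℝ E']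
  {H' : Type*} [TopologicalSpace H'] (I' : ModelWithCorners ℝ E' H')
  {X' : Type*} [TopologicalSpace X'] [ChartedSpace H' X']

/-- A (not necessarily smooth) differential `k`-form on a manifold `X` modelled on `E`. Mathlib's
tangent space `TangentSpace I x` is by definition `E`, identified with the geometric tangent space
through the preferred chart at `x`; a form assigns to `x` an alternating `k`-linear map on it. -/
abbrev DForm (E : Type*) [NormedAddCommGroup E] [NormedSpace ℝ E] (X : Type*) (k : ℕ) :=
  X → E [⋀^Fin k]→L[ℝ] ℝ

/-- The differential `T_x X → T_{f x} X'` of a map. -/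
def tmap (f : X → X') (x : X) : E →L[ℝ] E' := mfderiv I I' f x

/-- The differential at `y` of the inverse of the preferred chart at `x₀`. -/
def chartInvDeriv (x₀ : X) (y : E) : E →L[ℝ] E :=
  mfderivWithin 𝓘(ℝ, E) I (extChartAt I x₀).symm (range I) y

/-- The coordinate expression of a form in the preferred chart at `x₀`. -/
def DForm.inChart {k : ℕ} (θ : DForm E X k) (x₀ : X) (y : E) : E [⋀^Fin k]→L[ℝ] ℝ :=
  (θ ((extChartAt I x₀).symm y)).compContinuousLinearMap (chartInvDeriv I x₀ y)

/-- Smoothness of a form (up to the boundary, if there is one). -/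
def DForm.IsSmooth {k : ℕ} (θ : DForm E X k) : Prop :=
  ∀ x₀ : X, ContDiffOn ℝ ∞ (θ.inChart I x₀) (extChartAt I x₀).target

/-- The exterior derivative, computed at `x` in the preferred chart at `x` (whose differential at
`x` is the identity of `TangentSpace I x = E`). -/
def DForm.extd {k : ℕ} (θ : DForm E X k) : DForm E X (k + 1) := fun x =>
  extDerivWithin (θ.inChart I x) (range I) (extChartAt I x x)

/-- The pullback `f^* θ`. -/
def DForm.pull {k : ℕ} (θ : DForm E' X' k) (f : X → X') : DForm E X k := fun x =>
  (θ (f x)).compContinuousLinearMap (tmap I I' f x)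

/-- An embedding of manifolds in the textbook sense: smooth, with injective differentials, and a
homeomorphism onto its image. The source may have a boundary. Embedded submanifolds are
represented by embeddings. -/
structure IsEmbedded (f : X → X') : Prop where
  smooth : ContMDiff I I' ∞ f
  immersion : ∀ x, Injective (tmap I I' f x)
  embedding : Topology.IsEmbedding f

end Forms

/-! ### Geodesics and the exponential map -/

section Riemannian

variable (M : Type*) [TopologicalSpace M] [ChartedSpace (Euc 7) M] [IsManifold (𝓡 7) ∞ M]

/-- Smooth Riemannian metrics on a 7-manifold. -/
abbrev Metric :=
  ContMDiffRiemannianMetric (𝓡 7) ∞ (Euc 7) (fun x : M => TangentSpace (𝓡 7) x)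

variable {M}

/-- The metric `h_x(u, v)`. -/
def Metric.ip (h : Metric M) (x : M) (u v : Euc 7) : ℝ := h.inner x u v

/-- The metric in the coordinates of the preferred chart at `x₀`. -/
def Metric.inChart (h : Metric M) (x₀ : M) (y u v : Euc 7) : ℝ :=
  h.ip ((extChartAt (𝓡 7) x₀).symm y)
    (chartInvDeriv (𝓡 7) x₀ y u) (chartInvDeriv (𝓡 7) x₀ y v)

/-- `γ` is an (affinely parametrised) geodesic of `h` on the open set `J` of times. The equation
is written in the chart at `γ t` as the Euler-Lagrange equation of the energy:
`d/dt h_c(c', w) = 1/2 (∂_w h)_c(c', c')` for all constant coordinate vectors `w`. -/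
structure IsGeodesicOn (h : Metric M) (γ : ℝ → M) (J : Set ℝ) : Prop where
  smooth : ContMDiffOn 𝓘(ℝ, ℝ) (𝓡 7) ∞ γ J
  eulerLagrange : ∀ t ∈ J, ∀ w : Euc 7,
    let c : ℝ → Euc 7 := fun τ => extChartAt (𝓡 7) (γ t) (γ τ)
    HasDerivAt (fun τ => h.inChart (γ t) (c τ) (deriv c τ) w)
      (1 / 2 * fderiv ℝ (fun y => h.inChart (γ t) y (deriv c t) (deriv c t)) (c t) w) t

/-- `y` is the endpoint at time `1` of a geodesic with initial velocity `w`. -/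
def IsExp (h : Metric M) (w : TangentBundle (𝓡 7) M) (y : M) : Prop :=
  ∃ ε : ℝ, 0 < ε ∧ ∃ γ : ℝ → M, IsGeodesicOn h γ (Ioo (-ε) (1 + ε)) ∧
    γ 0 = w.proj ∧ tmap 𝓘(ℝ, ℝ) (𝓡 7) γ 0 1 = (w.snd : Euc 7) ∧ γ 1 = y

/-- The domain of the exponential map. -/
def expDomain (h : Metric M) : Set (TangentBundle (𝓡 7) M) := {w | ∃ y, IsExp h w y}

open Classical in
/-- The exponential map of `h` (with value the base point outside of its domain). -/
def expMap (h : Metric M) (w : TangentBundle (𝓡 7) M) : M :=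
  if hw : ∃ y, IsExp h w y then hw.choose else w.proj

end Riemannian

/-! ### `G₂`-structures -/

/-- The form `dx_{i₁} ∧ … ∧ dx_{iₖ}` on `ℝ⁷`, evaluated on `k` vectors. -/
def dx {k : ℕ} (i : Fin k → Fin 7) (v : Fin k → Euc 7) : ℝ :=
  Matrix.det (Matrix.of fun r s => v r (i s))

/-- The standard 3-form on `ℝ⁷` (coordinates are numbered from `0` to `6`). -/
def phi0 (v : Fin 3 → Euc 7) : ℝ :=
  dx ![0, 1, 2] v + dx ![0, 3, 4] v + dx ![0, 5, 6] v + dx ![1, 3, 5] v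
    - dx ![1, 4, 6] v - dx ![2, 3, 6] v - dx ![2, 4, 5] v

/-- Its Hodge dual, the standard 4-form on `ℝ⁷`. -/
def psi0 (v : Fin 4 → Euc 7) : ℝ :=
  dx ![3, 4, 5, 6] v + dx ![1, 2, 5, 6] v + dx ![1, 2, 3, 4] v + dx ![0, 2, 4, 6] v
    - dx ![0, 2, 3, 5] v - dx ![0, 1, 4, 5] v - dx ![0, 1, 3, 6] v

/-- An almost `G₂`-structure: a closed positive 3-form `φ` with the metric `g = g(φ)` and the
dual 4-form `ψ = *φ` which it determines, the triple `(φ, ψ, g)` corresponding to the standard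
triple on `ℝ⁷` at each point. (The manifold is oriented by the isomorphisms with `ℝ⁷`.) -/
structure AlmostG2 (M : Type*) [TopologicalSpace M] [ChartedSpace (Euc 7) M]
    [IsManifold (𝓡 7) ∞ M] where
  φ : DForm (Euc 7) M 3
  ψ : DForm (Euc 7) M 4
  g : Metric M
  smooth_φ : φ.IsSmooth (𝓡 7)
  smooth_ψ : ψ.IsSmooth (𝓡 7)
  model : ∀ x : M, ∃ e : Euc 7 ≃L[ℝ] Euc 7,
    (∀ v : Fin 3 → Euc 7, φ x v = phi0 (e ∘ v)) ∧
    (∀ v : Fin 4 → Euc 7, ψ x v = psi0 (e ∘ v)) ∧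
    (∀ u v : Euc 7, g.ip x u v = inner ℝ (e u) (e v))
  closed : ∀ x : M, φ.extd (𝓡 7) x = 0

section Setup

variable {M : Type*} [TopologicalSpace M] [ChartedSpace (Euc 7) M] [IsManifold (𝓡 7) ∞ M]
  {N : Type*} [TopologicalSpace N] [ChartedSpace (EuclideanHalfSpace 4) N]
  {L : Type*} [TopologicalSpace L] [ChartedSpace (Euc 3) L]
  {S : Type*} [TopologicalSpace S] [ChartedSpace (Euc 6) S]
  (P : AlmostG2 M) (ι : N → M)

/-- The 4-dimensional submanifold (with boundary) embedded by `f` is coassociative. -/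
structure IsCoassociative (f : N → M) : Prop where
  embedded : IsEmbedded (𝓡∂ 4) (𝓡 7) f
  vanishes : ∀ x, P.φ.pull (𝓡∂ 4) (𝓡 7) f x = 0

/-! ### Self-dual forms on `N` -/

/-- The frame `e` of `T_x N` is orthonormal for the metric induced from `g`. -/
def IsOrthonormalFrame (x : N) (e : Fin 4 → Euc 4) : Prop :=
  ∀ a b, P.g.ip (ι x) (tmap (𝓡∂ 4) (𝓡 7) ι x (e a)) (tmap (𝓡∂ 4) (𝓡 7) ι x (e b)) =
    if a = b then 1 else 0

open Classical in
/-- A chosen orthonormal frame of `T_x N`. -/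
def frame (x : N) : Fin 4 → Euc 4 :=
  if h : ∃ e, IsOrthonormalFrame P ι x e then h.choose else 0

/-- The volume form of the metric induced from `g` on `N`, for the orientation in which `*φ` is
positive: the positive multiple of `*φ|_N` with value `±1` on orthonormal frames. -/
def vol : DForm (Euc 4) N 4 := fun x =>
  |P.ψ.pull (𝓡∂ 4) (𝓡 7) ι x (frame P ι x)|⁻¹ • P.ψ.pull (𝓡∂ 4) (𝓡 7) ι x

/-- The Hodge star of the induced metric and orientation on 3-forms,
`(*η)(w) = 1/3! ∑ η(e_a, e_b, e_c) vol(e_a, e_b, e_c, w)`. -/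
def star3 (η : DForm (Euc 4) N 3) : DForm (Euc 4) N 1 := fun x =>
  (1 / 6 : ℝ) • ∑ a, ∑ b, ∑ c,
    η x ![frame P ι x a, frame P ι x b, frame P ι x c] •
      (((vol P ι x).curryLeft (frame P ι x a)).curryLeft (frame P ι x b)).curryLeft (frame P ι x c)

/-- The Hodge star on 2-forms, `(*η)(w, w') = 1/2! ∑ η(e_a, e_b) vol(e_a, e_b, w, w')`. -/
def star2 (η : DForm (Euc 4) N 2) : DForm (Euc 4) N 2 := fun x =>
  (1 / 2 : ℝ) • ∑ a, ∑ b, η x ![frame P ι x a, frame P ι x b] •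
    ((vol P ι x).curryLeft (frame P ι x a)).curryLeft (frame P ι x b)

/-- The codifferential `d^* = - * d *` on 3-forms of the 4-manifold `N`. -/
def codiff (η : DForm (Euc 4) N 3) : DForm (Euc 4) N 2 := fun x =>
  -star2 P ι ((star3 P ι η).extd (𝓡∂ 4)) x

/-- The operator `d^*_+ = 1/2 (d^* + * d^*)` from 3-forms to self-dual 2-forms. -/
def codiffPlus (η : DForm (Euc 4) N 3) : DForm (Euc 4) N 2 := fun x =>
  (1 / 2 : ℝ) • (codiff P ι η x + star2 P ι (codiff P ι η) x)

/-! ### Scaffolds -/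

/-- The 2-form `ω₀ = (n_S ⌟ φ)|_S` on a hypersurface `κ : S → M` with normal field `n_S`. -/
def omega0 (κ : S → M) (nS : S → TangentBundle (𝓡 7) M) : DForm (Euc 6) S 2 := fun y =>
  ((P.φ (κ y)).curryLeft (nS y).snd).compContinuousLinearMap (tmap (𝓡 6) (𝓡 7) κ y)

/-- A scaffold for `ι : N → M`, where `j : L → N` is the inclusion of `L = ∂N`. -/
structure Scaffold (j : L → N) (S : Type*) [TopologicalSpace S] [ChartedSpace (Euc 6) S] where
  /-- the inclusion of the 6-dimensional submanifold `S` -/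
  κ : S → M
  embedded : IsEmbedded (𝓡 6) (𝓡 7) κ
  /-- the unit normal vector field of `S`, which orients `S` -/
  nS : S → TangentBundle (𝓡 7) M
  nS_smooth : ContMDiff (𝓡 6) (𝓡 7).tangent ∞ nS
  nS_proj : ∀ y, (nS y).proj = κ y
  nS_unit : ∀ y, P.g.ip (κ y) (nS y).snd (nS y).snd = 1
  nS_normal : ∀ y (u : Euc 6), P.g.ip (κ y) (nS y).snd (tmap (𝓡 6) (𝓡 7) κ y u) = 0
  /-- `S` is a symplectic submanifold -/
  symplectic : ∀ y, (omega0 P κ nS).extd (𝓡 6) y = 0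
  /-- the inclusion of `∂N` in `S` -/
  bS : L → S
  bS_eq : ∀ p, κ (bS p) = ι (j p)
  /-- the restriction of `n_S` to `∂N` is tangent to `N` and points inwards (`N` is modelled on
  the half-space of vectors with non-negative coordinate number `0`) -/
  n : L → Euc 4
  n_eq : ∀ p, tmap (𝓡∂ 4) (𝓡 7) ι (j p) (n p) = (nS (bS p)).snd
  n_inward : ∀ p, 0 < n p 0

variable {P ι} {j : L → N}

/-- The symplectic form of a scaffold. -/
def Scaffold.omega (C : Scaffold P ι j S) : DForm (Euc 6) S 2 := omega0 P C.κ C.nS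

/-- The 3-dimensional submanifold of `S` embedded by `b : L → S` is special Lagrangian. -/
structure IsSpecialLagrangian (C : Scaffold P ι j S) (b : L → S) : Prop where
  embedded : IsEmbedded (𝓡 3) (𝓡 6) b
  lagrangian : ∀ p, C.omega.pull (𝓡 3) (𝓡 6) b p = 0
  special : ∀ p, P.φ.pull (𝓡 3) (𝓡 7) (C.κ ∘ b) p = 0

/-- The modified metric `h` (written `ĝ`): there are a neighbourhood `T` of `S` with a
diffeomorphism `η` onto it from a neighbourhood `D` of `S × {0}` in `S × ℝ`, where
`η(x, 0) = x` and `∂η/∂s (x, 0) = n_S(x)`, such that `ĝ = g` outside of `T` and `ĝ` is the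
product metric `g|_S + ds²` on a neighbourhood `O ⊆ T` of `S`. In particular `S` is totally
geodesic for `ĝ`, and `ĝ = g` at the points of `S`. -/
def IsAdaptedMetric (C : Scaffold P ι j S) (h : Metric M) : Prop :=
  ∃ (D : Set (S × ℝ)) (T O : Set M) (η : S × ℝ → M) (ηinv : M → S × ℝ),
    IsOpen D ∧ IsOpen T ∧ IsOpen O ∧ (∀ y, (y, (0 : ℝ)) ∈ D) ∧ range C.κ ⊆ O ∧ O ⊆ T ∧
    MapsTo η D T ∧ MapsTo ηinv T D ∧ LeftInvOn ηinv η D ∧ RightInvOn ηinv η T ∧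
    ContMDiffOn ((𝓡 6).prod 𝓘(ℝ, ℝ)) (𝓡 7) ∞ η D ∧
    ContMDiffOn (𝓡 7) ((𝓡 6).prod 𝓘(ℝ, ℝ)) ∞ ηinv T ∧
    (∀ y, η (y, 0) = C.κ y) ∧
    (∀ y, tmap ((𝓡 6).prod 𝓘(ℝ, ℝ)) (𝓡 7) η (y, 0) ((0 : Euc 6), (1 : ℝ)) = (C.nS y).snd) ∧
    (∀ q ∈ D, η q ∈ O → ∀ a b : Euc 6 × ℝ,
      h.ip (η q) (tmap ((𝓡 6).prod 𝓘(ℝ, ℝ)) (𝓡 7) η q a)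
          (tmap ((𝓡 6).prod 𝓘(ℝ, ℝ)) (𝓡 7) η q b) =
        P.g.ip (C.κ q.1) (tmap (𝓡 6) (𝓡 7) C.κ q.1 a.1) (tmap (𝓡 6) (𝓡 7) C.κ q.1 b.1)
          + a.2 * b.2) ∧
    (∀ x ∉ T, ∀ u v, h.ip x u v = P.g.ip x u v)

/-! ### Adapted tubular neighbourhoods -/

/-- The total space of the normal bundle `ν̂_M(N)` with respect to `h`, a subset of `TM`. -/
def normalBundle (ι : N → M) (h : Metric M) : Set (TangentBundle (𝓡 7) M) :=
  {w | ∃ x, w.proj = ι x ∧ ∀ u : Euc 4, h.ip (ι x) w.snd (tmap (𝓡∂ 4) (𝓡 7) ι x u) = 0}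

/-- The sets `𝒱_N`: open neighbourhoods of the zero section in `ν̂_M(N)` with star-shaped fibres,
which the exponential map of `h` maps diffeomorphically onto `𝒯_N`, the fibres over `∂N` going
into `S`. -/
structure IsTubular (C : Scaffold P ι j S) (h : Metric M)
    (V : Set (TangentBundle (𝓡 7) M)) : Prop where
  subset : V ⊆ normalBundle ι h
  isOpen : ∃ O : Set (TangentBundle (𝓡 7) M), IsOpen O ∧ V = normalBundle ι h ∩ O
  zero_mem : ∀ x : N, (⟨ι x, 0⟩ : TangentBundle (𝓡 7) M) ∈ V
  starShaped : ∀ w ∈ V, ∀ t ∈ Icc (0 : ℝ) 1,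
    (⟨w.proj, t • w.snd⟩ : TangentBundle (𝓡 7) M) ∈ V
  subset_domain : V ⊆ expDomain h
  smooth : ContMDiffOn (𝓡 7).tangent (𝓡 7) ∞ (expMap h) V
  smooth_inv : ∃ σ : M → TangentBundle (𝓡 7) M,
    ContMDiffOn (𝓡 7) (𝓡 7).tangent ∞ σ (expMap h '' V) ∧ LeftInvOn σ (expMap h) V
  boundary : ∀ w ∈ V, ∀ p : L, w.proj = ι (j p) → expMap h w ∈ range C.κ

/-- `ȷ_N(w) = (w ⌟ φ)|_{T_x N}`, for a tangent vector `w` of `M` at `ι x`. -/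
def jN (P : AlmostG2 M) (ι : N → M) (x : N) (w : TangentBundle (𝓡 7) M) :
    Euc 4 [⋀^Fin 2]→L[ℝ] ℝ :=
  ((P.φ (ι x)).curryLeft w.snd).compContinuousLinearMap (tmap (𝓡∂ 4) (𝓡 7) ι x)

/-- `Γ(𝒰_N)`: the smooth self-dual 2-forms with values in `𝒰_N = ȷ_N(𝒱_N)`. -/
def GammaU (P : AlmostG2 M) (ι : N → M) (V : Set (TangentBundle (𝓡 7) M)) :
    Set (DForm (Euc 4) N 2) :=
  {α | α.IsSmooth (𝓡∂ 4) ∧ (∀ x, star2 P ι α x = α x) ∧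
    ∀ x, ∃ w ∈ V, w.proj = ι x ∧ jN P ι x w = α x}

open Classical in
/-- `v = ȷ_N⁻¹(α)`, with `ȷ_N` the isomorphism from `ν̂_M(N)` to the self-dual 2-forms. -/
def normalField (P : AlmostG2 M) (ι : N → M) (h : Metric M) (α : DForm (Euc 4) N 2) (x : N) :
    TangentBundle (𝓡 7) M :=
  if hw : ∃ w ∈ normalBundle ι h, w.proj = ι x ∧ jN P ι x w = α x then hw.choose else ⟨ι x, 0⟩

/-! ### The deformation map -/

/-- The parametrisation `exp_v : N → N_α`, `v = ȷ_N⁻¹(α)`, of the deformation `N_α`. -/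
def deform (P : AlmostG2 M) (ι : N → M) (h : Metric M) (α : DForm (Euc 4) N 2) (x : N) : M :=
  expMap h (normalField P ι h α x)

/-- `F̂(α) = exp_v^*(φ|_{N_α})`. -/
def Fhat (P : AlmostG2 M) (ι : N → M) (h : Metric M) (α : DForm (Euc 4) N 2) :
    DForm (Euc 4) N 3 :=
  P.φ.pull (𝓡∂ 4) (𝓡 7) (deform P ι h α)

/-- The deformation map `G = d^*_+ ∘ F̂`. -/
def Gmap (P : AlmostG2 M) (ι : N → M) (h : Metric M) (α : DForm (Euc 4) N 2) :
    DForm (Euc 4) N 2 :=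
  codiffPlus P ι (Fhat P ι h α)

/-! ### The boundary -/

/-- `ȷ_{∂N}(w) = (w ⌟ ω₀)|_{∂N}`, for a tangent vector `w` of `S` at the point `p` of `∂N`. -/
def Scaffold.jL (C : Scaffold P ι j S) (p : L) (w : Euc 6) : Euc 3 [⋀^Fin 1]→L[ℝ] ℝ :=
  ((C.omega (C.bS p)).curryLeft w).compContinuousLinearMap (tmap (𝓡 3) (𝓡 6) C.bS p)

open Classical in
/-- `ȷ_{∂N}⁻¹(β)`, a section of the normal bundle `ν̂_S(∂N)` with respect to `h`. -/
def Scaffold.bdryField (C : Scaffold P ι j S) (h : Metric M) (β : DForm (Euc 3) L 1) (p : L) :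
    Euc 6 :=
  if hw : ∃ w : Euc 6, (∀ u : Euc 3, h.ip (C.κ (C.bS p)) (tmap (𝓡 6) (𝓡 7) C.κ (C.bS p) w)
      (tmap (𝓡 6) (𝓡 7) C.κ (C.bS p) (tmap (𝓡 3) (𝓡 6) C.bS p u)) = 0) ∧ C.jL p w = β p
  then hw.choose else 0

open Classical in
/-- The parametrisation `exp_v : ∂N → (∂N)_β ⊆ S`, `v = ȷ_{∂N}⁻¹(β)`. As `S` is totally
geodesic, the exponential map of `S` is the restriction of that of `M`. -/
def Scaffold.bdryDeform (C : Scaffold P ι j S) (h : Metric M) (β : DForm (Euc 3) L 1) (p : L) :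
    S :=
  if hy : ∃ y, C.κ y = expMap h
      ⟨C.κ (C.bS p), tmap (𝓡 6) (𝓡 7) C.κ (C.bS p) (C.bdryField h β p)⟩
  then hy.choose else C.bS p

/-- `F̂_{∂N}(β) = exp_v^*((n_S ⌟ φ)|_{(∂N)_β})`. -/
def Scaffold.FhatBdry (C : Scaffold P ι j S) (h : Metric M) (β : DForm (Euc 3) L 1) :
    DForm (Euc 3) L 2 :=
  C.omega.pull (𝓡 3) (𝓡 6) (C.bdryDeform h β)

/-- The 1-form `-(n ⌟ α)|_{∂N}`, which is `ȷ_{∂N}` of the boundary values of `ȷ_N⁻¹(α)`. -/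
def Scaffold.bdryForm (C : Scaffold P ι j S) (α : DForm (Euc 4) N 2) : DForm (Euc 3) L 1 :=
  fun p => -((α (j p)).curryLeft (C.n p)).compContinuousLinearMap (tmap (𝓡 3) (𝓡∂ 4) j p)

/-- `Γ(𝒰_N)_bc`: the forms in `Γ(𝒰_N)` with Lagrangian boundary deformation and with
`n ⌟ F̂(α) = 0` on `∂N`. -/
def Scaffold.GammaBC (C : Scaffold P ι j S) (h : Metric M) (V : Set (TangentBundle (𝓡 7) M)) :
    Set (DForm (Euc 4) N 2) :=
  {α | α ∈ GammaU P ι V ∧ (∀ p, C.FhatBdry h (C.bdryForm α) p = 0) ∧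
    ∀ p, (Fhat P ι h α (j p)).curryLeft (C.n p) = 0}

end Setup

end CoassocBdry

end

/-!
The equation `G(α) = 0` is a weaker system than `F̂(α) = exp_v^* φ = 0`, and the point is that under
the boundary conditions the two are equivalent. Write `η = F̂(α)` and `ξ = *η`, a 1-form on `N`.

The condition `n ⌟ η = 0` on `∂N` says that `ξ` is a multiple of the 1-form dual to the normal `n`,
so that `ξ` vanishes on vectors tangent to `∂N` (`star3_Fhat_boundary`). Since `*` is an involution
on 2-forms, `G(α) = 0` means that `dξ` is anti-self-dual. By Stokes' theorem
`0 = ∫ d(ξ ∧ dξ) = ∫ dξ ∧ dξ = -∫ |dξ|² vol`, so `ξ` is closed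
(`IsCoassociative.extd_eq_zero_of_antiSelfDual`).

Next, `η` is exact in a way which can be made explicit. The homotopy `H(t, ·) = exp_{s(t) v}` joins
`ι` to `exp_v`; as `φ` is closed, Cartan's formula `DForm.hasDerivAt_slice` gives
`∂_t H_t^* φ = dτ_t` with `τ_t` the contraction of `H^* φ` with `∂/∂t`, and `ι^* φ = 0` because `N`
is coassociative. As `ξ` is closed and vanishes on `∂N`, Stokes' theorem gives
`∫ ξ ∧ dτ_t = 0` for every `t`; integrating over `t` yields `0 = ∫ ξ ∧ η = -∫ |η|² vol`, whence
`η = 0` (`IsCoassociative.eq_zero_of_closed_star`). The deformation is embedded because the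
exponential map has a smooth left inverse on the image of the tubular neighbourhood
(`isEmbedded_deform`).

Along `∂N` the field `v` is normal to `n = n_S` for the adapted metric, hence tangent to `S`, and
`φ(v, n, ·) = -φ(n, v, ·)` identifies it with `ȷ_{∂N}⁻¹(β)` (`tmap_bdryField`); so the two
parametrisations of the deformed boundary agree. The first boundary condition is that the deformed
boundary is Lagrangian, and `φ` vanishes on it as it lies in a coassociative submanifold.

Two points need care in the absence of a general theory. Integration is replaced by a measure built
from the densities `|vol|` in charts by a partition of unity, for which Stokes' theorem holds
(`exists_stokes_measure`). Smoothness of the normal field `v` and of `*η`, both defined by pointwise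
choices, follows from the smooth injective linear systems which they solve
(`contDiffWithinAt_of_linear_equations`).
-/

noncomputable section

set_option linter.unusedSectionVars false

namespace CoassocBdry

/-! ### Differential forms in charts -/

section FormCalculus

variable {E : Type*} [NormedAddCommGroup E] [NormedSpace ℝ E]
  {H : Type*} [TopologicalSpace H] {I : ModelWithCorners ℝ E H}
  {X : Type*} [TopologicalSpace X] [ChartedSpace H X] [IsManifold I ∞ X]
  {E' : Type*} [NormedAddCommGroup E'] [NormedSpace ℝ E']
  {H' : Type*} [TopologicalSpace H'] {I' : ModelWithCorners ℝ E' H'}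
  {X' : Type*} [TopologicalSpace X'] [ChartedSpace H' X'] [IsManifold I' ∞ X']

/-- The coordinate expression of a map in the preferred charts at `x₀` and `q`. -/
def localRep (I : ModelWithCorners ℝ E H) (I' : ModelWithCorners ℝ E' H')
    (f : X → X') (x₀ : X) (q : X') (y : E) : E' :=
  extChartAt I' q (f ((extChartAt I x₀).symm y))

theorem mapsTo_localRep (f : X → X') (x₀ : X) (q : X') (s : Set E) :
    MapsTo (localRep I I' f x₀ q) s (range I') := fun y _ => by
  simp [localRep, extChartAt]

theorem target_mem_nhdsWithin_range {x₀ : X} {y : E} (hy : y ∈ (extChartAt I x₀).target) :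
    (extChartAt I x₀).target ∈ 𝓝[range I] y :=
  extChartAt_target_mem_nhdsWithin_of_mem hy

theorem uniqueDiffWithinAt_range {x₀ : X} {y : E} (hy : y ∈ (extChartAt I x₀).target) :
    UniqueDiffWithinAt ℝ (range I) y :=
  I.uniqueDiffOn y (extChartAt_target_subset_range x₀ hy)

theorem contMDiffWithinAt_chart_symm {x₀ : X} {y : E} (hy : y ∈ (extChartAt I x₀).target) :
    ContMDiffWithinAt 𝓘(ℝ, E) I ∞ (extChartAt I x₀).symm (range I) y :=
  (contMDiffOn_extChartAt_symm x₀ y hy).mono_of_mem_nhdsWithin (target_mem_nhdsWithin_range hy)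

theorem contDiffWithinAt_localRep {f : X → X'} {x₀ : X} {q : X'} {y : E}
    (hf : ContMDiffAt I I' ∞ f ((extChartAt I x₀).symm y)) (hy : y ∈ (extChartAt I x₀).target)
    (hq : f ((extChartAt I x₀).symm y) ∈ (extChartAt I' q).source) :
    ContDiffWithinAt ℝ ∞ (localRep I I' f x₀ q) (range I) y := by
  rw [← contMDiffWithinAt_iff_contDiffWithinAt]
  have h1 : ContMDiffAt I' 𝓘(ℝ, E') ∞ (extChartAt I' q) (f ((extChartAt I x₀).symm y)) :=
    contMDiffAt_extChartAt' (by simpa using hq)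
  exact (h1.comp _ hf).comp_contMDiffWithinAt _ (contMDiffWithinAt_chart_symm hy)

theorem localRep_mem_target {f : X → X'} {x₀ : X} {q : X'} {y : E}
    (hq : f ((extChartAt I x₀).symm y) ∈ (extChartAt I' q).source) :
    localRep I I' f x₀ q y ∈ (extChartAt I' q).target :=
  (extChartAt I' q).map_source hq

theorem eventually_mem_source {f : X → X'} {x₀ : X} {q : X'} {y : E}
    (hf : ContinuousAt f ((extChartAt I x₀).symm y)) (hy : y ∈ (extChartAt I x₀).target)
    (hq : f ((extChartAt I x₀).symm y) ∈ (extChartAt I' q).source) :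
    ∀ᶠ y' in 𝓝[range I] y, y' ∈ (extChartAt I x₀).target ∧
      f ((extChartAt I x₀).symm y') ∈ (extChartAt I' q).source := by
  refine Filter.Eventually.and (target_mem_nhdsWithin_range hy) ?_
  have h1 := hf.comp_continuousWithinAt (contMDiffWithinAt_chart_symm hy).continuousWithinAt
  exact h1 ((isOpen_extChartAt_source q).mem_nhds hq)

/-- The chain rule relating the differential of a map to the derivative of its coordinate
expression. -/
theorem tmap_comp_chartInvDeriv {f : X → X'} {x₀ : X} {q : X'} {y : E}
    (hf : ContMDiffAt I I' ∞ f ((extChartAt I x₀).symm y)) (hy : y ∈ (extChartAt I x₀).target)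
    (hq : f ((extChartAt I x₀).symm y) ∈ (extChartAt I' q).source) :
    (tmap I I' f ((extChartAt I x₀).symm y)).comp (chartInvDeriv I x₀ y) =
      (chartInvDeriv I' q (localRep I I' f x₀ q y)).comp
        (fderivWithin ℝ (localRep I I' f x₀ q) (range I) y) := by
  have hu : UniqueMDiffWithinAt 𝓘(ℝ, E) (range I) y :=
    (uniqueDiffWithinAt_range hy).uniqueMDiffWithinAt
  have hs := (contMDiffWithinAt_chart_symm hy).mdifferentiableWithinAt (by simp)
  have h1 : mfderivWithin 𝓘(ℝ, E) I' (f ∘ (extChartAt I x₀).symm) (range I) y =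
      (tmap I I' f ((extChartAt I x₀).symm y)).comp (chartInvDeriv I x₀ y) :=
    mfderiv_comp_mfderivWithin y (hf.mdifferentiableAt (by simp)) hs hu
  have hl := (contDiffWithinAt_localRep hf hy hq).differentiableWithinAt (by simp)
  have h2 : mfderivWithin 𝓘(ℝ, E) I'
      ((extChartAt I' q).symm ∘ localRep I I' f x₀ q) (range I) y =
      (chartInvDeriv I' q (localRep I I' f x₀ q y)).comp
        (mfderivWithin 𝓘(ℝ, E) 𝓘(ℝ, E') (localRep I I' f x₀ q) (range I) y) :=
    mfderivWithin_comp y (mdifferentiableWithinAt_extChartAt_symm (localRep_mem_target hq))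
      hl.mdifferentiableWithinAt (mapsTo_localRep _ _ _ _) hu
  rw [mfderivWithin_eq_fderivWithin] at h2
  refine h1.symm.trans (Eq.trans ?_ h2)
  refine Filter.EventuallyEq.mfderivWithin_eq ?_ ?_
  · filter_upwards [eventually_mem_source hf.continuousAt hy hq] with y' hy'
    simp only [Function.comp, localRep]
    rw [(extChartAt I' q).left_inv hy'.2]
  · simp only [Function.comp, localRep]
    rw [(extChartAt I' q).left_inv hq]

theorem chartInvDeriv_self (x : X) :
    chartInvDeriv I x (extChartAt I x x) = ContinuousLinearMap.id ℝ E :=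
  mfderivWithin_range_extChartAt_symm (I := I) (x := x)

theorem bijective_chartInvDeriv {x₀ : X} {y : E} (hy : y ∈ (extChartAt I x₀).target) :
    Bijective (chartInvDeriv I x₀ y) :=
  (isInvertible_mfderivWithin_extChartAt_symm (I := I) hy).bijective

theorem tmap_eq_fderivWithin {f : X → X'} {x : X} (hf : ContMDiffAt I I' ∞ f x) :
    tmap I I' f x = fderivWithin ℝ (localRep I I' f x (f x)) (range I) (extChartAt I x x) := by
  have h := tmap_comp_chartInvDeriv (f := f) (x₀ := x) (q := f x) (y := extChartAt I x x)
    (by simpa using hf) (mem_extChartAt_target x) (by simp)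
  have h2 : localRep I I' f x (f x) (extChartAt I x x) = extChartAt I' (f x) (f x) := by
    simp [localRep]
  rw [h2, chartInvDeriv_self, chartInvDeriv_self] at h
  simpa using h

/-- The differential of an inverse chart is the derivative of a change of charts, as the preferred
chart at a point has the identity as its differential there. -/
theorem chartInvDeriv_eq_fderivWithin {x₀ z : X} (hz : z ∈ (extChartAt I x₀).source) :
    chartInvDeriv I x₀ (extChartAt I x₀ z) =
      fderivWithin ℝ (localRep I I (id : X → X) x₀ z) (range I) (extChartAt I x₀ z) := by
  have h := tmap_comp_chartInvDeriv (I := I) (I' := I) (f := (id : X → X)) (x₀ := x₀) (q := z)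
    (y := extChartAt I x₀ z) contMDiffAt_id ((extChartAt I x₀).map_source hz)
    (by rw [(extChartAt I x₀).left_inv hz]; exact mem_extChartAt_source z)
  have h2 : localRep I I (id : X → X) x₀ z (extChartAt I x₀ z) = extChartAt I z z := by
    rw [localRep, (extChartAt I x₀).left_inv hz]; rfl
  have h3 : tmap I I (id : X → X) ((extChartAt I x₀).symm (extChartAt I x₀ z)) =
      ContinuousLinearMap.id ℝ E := mfderiv_id
  rw [h2, chartInvDeriv_self, h3] at h
  simpa using h

/-- Pullback in charts. -/
theorem DForm.inChart_pull {k : ℕ} (θ : DForm E' X' k) {f : X → X'} {x₀ : X} {q : X'} {y : E}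
    (hf : ContMDiffAt I I' ∞ f ((extChartAt I x₀).symm y)) (hy : y ∈ (extChartAt I x₀).target)
    (hq : f ((extChartAt I x₀).symm y) ∈ (extChartAt I' q).source) :
    (θ.pull I I' f).inChart I x₀ y =
      (θ.inChart I' q (localRep I I' f x₀ q y)).compContinuousLinearMap
        (fderivWithin ℝ (localRep I I' f x₀ q) (range I) y) := by
  have h := tmap_comp_chartInvDeriv hf hy hq
  have h4 : (extChartAt I' q).symm (localRep I I' f x₀ q y) = f ((extChartAt I x₀).symm y) := by
    simp only [localRep]; rw [(extChartAt I' q).left_inv hq]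
  ext v
  simp only [DForm.inChart, DForm.pull, h4,
    ContinuousAlternatingMap.compContinuousLinearMap_apply]
  congr 1
  funext i
  exact DFunLike.congr_fun h (v i)

theorem DForm.IsSmooth.contDiffWithinAt {k : ℕ} {θ : DForm E X k} (h : θ.IsSmooth I)
    {x₀ : X} {y : E} (hy : y ∈ (extChartAt I x₀).target) :
    ContDiffWithinAt ℝ ∞ (θ.inChart I x₀) (range I) y :=
  (h x₀ y hy).mono_of_mem_nhdsWithin (target_mem_nhdsWithin_range hy)

theorem DForm.isSmooth_of_contDiffWithinAt {k : ℕ} {θ : DForm E X k}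
    (h : ∀ x₀ : X, ∀ y ∈ (extChartAt I x₀).target,
      ContDiffWithinAt ℝ ∞ (θ.inChart I x₀) (range I) y) : θ.IsSmooth I :=
  fun x₀ y hy => (h x₀ y hy).mono (extChartAt_target_subset_range x₀)

/-- Smoothness of a family of alternating forms on a finite-dimensional space can be checked on
constant vectors. -/
theorem contDiffWithinAt_alternating {F V : Type*} [NormedAddCommGroup F]
    [NormedSpace ℝ F] [FiniteDimensional ℝ F] [NormedAddCommGroup V] [NormedSpace ℝ V]
    {k : ℕ} {a : V → F [⋀^Fin k]→L[ℝ] ℝ} {s : Set V} {y : V}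
    (h : ∀ v, ContDiffWithinAt ℝ ∞ (fun z => a z v) s y) : ContDiffWithinAt ℝ ∞ a s y := by
  let b := Module.finBasis ℝ F
  let T : (F [⋀^Fin k]→L[ℝ] ℝ) →ₗ[ℝ] ((Fin k → Fin (Module.finrank ℝ F)) → ℝ) :=
    { toFun := fun f i => f (b ∘ i)
      map_add' := fun f g => by ext; simp
      map_smul' := fun c f => by ext; simp }
  have hT : LinearMap.ker T = ⊥ := by
    rw [LinearMap.ker_eq_bot]
    intro f g hfg
    apply ContinuousAlternatingMap.toAlternatingMap_injective
    refine Module.Basis.ext_alternating b fun i _ => ?_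
    exact congrFun hfg i
  obtain ⟨L, hL⟩ := T.exists_leftInverse_of_injective hT
  have h2 : a = fun z => (LinearMap.toContinuousLinearMap L) (T (a z)) := by
    funext z
    exact (LinearMap.congr_fun hL (a z)).symm
  rw [h2]
  refine (LinearMap.toContinuousLinearMap L).contDiff.comp_contDiffWithinAt ?_
  exact contDiffWithinAt_pi.2 fun i => h _

theorem contDiffWithinAt_compContinuousLinearMap {F G V : Type*} [NormedAddCommGroup F]
    [NormedSpace ℝ F] [NormedAddCommGroup G] [NormedSpace ℝ G]
    [NormedAddCommGroup V] [NormedSpace ℝ V] [FiniteDimensional ℝ G]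
    {k : ℕ} {a : V → F [⋀^Fin k]→L[ℝ] ℝ} {A : V → G →L[ℝ] F}
    {s : Set V} {y : V} (ha : ContDiffWithinAt ℝ ∞ a s y) (hA : ContDiffWithinAt ℝ ∞ A s y) :
    ContDiffWithinAt ℝ ∞ (fun z => (a z).compContinuousLinearMap (A z)) s y := by
  refine contDiffWithinAt_alternating fun v => ?_
  have h1 : ContDiff ℝ ∞ (fun p : (∀ _ : Fin k, G →L[ℝ] F) ×
      ContinuousMultilinearMap ℝ (fun _ : Fin k => F) ℝ => p.2.compContinuousLinearMap p.1) :=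
    ContinuousMultilinearMap.analyticOnNhd_uncurry_compContinuousLinearMap.contDiff
  have h2 : ContDiffWithinAt ℝ ∞ (fun z => ((fun _ : Fin k => A z),
      ContinuousAlternatingMap.toContinuousMultilinearMapCLM ℝ (a z))) s y :=
    (contDiffWithinAt_pi.2 fun _ => hA).prodMk
      ((ContinuousAlternatingMap.toContinuousMultilinearMapCLM ℝ :
        (F [⋀^Fin k]→L[ℝ] ℝ) →L[ℝ] _).contDiff.comp_contDiffWithinAt ha)
  exact (ContinuousMultilinearMap.apply ℝ (fun _ : Fin k => G) ℝ v).contDiff.comp_contDiffWithinAt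
    (h1.comp_contDiffWithinAt h2)

/-- Evaluation of a smooth family of forms on smooth families of vectors is smooth. -/
theorem contDiffWithinAt_alternating_apply {F V : Type*} [NormedAddCommGroup F]
    [NormedSpace ℝ F] [NormedAddCommGroup V] [NormedSpace ℝ V]
    {k : ℕ} {a : V → F [⋀^Fin k]→L[ℝ] ℝ} {A : V → Fin k → F}
    {s : Set V} {y : V} (ha : ContDiffWithinAt ℝ ∞ a s y)
    (hA : ∀ i, ContDiffWithinAt ℝ ∞ (fun z => A z i) s y) :
    ContDiffWithinAt ℝ ∞ (fun z => a z (A z)) s y := by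
  have h1 : ContDiff ℝ ∞ (fun p : (∀ _ : Fin k, ℝ →L[ℝ] F) ×
      ContinuousMultilinearMap ℝ (fun _ : Fin k => F) ℝ => p.2.compContinuousLinearMap p.1) :=
    ContinuousMultilinearMap.analyticOnNhd_uncurry_compContinuousLinearMap.contDiff
  have h2 : ContDiffWithinAt ℝ ∞ (fun z => ((fun i : Fin k =>
      ContinuousLinearMap.toSpanSingleton ℝ (A z i)),
      ContinuousAlternatingMap.toContinuousMultilinearMapCLM ℝ (a z))) s y :=
    (contDiffWithinAt_pi.2 fun i =>
      (ContinuousLinearMap.toSpanSingletonCLE (𝕜 := ℝ) (E := F)).contDiff.comp_contDiffWithinAt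
        (hA i)).prodMk
      ((ContinuousAlternatingMap.toContinuousMultilinearMapCLM ℝ :
        (F [⋀^Fin k]→L[ℝ] ℝ) →L[ℝ] _).contDiff.comp_contDiffWithinAt ha)
  have h3 := (ContinuousMultilinearMap.apply ℝ (fun _ : Fin k => ℝ) ℝ
    (fun _ => 1)).contDiff.comp_contDiffWithinAt (h1.comp_contDiffWithinAt h2)
  refine h3.congr_of_eventuallyEq (Filter.Eventually.of_forall fun z => ?_) ?_ <;>
    simp [Function.comp_def]

theorem contDiffWithinAt_fderivWithin_range {F : Type*} [NormedAddCommGroup F] [NormedSpace ℝ F]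
    {x₀ : X} {y : E} (hy : y ∈ (extChartAt I x₀).target) {f : E → F}
    (hf : ContDiffWithinAt ℝ ∞ f (range I) y) :
    ContDiffWithinAt ℝ ∞ (fderivWithin ℝ f (range I)) (range I) y :=
  hf.fderivWithin_right I.uniqueDiffOn (by simp) (extChartAt_target_subset_range x₀ hy)

/-- Pullbacks of smooth forms are smooth. -/
theorem DForm.IsSmooth.pull [FiniteDimensional ℝ E] {k : ℕ} {θ : DForm E' X' k}
    (hθ : θ.IsSmooth I') {f : X → X'} (hf : ContMDiff I I' ∞ f) :
    (θ.pull I I' f).IsSmooth I := by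
  refine DForm.isSmooth_of_contDiffWithinAt fun x₀ y hy => ?_
  set q := f ((extChartAt I x₀).symm y)
  have hq : f ((extChartAt I x₀).symm y) ∈ (extChartAt I' q).source := mem_extChartAt_source q
  have hl := contDiffWithinAt_localRep (hf _) hy hq
  have h1 : ContDiffWithinAt ℝ ∞ (fun y =>
      (θ.inChart I' q (localRep I I' f x₀ q y)).compContinuousLinearMap
        (fderivWithin ℝ (localRep I I' f x₀ q) (range I) y)) (range I) y :=
    contDiffWithinAt_compContinuousLinearMap
      ((hθ.contDiffWithinAt (localRep_mem_target hq)).comp y hl (mapsTo_localRep _ _ _ _))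
      (contDiffWithinAt_fderivWithin_range hy hl)
  refine h1.congr_of_eventuallyEq ?_ (DForm.inChart_pull θ (hf _) hy hq)
  filter_upwards [eventually_mem_source hf.continuous.continuousAt hy hq] with y' hy'
  exact DForm.inChart_pull θ (hf _) hy'.1 hy'.2

theorem two_le_infty : minSmoothness ℝ 2 ≤ (∞ : WithTop ℕ∞) := by
  rw [minSmoothness_of_isRCLikeNormedField]
  exact ENat.LEInfty.out

theorem mem_closure_interior_range {x₀ : X} {y : E} (hy : y ∈ (extChartAt I x₀).target) :
    y ∈ closure (interior (range I)) :=
  I.range_subset_closure_interior (extChartAt_target_subset_range x₀ hy)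

/-- The exterior derivative of a pullback, in coordinates. -/
theorem DForm.extDerivWithin_inChart_pull {k : ℕ} {θ : DForm E' X' k}
    (hθ : θ.IsSmooth I') {f : X → X'} (hf : ContMDiff I I' ∞ f) {x₀ : X} {q : X'} {y : E}
    (hy : y ∈ (extChartAt I x₀).target)
    (hq : f ((extChartAt I x₀).symm y) ∈ (extChartAt I' q).source) :
    extDerivWithin ((θ.pull I I' f).inChart I x₀) (range I) y =
      (extDerivWithin (θ.inChart I' q) (range I') (localRep I I' f x₀ q y)).compContinuousLinearMap
        (fderivWithin ℝ (localRep I I' f x₀ q) (range I) y) := by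
  rw [← extDerivWithin_pullback (r := ∞)
    ((hθ.contDiffWithinAt (localRep_mem_target hq)).differentiableWithinAt (by simp))
    (contDiffWithinAt_localRep (hf _) hy hq) two_le_infty I.uniqueDiffOn
    (mem_closure_interior_range hy) (extChartAt_target_subset_range x₀ hy)
    (mapsTo_localRep _ _ _ _)]
  refine Filter.EventuallyEq.extDerivWithin_eq ?_ (DForm.inChart_pull θ (hf _) hy hq)
  filter_upwards [eventually_mem_source hf.continuous.continuousAt hy hq] with y' hy'
  exact DForm.inChart_pull θ (hf _) hy'.1 hy'.2

theorem DForm.pull_id {k : ℕ} (θ : DForm E X k) : θ.pull I I (id : X → X) = θ := by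
  funext x
  have h3 : tmap I I (id : X → X) x = ContinuousLinearMap.id ℝ E := mfderiv_id
  ext v
  simp [DForm.pull, h3]

/-- The exterior derivative may be computed in any preferred chart. -/
theorem DForm.inChart_extd {k : ℕ} {θ : DForm E X k} (hθ : θ.IsSmooth I) {x₀ : X} {y : E}
    (hy : y ∈ (extChartAt I x₀).target) :
    (θ.extd I).inChart I x₀ y = extDerivWithin (θ.inChart I x₀) (range I) y := by
  set z := (extChartAt I x₀).symm y with hz
  have hzs : z ∈ (extChartAt I x₀).source := (extChartAt I x₀).map_target hy
  have hyz : extChartAt I x₀ z = y := (extChartAt I x₀).right_inv hy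
  have h := DForm.extDerivWithin_inChart_pull hθ (contMDiff_id (M := X)) (x₀ := x₀) (q := z) hy
    (mem_extChartAt_source z)
  rw [DForm.pull_id] at h
  have h2 := chartInvDeriv_eq_fderivWithin (I := I) hzs
  rw [hyz] at h2
  rw [h, ← h2]
  rfl

/-- The exterior derivative of a smooth form is smooth. -/
theorem DForm.IsSmooth.extd {k : ℕ} {θ : DForm E X k} (hθ : θ.IsSmooth I) :
    (θ.extd I).IsSmooth I := by
  refine DForm.isSmooth_of_contDiffWithinAt fun x₀ y hy => ?_
  have h0 : ContDiff ℝ ∞ (fun f : E →L[ℝ] E [⋀^Fin k]→L[ℝ] ℝ =>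
      ContinuousAlternatingMap.alternatizeUncurryFinCLM ℝ E ℝ f) :=
    ContinuousLinearMap.contDiff _
  have h1 : ContDiffWithinAt ℝ ∞ (extDerivWithin (θ.inChart I x₀) (range I)) (range I) y :=
    h0.comp_contDiffWithinAt (contDiffWithinAt_fderivWithin_range hy (hθ.contDiffWithinAt hy))
  refine h1.congr_of_eventuallyEq ?_ (DForm.inChart_extd hθ hy)
  filter_upwards [target_mem_nhdsWithin_range hy] with y' hy'
  exact DForm.inChart_extd hθ hy'

/-- `d ∘ d = 0`. -/
theorem DForm.extd_extd {k : ℕ} {θ : DForm E X k} (hθ : θ.IsSmooth I) (x : X) :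
    (θ.extd I).extd I x = 0 := by
  have hx := mem_extChartAt_target (I := I) x
  have h1 : extDerivWithin ((θ.extd I).inChart I x) (range I) (extChartAt I x x) =
      extDerivWithin (extDerivWithin (θ.inChart I x) (range I)) (range I) (extChartAt I x x) := by
    refine Filter.EventuallyEq.extDerivWithin_eq ?_ (DForm.inChart_extd hθ hx)
    filter_upwards [target_mem_nhdsWithin_range hx] with y' hy'
    exact DForm.inChart_extd hθ hy'
  exact h1.trans (extDerivWithin_extDerivWithin_apply (hθ.contDiffWithinAt hx) two_le_infty
    I.uniqueDiffOn (mem_closure_interior_range hx) (extChartAt_target_subset_range x hx))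

/-- The exterior derivative commutes with pullbacks. -/
theorem DForm.extd_pull {k : ℕ} {θ : DForm E' X' k} (hθ : θ.IsSmooth I') {f : X → X'}
    (hf : ContMDiff I I' ∞ f) (x : X) :
    (θ.pull I I' f).extd I x = (θ.extd I' (f x)).compContinuousLinearMap (tmap I I' f x) := by
  have hx := mem_extChartAt_target (I := I) x
  have hs : (extChartAt I x).symm (extChartAt I x x) = x := by simp
  have h := DForm.extDerivWithin_inChart_pull hθ hf (x₀ := x) (q := f x) hx (by rw [hs]; simp)
  have h2 : localRep I I' f x (f x) (extChartAt I x x) = extChartAt I' (f x) (f x) := by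
    rw [localRep, hs]
  rw [h2, ← tmap_eq_fderivWithin (hf x)] at h
  exact h

end FormCalculus

/-! ### The divergence theorem on a half-space -/

section HalfSpace

open MeasureTheory

variable {n : ℕ}

/-- The divergence theorem on the half-space for compactly supported vector fields whose normal
component vanishes on the boundary hyperplane. -/
theorem integral_divergence_halfSpace (G : Fin (n + 1) → Euc (n + 1) → ℝ)
    (hG : ∀ i, ContDiffOn ℝ 1 (G i) (range (𝓡∂ (n + 1))))
    (K : Set (Euc (n + 1))) (hK : IsCompact K) (hGK : ∀ i, ∀ y ∉ K, G i y = 0)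
    (hG0 : ∀ y, y 0 = 0 → G 0 y = 0) :
    ∫ y in range (𝓡∂ (n + 1)),
      ∑ i, fderivWithin ℝ (G i) (range (𝓡∂ (n + 1))) y (EuclideanSpace.single i 1) = 0 := by
  set HS := range (𝓡∂ (n + 1)) with hHS
  have hHS' : HS = {y | 0 ≤ y 0} := range_euclideanHalfSpace (n + 1)
  have hint : interior HS = {y | 0 < y 0} := interior_range_modelWithCornersEuclideanHalfSpace _
  obtain ⟨R, hR, hKR⟩ : ∃ R : ℝ, 0 < R ∧ K ⊆ Metric.ball 0 R := by
    obtain ⟨R, hR⟩ := hK.isBounded.subset_ball_lt 0 0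
    exact ⟨R, hR⟩
  set D : Euc (n + 1) → ℝ := fun y =>
    ∑ i, fderivWithin ℝ (G i) HS y (EuclideanSpace.single i 1) with hD
  let eL : Euc (n + 1) ≃L[ℝ] (Fin (n + 1) → ℝ) := PiLp.continuousLinearEquiv 2 ℝ (fun _ => ℝ)
  -- integrate over the box `[0, R] × [-R, R]ⁿ`; its face in the boundary hyperplane is the only one
  -- which can meet `K`
  let a : Fin (n + 1) → ℝ := Fin.cons 0 (fun _ => -R)
  let b : Fin (n + 1) → ℝ := fun _ => R
  have ha0 : a 0 = 0 := rfl
  have has : ∀ i, i ≠ 0 → a i = -R := fun i hi => by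
    obtain ⟨k, rfl⟩ := Fin.exists_succ_eq.2 hi; rfl
  have hle : a ≤ b := fun i => by
    by_cases hi : i = 0
    · subst hi; simpa [ha0, b] using hR.le
    · rw [has i hi]; simp only [b]; linarith
  have hbig : ∀ y : Euc (n + 1), ∀ i, R ≤ |y i| → y ∉ K := fun y i hi hy => by
    have h1 := hKR hy
    rw [mem_ball_zero_iff] at h1
    have h2 := PiLp.norm_apply_le y i
    rw [Real.norm_eq_abs] at h2
    linarith
  have hD0 : ∀ y ∉ K, D y = 0 := fun y hy => by
    simp only [hD]
    refine Finset.sum_eq_zero fun i _ => ?_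
    have h1 : G i =ᶠ[𝓝[HS] y] fun _ => 0 := by
      refine mem_nhdsWithin_of_mem_nhds ?_
      filter_upwards [hK.isClosed.isOpen_compl.mem_nhds hy] with z hz using hGK i z hz
    rw [h1.fderivWithin_eq (hGK i y hy)]
    simp
  have hmaps : ∀ x ∈ Icc a b, eL.symm x ∈ HS := fun x hx => by
    rw [hHS']; exact hx.1 0
  have hdc : ∀ i, ContinuousOn (fderivWithin ℝ (G i) HS) HS := fun i =>
    (hG i).continuousOn_fderivWithin (𝓡∂ (n + 1)).uniqueDiffOn (by simp)
  have hstep : ∫ y in HS, D y = ∫ x in Icc a b, D (eL.symm x) := by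
    have h1 : ∫ y in HS, D y = ∫ y in eL ⁻¹' (Icc a b), D y := by
      refine setIntegral_eq_of_subset_of_forall_sdiff_eq_zero ?_ ?_ ?_
      · rw [hHS']; exact (isClosed_le continuous_const (by fun_prop)).measurableSet
      · intro y hy
        have := hmaps _ hy
        simpa using this
      · intro y hy
        apply hD0
        obtain ⟨hy1, hy2⟩ := hy
        rw [hHS'] at hy1
        by_contra hyK
        apply hy2
        have hlt : ∀ i, |y i| < R := fun i => by
          by_contra hcon
          exact hbig y i (not_lt.1 hcon) hyK
        refine ⟨fun i => ?_, fun i => (le_abs_self _).trans (hlt i).le⟩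
        by_cases hi : i = 0
        · subst hi; exact hy1
        · rw [has i hi]; exact (neg_le_neg (hlt i).le).trans (neg_abs_le (y i))
    rw [h1]
    have hmp : MeasurePreserving eL volume volume := PiLp.volume_preserving_ofLp _
    have h2 := hmp.setIntegral_preimage_emb eL.toHomeomorph.measurableEmbedding
      (fun x => D (eL.symm x)) (Icc a b)
    simpa using h2
  rw [hstep]
  have hdiv := integral_divergence_of_hasFDerivAt_off_countable' a b hle
    (fun i x => G i (eL.symm x))
    (fun i x => (fderivWithin ℝ (G i) HS (eL.symm x)).comp
      (eL.symm : (Fin (n + 1) → ℝ) →L[ℝ] Euc (n + 1)))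
    ∅ countable_empty ?_ ?_ ?_
  · have h3 : ∀ x, ∑ i, ((fderivWithin ℝ (G i) HS (eL.symm x)).comp
        (eL.symm : (Fin (n + 1) → ℝ) →L[ℝ] Euc (n + 1))) (Pi.single i 1) =
          D (eL.symm x) := fun x => by
      simp only [hD]
      refine Finset.sum_congr rfl fun i _ => ?_
      rfl
    simp only [h3] at hdiv
    rw [hdiv]
    refine Finset.sum_eq_zero fun i _ => ?_
    have hfront : ∀ x, G i (eL.symm (i.insertNth (b i) x)) = 0 := fun x => by
      apply hGK i _ (hbig _ i _)
      have : (eL.symm (i.insertNth (b i) x)) i = R := by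
        change (i.insertNth (b i) x : Fin (n + 1) → ℝ) i = R
        simp [b]
      rw [this]; exact le_abs_self R
    have hback : ∀ x, G i (eL.symm (i.insertNth (a i) x)) = 0 := fun x => by
      have h4 : (eL.symm (i.insertNth (a i) x)) i = a i := by
        change (i.insertNth (a i) x : Fin (n + 1) → ℝ) i = a i
        simp
      by_cases hi : i = 0
      · subst hi; exact hG0 _ h4
      · apply hGK i _ (hbig _ i _)
        rw [h4, has i hi, abs_neg]; exact le_abs_self R
    simp [hfront, hback]
  · exact fun i => (hG i).continuousOn.comp eL.symm.continuous.continuousOn hmaps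
  · intro x hx i
    have h4 : eL.symm x ∈ interior HS := by
      rw [hint]; exact (hx.1 0 (mem_univ _)).1
    have h5 : HasFDerivAt (G i) (fderivWithin ℝ (G i) HS (eL.symm x)) (eL.symm x) :=
      (((hG i).differentiableOn (by simp)) _ (interior_subset h4)).hasFDerivWithinAt.hasFDerivAt
        (mem_interior_iff_mem_nhds.1 h4)
    exact h5.comp x eL.symm.hasFDerivAt
  · refine ContinuousOn.integrableOn_compact isCompact_Icc ?_
    refine continuousOn_finsetSum _ fun i _ => ?_
    exact (((hdc i).comp eL.symm.continuous.continuousOn hmaps).clm_comp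
      continuousOn_const).clm_apply continuousOn_const

end HalfSpace

/-! ### Top-degree forms -/

section Density

open MeasureTheory

variable {d : ℕ}

theorem topForm_comp_apply (f : Euc d [⋀^Fin d]→L[ℝ] ℝ) (A : Euc d →L[ℝ] Euc d) :
    f.compContinuousLinearMap A (fun i => EuclideanSpace.single i 1) =
      A.det * f (fun i => EuclideanSpace.single i 1) := by
  let b := (EuclideanSpace.basisFun (Fin d) ℝ).toBasis
  have hb : (fun i => EuclideanSpace.single i (1 : ℝ)) = b := by
    funext i; simp [b]
  have h1 := f.toAlternatingMap.eq_smul_basis_det b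
  have h2 : ∀ v, f v = f b * b.det v := fun v => by
    have := congrArg (fun g => g v) h1
    simpa using this
  rw [hb]
  have h3 : f.compContinuousLinearMap A b = f (A ∘ b) := rfl
  rw [h3, h2 (A ∘ b)]
  have h4 := b.det_comp (A : Euc d →ₗ[ℝ] Euc d) b
  rw [Module.Basis.det_self, mul_one] at h4
  have h5 : b.det (A ∘ b) = A.det := h4
  rw [h5, mul_comm]

theorem topForm_apply_ne_zero {f : Euc d [⋀^Fin d]→L[ℝ] ℝ} (hf : f ≠ 0) :
    f (fun i => EuclideanSpace.single i 1) ≠ 0 := by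
  intro h
  apply hf
  apply ContinuousAlternatingMap.toAlternatingMap_injective
  let b := (EuclideanSpace.basisFun (Fin d) ℝ).toBasis
  have hb : (fun i => EuclideanSpace.single i (1 : ℝ)) = b := by
    funext i; simp [b]
  rw [f.toAlternatingMap.eq_smul_basis_det b]
  rw [hb] at h
  change f b • b.det = 0
  rw [h, zero_smul]

theorem topForm_eq_smul {Ω : Euc d [⋀^Fin d]→L[ℝ] ℝ} (hΩ : Ω ≠ 0) (η : Euc d [⋀^Fin d]→L[ℝ] ℝ) :
    η = (η (fun i => EuclideanSpace.single i 1) / Ω (fun i => EuclideanSpace.single i 1)) • Ω := by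
  apply ContinuousAlternatingMap.toAlternatingMap_injective
  let b := (EuclideanSpace.basisFun (Fin d) ℝ).toBasis
  have hb : (fun i => EuclideanSpace.single i (1 : ℝ)) = b := by
    funext i; simp [b]
  refine Module.Basis.ext_alternating b fun v hv => ?_
  have h := topForm_apply_ne_zero hΩ
  obtain ⟨σ, rfl⟩ : ∃ σ : Equiv.Perm (Fin d), v = σ :=
    ⟨Equiv.ofBijective v (Finite.injective_iff_bijective.1 hv), rfl⟩
  have h1 := η.toAlternatingMap.map_perm b σ
  have h2 := Ω.toAlternatingMap.map_perm b σ
  change η (b ∘ σ) = _ / _ * Ω (b ∘ σ)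
  change η (b ∘ σ) = Equiv.Perm.sign σ • η b at h1
  change Ω (b ∘ σ) = Equiv.Perm.sign σ • Ω b at h2
  rw [h1, h2, hb]
  rw [hb] at h
  simp only [Units.smul_def, zsmul_eq_mul]
  field_simp

end Density

/-! ### Densities on manifolds with boundary -/

section Stokes

open MeasureTheory

variable {n : ℕ} {N : Type*} [TopologicalSpace N] [ChartedSpace (EuclideanHalfSpace (n + 1)) N]
  [IsManifold (𝓡∂ (n + 1)) ∞ N]

/-- The coefficient of a top-degree form in the preferred chart at `x₀`. -/
def chartDensity (Ω : DForm (Euc (n + 1)) N (n + 1)) (x₀ : N) (y : Euc (n + 1)) : ℝ :=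
  Ω.inChart (𝓡∂ (n + 1)) x₀ y (fun i => EuclideanSpace.single i 1)

theorem DForm.inChart_ne_zero {k : ℕ} {θ : DForm (Euc (n + 1)) N k} {x₀ : N} {y : Euc (n + 1)}
    (hy : y ∈ (extChartAt (𝓡∂ (n + 1)) x₀).target)
    (h : θ ((extChartAt (𝓡∂ (n + 1)) x₀).symm y) ≠ 0) : θ.inChart (𝓡∂ (n + 1)) x₀ y ≠ 0 := by
  intro h0
  apply h
  ext v
  have hs := (bijective_chartInvDeriv (I := 𝓡∂ (n + 1)) hy).surjective
  choose w hw using fun i => hs (v i)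
  have := congrArg (fun g => g w) h0
  simp only [DForm.inChart, ContinuousAlternatingMap.compContinuousLinearMap_apply] at this
  have hv : (⇑(chartInvDeriv (𝓡∂ (n + 1)) x₀ y) ∘ w) = v := funext hw
  rw [hv] at this
  simpa using this

theorem chartDensity_ne_zero {Ω : DForm (Euc (n + 1)) N (n + 1)} (hΩ : ∀ x, Ω x ≠ 0) {x₀ : N}
    {y : Euc (n + 1)} (hy : y ∈ (extChartAt (𝓡∂ (n + 1)) x₀).target) :
    chartDensity Ω x₀ y ≠ 0 :=
  topForm_apply_ne_zero (DForm.inChart_ne_zero hy (hΩ _))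

theorem continuousOn_chartDensity {Ω : DForm (Euc (n + 1)) N (n + 1)}
    (hΩ : Ω.IsSmooth (𝓡∂ (n + 1))) (x₀ : N) :
    ContinuousOn (chartDensity Ω x₀) (extChartAt (𝓡∂ (n + 1)) x₀).target := fun y hy =>
  (ContinuousAlternatingMap.apply ℝ (Euc (n + 1)) ℝ
    (fun i => EuclideanSpace.single i 1)).continuous.continuousAt.comp_continuousWithinAt
    ((hΩ x₀).continuousOn y hy)

theorem chartDensity_coordChange (Ω : DForm (Euc (n + 1)) N (n + 1)) {a b : N} {y : Euc (n + 1)}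
    (hy : y ∈ (extChartAt (𝓡∂ (n + 1)) a).target)
    (hb : (extChartAt (𝓡∂ (n + 1)) a).symm y ∈ (extChartAt (𝓡∂ (n + 1)) b).source) :
    chartDensity Ω a y =
      (fderivWithin ℝ (localRep (𝓡∂ (n + 1)) (𝓡∂ (n + 1)) (id : N → N) a b)
        (range (𝓡∂ (n + 1))) y).det *
      chartDensity Ω b (localRep (𝓡∂ (n + 1)) (𝓡∂ (n + 1)) (id : N → N) a b y) := by
  have h := DForm.inChart_pull Ω (contMDiffAt_id (M := N)) hy hb
  rw [DForm.pull_id] at h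
  rw [chartDensity, h, topForm_comp_apply]
  rfl

theorem measurableSet_extChartAt_target (x : N) :
    MeasurableSet (extChartAt (𝓡∂ (n + 1)) x).target := by
  rw [extChartAt_target]
  refine (((chartAt _ x).open_target.preimage (𝓡∂ (n + 1)).continuous_symm).measurableSet).inter ?_
  exact (𝓡∂ (n + 1)).isClosed_range.measurableSet

/-- Change of variables: the integral of a function against the density defined by a top-degree
form does not depend on the chart, provided the function vanishes outside of both charts. -/
theorem integral_chartDensity_eq (Ω : DForm (Euc (n + 1)) N (n + 1)) {f : N → ℝ} {a b : N}
    (hfa : ∀ x ∉ (extChartAt (𝓡∂ (n + 1)) a).source, f x = 0)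
    (hfb : ∀ x ∉ (extChartAt (𝓡∂ (n + 1)) b).source, f x = 0) :
    ∫ y in (extChartAt (𝓡∂ (n + 1)) a).target,
      f ((extChartAt (𝓡∂ (n + 1)) a).symm y) * |chartDensity Ω a y| =
    ∫ y in (extChartAt (𝓡∂ (n + 1)) b).target,
      f ((extChartAt (𝓡∂ (n + 1)) b).symm y) * |chartDensity Ω b y| := by
  set I := 𝓡∂ (n + 1) with hI
  set τ := localRep I I (id : N → N) a b with hτ
  have hmeas : ∀ a b : N, MeasurableSet ((extChartAt I a).target ∩
      (extChartAt I a).symm ⁻¹' (extChartAt I b).source) := fun a b => by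
    obtain ⟨u, hu, hu2⟩ := (continuousOn_iff'.1 (continuousOn_extChartAt_symm (I := I) a)) _
      (isOpen_extChartAt_source (I := I) b)
    rw [inter_comm, hu2]
    exact hu.measurableSet.inter (measurableSet_extChartAt_target a)
  have hred : ∀ a b : N, (∀ x ∉ (extChartAt I b).source, f x = 0) →
      ∫ y in (extChartAt I a).target, f ((extChartAt I a).symm y) * |chartDensity Ω a y| =
      ∫ y in (extChartAt I a).target ∩ (extChartAt I a).symm ⁻¹' (extChartAt I b).source,
        f ((extChartAt I a).symm y) * |chartDensity Ω a y| := fun a b hfb => by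
    refine setIntegral_eq_of_subset_of_forall_sdiff_eq_zero (measurableSet_extChartAt_target a)
      inter_subset_left ?_
    rintro y ⟨hy1, hy2⟩
    rw [hfb _ fun h => hy2 ⟨hy1, h⟩, zero_mul]
  rw [hred a b hfb, hred b a hfa]
  have himg : (extChartAt I b).target ∩ (extChartAt I b).symm ⁻¹' (extChartAt I a).source =
      τ '' ((extChartAt I a).target ∩ (extChartAt I a).symm ⁻¹' (extChartAt I b).source) := by
    ext y
    constructor
    · rintro ⟨hy1, hy2⟩
      refine ⟨extChartAt I a ((extChartAt I b).symm y), ⟨(extChartAt I a).map_source hy2, ?_⟩, ?_⟩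
      · simp only [mem_preimage, (extChartAt I a).left_inv hy2]
        exact (extChartAt I b).map_target hy1
      · simp only [hτ, localRep, (extChartAt I a).left_inv hy2, id]
        exact (extChartAt I b).right_inv hy1
    · rintro ⟨z, ⟨hz1, hz2⟩, rfl⟩
      refine ⟨(extChartAt I b).map_source hz2, ?_⟩
      simp only [hτ, localRep, mem_preimage, id, (extChartAt I b).left_inv hz2]
      exact (extChartAt I a).map_target hz1
  rw [himg, integral_image_eq_integral_abs_det_fderiv_smul volume (hmeas a b)
    (f' := fun y => fderivWithin ℝ τ (range I) y)]
  · refine setIntegral_congr_fun (hmeas a b) fun y hy => ?_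
    simp only [smul_eq_mul]
    rw [chartDensity_coordChange Ω hy.1 hy.2, abs_mul]
    have : (extChartAt I b).symm (localRep I I (id : N → N) a b y) = (extChartAt I a).symm y :=
      (extChartAt I b).left_inv hy.2
    rw [hτ, this]
    ring
  · intro y hy
    exact ((contDiffWithinAt_localRep contMDiffAt_id hy.1 hy.2).differentiableWithinAt
      (by simp)).hasFDerivWithinAt.mono (inter_subset_left.trans (extChartAt_target_subset_range a))
  · intro y hy z hz hyz
    have h1 := congrArg (extChartAt I b).symm hyz
    simp only [hτ, localRep, id] at h1
    rw [(extChartAt I b).left_inv hy.2, (extChartAt I b).left_inv hz.2] at h1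
    exact (extChartAt I a).symm.injOn hy.1 hz.1 h1

/-- Boundary points are the points with vanishing normal coordinate, in any chart. -/
theorem mem_boundary_of_chart {x₀ : N} {y : Euc (n + 1)}
    (hy : y ∈ (extChartAt (𝓡∂ (n + 1)) x₀).target) (hy0 : y 0 = 0) :
    (extChartAt (𝓡∂ (n + 1)) x₀).symm y ∈ (𝓡∂ (n + 1)).boundary N := by
  set z := (extChartAt (𝓡∂ (n + 1)) x₀).symm y with hz
  have hzs : z ∈ (extChartAt (𝓡∂ (n + 1)) x₀).source := (extChartAt (𝓡∂ (n + 1)) x₀).map_target hy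
  change (𝓡∂ (n + 1)).IsBoundaryPoint z
  rw [ModelWithCorners.isBoundaryPoint_iff_not_isInteriorPoint,
    (𝓡∂ (n + 1)).isInteriorPoint_iff_of_mem_atlas (n := ∞) (by simp) (chart_mem_atlas _ x₀)
      (by simpa using hzs)]
  intro h
  have h1 : extChartAt (𝓡∂ (n + 1)) x₀ z ∈ interior (range (𝓡∂ (n + 1))) :=
    interior_mono (extChartAt_target_subset_range x₀) h
  rw [interior_range_modelWithCornersEuclideanHalfSpace,
    (extChartAt (𝓡∂ (n + 1)) x₀).right_inv hy] at h1
  exact absurd hy0 (ne_of_gt h1)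

theorem chart_zero_of_mem_boundary {z : N} (hz : z ∈ (𝓡∂ (n + 1)).boundary N) :
    extChartAt (𝓡∂ (n + 1)) z z 0 = 0 := by
  have h := ModelWithCorners.isBoundaryPoint_iff.1 hz
  rw [frontier_range_modelWithCornersEuclideanHalfSpace] at h
  exact h.symm

/-- Directions parallel to the boundary hyperplane of a chart are tangent to the boundary. -/
theorem chartInvDeriv_apply_zero {x₀ : N} {y : Euc (n + 1)}
    (hy : y ∈ (extChartAt (𝓡∂ (n + 1)) x₀).target) (hy0 : y 0 = 0) {u : Euc (n + 1)}
    (hu : u 0 = 0) : chartInvDeriv (𝓡∂ (n + 1)) x₀ y u 0 = 0 := by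
  set I := 𝓡∂ (n + 1) with hI
  set z := (extChartAt I x₀).symm y with hz
  have hzs : z ∈ (extChartAt I x₀).source := (extChartAt I x₀).map_target hy
  have hyz : extChartAt I x₀ z = y := (extChartAt I x₀).right_inv hy
  have h2 := chartInvDeriv_eq_fderivWithin (I := I) hzs
  rw [hyz] at h2
  rw [h2]
  set τ := localRep I I (id : N → N) x₀ z
  have hd : HasFDerivWithinAt τ (fderivWithin ℝ τ (range I) y) (range I) y :=
    ((contDiffWithinAt_localRep contMDiffAt_id hy (mem_extChartAt_source z)).differentiableWithinAt
      (by simp)).hasFDerivWithinAt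
  have hr : range I = {y : Euc (n + 1) | 0 ≤ y 0} := range_euclideanHalfSpace (n + 1)
  have hc : HasDerivAt (fun t : ℝ => y + t • u) u 0 := by
    simpa using ((hasDerivAt_id (0 : ℝ)).smul_const u).const_add y
  have hm : ∀ t : ℝ, y + t • u ∈ range I := fun t => by
    rw [hr]; simp [hy0, hu]
  have hd' : HasFDerivWithinAt τ (fderivWithin ℝ τ (range I) y) (range I)
      ((fun t : ℝ => y + t • u) 0) := by simpa using hd
  have h3 : HasDerivAt (τ ∘ fun t : ℝ => y + t • u) (fderivWithin ℝ τ (range I) y u) 0 :=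
    hd'.comp_hasDerivAt 0 hc (Filter.Eventually.of_forall hm)
  have h4 : HasDerivAt (fun t : ℝ => (τ (y + t • u)) 0) (fderivWithin ℝ τ (range I) y u 0) 0 :=
    (EuclideanSpace.proj 0 : Euc (n + 1) →L[ℝ] ℝ).hasFDerivAt.comp_hasDerivAt 0 h3
  have hmin : IsLocalMin (fun t : ℝ => (τ (y + t • u)) 0) 0 := by
    refine Filter.Eventually.of_forall fun t => ?_
    have h5 : τ (y + (0 : ℝ) • u) 0 = 0 := by
      have : τ y = extChartAt I z z := rfl
      rw [zero_smul, add_zero, this]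
      exact chart_zero_of_mem_boundary (mem_boundary_of_chart hy hy0)
    have h6 : τ (y + t • u) ∈ range I := mapsTo_localRep _ _ _ univ (mem_univ _)
    rw [hr] at h6
    simp only [h5]; exact h6
  exact hmin.hasDerivAt_eq_zero h4

end Stokes

/-! ### Linearity and locality of the exterior derivative -/

section FormAlgebra

variable {E : Type*} [NormedAddCommGroup E] [NormedSpace ℝ E]
  {H : Type*} [TopologicalSpace H] {I : ModelWithCorners ℝ E H}
  {X : Type*} [TopologicalSpace X] [ChartedSpace H X] [IsManifold I ∞ X]

theorem contDiffWithinAt_comp_chart_symm {f : X → ℝ} (hf : ContMDiff I 𝓘(ℝ, ℝ) ∞ f) {x₀ : X} {y : E}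
    (hy : y ∈ (extChartAt I x₀).target) :
    ContDiffWithinAt ℝ ∞ (fun y => f ((extChartAt I x₀).symm y)) (range I) y := by
  rw [← contMDiffWithinAt_iff_contDiffWithinAt]
  exact (hf _).comp_contMDiffWithinAt _ (contMDiffWithinAt_chart_symm hy)

theorem DForm.IsSmooth.smul {k : ℕ} {θ : DForm E X k} (hθ : θ.IsSmooth I) {f : X → ℝ}
    (hf : ContMDiff I 𝓘(ℝ, ℝ) ∞ f) : DForm.IsSmooth I (fun x => f x • θ x : DForm E X k) :=
  DForm.isSmooth_of_contDiffWithinAt fun _ _ hy =>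
    (contDiffWithinAt_comp_chart_symm hf hy).smul (hθ.contDiffWithinAt hy)

theorem DForm.extd_sum {k : ℕ} {ι : Type*} (s : Finset ι) (θ : ι → DForm E X k)
    (hθ : ∀ i ∈ s, (θ i).IsSmooth I) (x : X) :
    DForm.extd I (fun x => ∑ i ∈ s, θ i x : DForm E X k) x = ∑ i ∈ s, (θ i).extd I x := by
  have h1 : DForm.inChart I (fun x => ∑ i ∈ s, θ i x : DForm E X k) x =
      fun y => ∑ i ∈ s, (θ i).inChart I x y := by
    funext y
    ext v
    simp [DForm.inChart, ContinuousAlternatingMap.sum_apply]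
  have hx := mem_extChartAt_target (I := I) x
  have h2 := fderivWithin_fun_sum (u := s) (A := fun i => (θ i).inChart I x)
    (uniqueDiffWithinAt_range hx)
    (fun i hi => ((hθ i hi).contDiffWithinAt hx).differentiableWithinAt (by simp))
  simp only [DForm.extd, extDerivWithin, h1]
  rw [h2, ContinuousAlternatingMap.alternatizeUncurryFin, map_sum]
  rfl

theorem DForm.inChart_eq_zero {k : ℕ} {θ : DForm E X k} {x₀ : X} {y : E}
    (h : θ ((extChartAt I x₀).symm y) = 0) : θ.inChart I x₀ y = 0 := by
  rw [DForm.inChart, h]; rfl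

theorem DForm.extd_eq_zero_of_eventually {k : ℕ} {θ : DForm E X k} {x : X}
    (h : ∀ᶠ z in 𝓝 x, θ z = 0) : θ.extd I x = 0 := by
  have hx := mem_extChartAt_target (I := I) x
  have h1 : θ.inChart I x =ᶠ[𝓝[range I] (extChartAt I x x)] fun _ => 0 := by
    have hc := (contMDiffWithinAt_chart_symm hx).continuousWithinAt
    have h2 : ∀ᶠ z in 𝓝 ((extChartAt I x).symm (extChartAt I x x)), θ z = 0 := by simpa using h
    filter_upwards [hc h2] with y hy
    exact DForm.inChart_eq_zero hy
  simp only [DForm.extd, extDerivWithin]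
  rw [h1.fderivWithin_eq (h1.self_of_nhdsWithin (mem_range_self _)), fderivWithin_fun_const]
  exact map_zero (ContinuousAlternatingMap.alternatizeUncurryFinCLM ℝ E ℝ)

end FormAlgebra

/-! ### Stokes' theorem -/

section Stokes

open MeasureTheory

variable {n : ℕ} {N : Type*} [TopologicalSpace N] [ChartedSpace (EuclideanHalfSpace (n + 1)) N]
  [IsManifold (𝓡∂ (n + 1)) ∞ N]

/-- The quotient `η / Ω` of two top-degree forms, read off on the standard basis of the tangent
space; it is `0` where `Ω` vanishes. -/
def formRatio (η Ω : DForm (Euc (n + 1)) N (n + 1)) (x : N) : ℝ :=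
  η x (fun i => EuclideanSpace.single i 1) / Ω x (fun i => EuclideanSpace.single i 1)

theorem eq_formRatio_smul {Ω : DForm (Euc (n + 1)) N (n + 1)} (η : DForm (Euc (n + 1)) N (n + 1))
    {x : N} (hΩ : Ω x ≠ 0) : η x = formRatio η Ω x • Ω x :=
  topForm_eq_smul hΩ (η x)

theorem eq_formRatio {η Ω : DForm (Euc (n + 1)) N (n + 1)} {x : N} (hΩ : Ω x ≠ 0) {c : ℝ}
    (h : η x = c • Ω x) : c = formRatio η Ω x := by
  have := topForm_apply_ne_zero hΩ
  rw [formRatio, h]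
  simp only [ContinuousAlternatingMap.smul_apply, smul_eq_mul]
  field_simp

theorem chartDensity_eq_mul {η Ω : DForm (Euc (n + 1)) N (n + 1)} {x₀ : N} {y : Euc (n + 1)} {c : ℝ}
    (h : η ((extChartAt (𝓡∂ (n + 1)) x₀).symm y) =
      c • Ω ((extChartAt (𝓡∂ (n + 1)) x₀).symm y)) :
    chartDensity η x₀ y = c * chartDensity Ω x₀ y := by
  simp only [chartDensity, DForm.inChart, h]
  simp

theorem continuous_of_chart {Y : Type*} [TopologicalSpace Y] {f : N → Y}
    (h : ∀ x₀, ContinuousOn (fun y => f ((extChartAt (𝓡∂ (n + 1)) x₀).symm y))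
      (extChartAt (𝓡∂ (n + 1)) x₀).target) : Continuous f := by
  rw [continuous_iff_continuousAt]
  intro x
  have h1 : ContinuousOn ((fun y => f ((extChartAt (𝓡∂ (n + 1)) x).symm y)) ∘
      extChartAt (𝓡∂ (n + 1)) x) (extChartAt (𝓡∂ (n + 1)) x).source :=
    (h x).comp (continuousOn_extChartAt x) (extChartAt (𝓡∂ (n + 1)) x).mapsTo
  have h2 := h1.continuousAt (extChartAt_source_mem_nhds x)
  refine h2.congr ?_
  filter_upwards [extChartAt_source_mem_nhds (I := 𝓡∂ (n + 1)) x] with z hz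
  simp only [comp, (extChartAt (𝓡∂ (n + 1)) x).left_inv hz]

theorem continuous_formRatio {η Ω : DForm (Euc (n + 1)) N (n + 1)} (hη : η.IsSmooth (𝓡∂ (n + 1)))
    (hΩ : Ω.IsSmooth (𝓡∂ (n + 1))) (hΩ0 : ∀ x, Ω x ≠ 0) : Continuous (formRatio η Ω) := by
  refine continuous_of_chart (n := n) fun x₀ => ?_
  refine ((continuousOn_chartDensity hη x₀).div (continuousOn_chartDensity hΩ x₀)
    fun y hy => chartDensity_ne_zero hΩ0 hy).congr fun y hy => ?_
  have := chartDensity_ne_zero hΩ0 hy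
  simp only [chartDensity_eq_mul (eq_formRatio_smul η (hΩ0 _)), Pi.div_apply]
  field_simp

/-- The local Stokes formula: the exact top-degree form `d θ`, with `θ` supported in one chart and
vanishing on vectors tangent to the boundary, has integral zero. -/
theorem integral_chart_extd_eq_zero {Ω : DForm (Euc (n + 1)) N (n + 1)}
    (hΩ : Ω.IsSmooth (𝓡∂ (n + 1))) (hΩ0 : ∀ x, Ω x ≠ 0)
    {θ : DForm (Euc (n + 1)) N n} (hθ : θ.IsSmooth (𝓡∂ (n + 1)))
    (hθ0 : ∀ x ∈ (𝓡∂ (n + 1)).boundary N, ∀ v : Fin n → Euc (n + 1), (∀ i, v i 0 = 0) → θ x v = 0)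
    {x₀ : N} {K : Set N} (hK : IsCompact K) (hKs : K ⊆ (extChartAt (𝓡∂ (n + 1)) x₀).source)
    (hθK : ∀ x ∉ K, θ x = 0) {g : N → ℝ} (hg : ∀ x, θ.extd (𝓡∂ (n + 1)) x = g x • Ω x) :
    ∫ y in (extChartAt (𝓡∂ (n + 1)) x₀).target,
      g ((extChartAt (𝓡∂ (n + 1)) x₀).symm y) * |chartDensity Ω x₀ y| = 0 := by
  classical
  set I := 𝓡∂ (n + 1) with hI
  set T := (extChartAt I x₀).target with hT
  set K' := extChartAt I x₀ '' K with hK'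
  have hK'c : IsCompact K' := hK.image_of_continuousOn ((continuousOn_extChartAt x₀).mono hKs)
  have hK'T : K' ⊆ T := by
    rintro _ ⟨z, hz, rfl⟩; exact (extChartAt I x₀).map_source (hKs hz)
  have hout : ∀ y ∈ T, y ∉ K' → (extChartAt I x₀).symm y ∉ K := fun y hy hyK h =>
    hyK ⟨_, h, (extChartAt I x₀).right_inv hy⟩
  -- the sign of the density, which records the orientation of the chart
  set s : Euc (n + 1) → ℝ := fun y => SignType.sign (chartDensity Ω x₀ y) with hs
  have hsloc : ∀ y ∈ T, ∀ᶠ y' in 𝓝[range I] y, s y' = s y := fun y hy => by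
    have hc : ContinuousWithinAt (chartDensity Ω x₀) (range I) y :=
      (continuousOn_chartDensity hΩ x₀ y hy).mono_of_mem_nhdsWithin
        (target_mem_nhdsWithin_range hy)
    rcases lt_or_gt_of_ne (chartDensity_ne_zero hΩ0 hy) with h | h
    · filter_upwards [hc.eventually_lt continuousWithinAt_const h] with y' hy'
      simp only [hs, sign_neg h, sign_neg hy']
    · filter_upwards [continuousWithinAt_const.eventually_lt hc h] with y' hy'
      simp only [hs, sign_pos h, sign_pos hy']
  let e : Fin (n + 1) → Euc (n + 1) := fun i => EuclideanSpace.single i 1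
  -- the vector field whose divergence is `± dθ`
  let G : Fin (n + 1) → Euc (n + 1) → ℝ := fun i y =>
    if y ∈ T then s y * ((-1) ^ (i : ℕ) * θ.inChart I x₀ y (i.removeNth e)) else 0
  have hθz : ∀ y ∈ T, y ∉ K' → θ.inChart I x₀ y = 0 := fun y hy hyK =>
    DForm.inChart_eq_zero (hθK _ (hout y hy hyK))
  have hGK : ∀ i, ∀ y ∉ K', G i y = 0 := fun i y hyK => by
    simp only [G]
    split_ifs with hy
    · rw [hθz y hy hyK]; simp
    · rfl
  have hGev : ∀ i, ∀ y ∈ T, G i =ᶠ[𝓝[range I] y]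
      fun y' => s y * ((-1) ^ (i : ℕ) * θ.inChart I x₀ y' (i.removeNth e)) := fun i y hy => by
    filter_upwards [hsloc y hy, target_mem_nhdsWithin_range hy] with y' h1 h2
    simp only [G, h1]
    exact if_pos h2
  have hGy : ∀ i, ∀ y ∈ T, G i y = s y * ((-1) ^ (i : ℕ) * θ.inChart I x₀ y (i.removeNth e)) :=
    fun i y hy => if_pos hy
  have hsm : ∀ i : Fin (n + 1), ∀ y ∈ T, ContDiffWithinAt ℝ ∞
      (fun y' => θ.inChart I x₀ y' (i.removeNth e)) (range I) y := fun i y hy =>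
    contDiffWithinAt_alternating_apply (A := fun _ => i.removeNth e) (hθ.contDiffWithinAt hy)
      fun _ => contDiffWithinAt_const
  have hout0 : ∀ i, ∀ y ∉ T, G i =ᶠ[𝓝[range I] y] fun _ => 0 := fun i y hy => by
    refine mem_nhdsWithin_of_mem_nhds ?_
    filter_upwards [hK'c.isClosed.isOpen_compl.mem_nhds fun h => hy (hK'T h)] with z hz
    exact hGK i z hz
  have hGsm : ∀ i, ContDiffOn ℝ 1 (G i) (range I) := fun i y hyr => by
    by_cases hy : y ∈ T
    · refine ContDiffWithinAt.congr_of_eventuallyEq ?_ (hGev i y hy) (hGy i y hy)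
      exact (contDiffWithinAt_const.mul (contDiffWithinAt_const.mul (hsm i y hy))).of_le
        (by exact ENat.LEInfty.out)
    · exact contDiffWithinAt_const.congr_of_eventuallyEq (hout0 i y hy)
        (hGK i y fun h => hy (hK'T h))
  have hmain := integral_divergence_halfSpace G hGsm K' hK'c hGK fun y hy0 => by
    simp only [G]
    split_ifs with hy
    · have h0 : θ.inChart I x₀ y ((0 : Fin (n + 1)).removeNth e) = 0 := by
        refine hθ0 _ (mem_boundary_of_chart hy hy0) _ fun i => ?_
        refine chartInvDeriv_apply_zero hy hy0 ?_
        simp [Fin.removeNth, e]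
      rw [h0]; simp
    · rfl
  rw [← hmain]
  symm
  have hTr : T ⊆ range I := extChartAt_target_subset_range x₀
  rw [setIntegral_eq_of_subset_of_forall_sdiff_eq_zero (s := T) I.isClosed_range.measurableSet hTr]
  · refine setIntegral_congr_fun (measurableSet_extChartAt_target x₀) fun y hy => ?_
    have hu := uniqueDiffWithinAt_range hy
    have h1 : ∑ i, fderivWithin ℝ (G i) (range I) y (EuclideanSpace.single i 1) =
        s y * extDerivWithin (θ.inChart I x₀) (range I) y e := by
      rw [extDerivWithin_apply ((hθ.contDiffWithinAt hy).differentiableWithinAt (by simp)) hu,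
        Finset.mul_sum]
      refine Finset.sum_congr rfl fun i _ => ?_
      have hd := (hsm i y hy).differentiableWithinAt (by simp)
      rw [(hGev i y hy).fderivWithin_eq (hGy i y hy),
        fderivWithin_const_mul hu (hd.const_mul _),
        fderivWithin_const_mul hu hd]
      simp [e]
    refine h1.trans ?_
    rw [← DForm.inChart_extd hθ hy]
    have h2 : (θ.extd I).inChart I x₀ y e =
        g ((extChartAt I x₀).symm y) * chartDensity Ω x₀ y := chartDensity_eq_mul (hg _)
    rw [h2]
    have h3 : |chartDensity Ω x₀ y| = s y * chartDensity Ω x₀ y := (sign_mul_self _).symm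
    rw [h3]; ring
  · rintro y ⟨_, hy⟩
    refine Finset.sum_eq_zero fun i _ => ?_
    rw [(hout0 i y hy).fderivWithin_eq (hGK i y fun h => hy (hK'T h))]
    simp

/-- A measure on a compact manifold with boundary for which Stokes' theorem holds: it integrates the
quotients `dθ / Ω` to zero, for all forms `θ` that vanish on the boundary. The measure is glued
from the densities `|Ω|` in finitely many charts by means of a partition of unity. -/
theorem exists_stokes_measure [T2Space N] [CompactSpace N] [MeasurableSpace N] [BorelSpace N]
    {Ω : DForm (Euc (n + 1)) N (n + 1)}
    (hΩ : Ω.IsSmooth (𝓡∂ (n + 1))) (hΩ0 : ∀ x, Ω x ≠ 0) :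
    ∃ μ : Measure N, IsFiniteMeasure μ ∧ μ.IsOpenPosMeasure ∧
      ∀ θ : DForm (Euc (n + 1)) N n, θ.IsSmooth (𝓡∂ (n + 1)) →
        (∀ x ∈ (𝓡∂ (n + 1)).boundary N, ∀ v : Fin n → Euc (n + 1),
          (∀ i, v i 0 = 0) → θ x v = 0) →
        ∫ x, formRatio (θ.extd (𝓡∂ (n + 1))) Ω x ∂μ = 0 := by
  classical
  set I := 𝓡∂ (n + 1) with hI
  -- a finite cover by charts with a subordinate partition of unity
  obtain ⟨t, ht⟩ := isCompact_univ.elim_finite_subcover (fun x : N => (extChartAt I x).source)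
    (fun x => isOpen_extChartAt_source x)
    (fun x _ => mem_iUnion.2 ⟨x, mem_extChartAt_source x⟩)
  obtain ⟨ρ, hρ⟩ := SmoothPartitionOfUnity.exists_isSubordinate I (isClosed_univ (X := N))
    (fun i : t => (extChartAt I (i : N)).source) (fun i => isOpen_extChartAt_source _)
    (fun x hx => by simpa using ht hx)
  have hρsum : ∀ x, ∑ i, ρ i x = 1 := fun x => by
    rw [← finsum_eq_sum_of_fintype]; exact ρ.sum_eq_one (mem_univ x)
  have hρ0 : ∀ i : t, ∀ x ∉ tsupport (ρ i), ρ i x = 0 := fun i x hx =>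
    image_eq_zero_of_notMem_tsupport hx
  have hρc : ∀ i : t, IsCompact (tsupport (ρ i)) := fun i => (isClosed_tsupport _).isCompact
  let T : N → Set (Euc (n + 1)) := fun a => (extChartAt I a).target
  have hTm : ∀ a, MeasurableSet (T a) := measurableSet_extChartAt_target
  let wt : t → Euc (n + 1) → ℝ := fun i y =>
    ρ i ((extChartAt I (i : N)).symm y) * |chartDensity Ω (i : N) y|
  have hwt0 : ∀ i y, 0 ≤ wt i y := fun i y => mul_nonneg (ρ.nonneg i _) (abs_nonneg _)
  -- continuous functions supported in a chart are integrable in it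
  have hint : ∀ (a : N) (f : N → ℝ) (K : Set N), Continuous f → IsCompact K →
      K ⊆ (extChartAt I a).source → (∀ x ∉ K, f x = 0) →
      IntegrableOn (fun y => f ((extChartAt I a).symm y) * |chartDensity Ω a y|) (T a) := by
    intro a f K hf hK hKs hfK
    have hc : ContinuousOn (fun y => f ((extChartAt I a).symm y) * |chartDensity Ω a y|) (T a) :=
      (hf.comp_continuousOn (continuousOn_extChartAt_symm a)).mul
        (continuousOn_chartDensity hΩ a).abs
    have hK'c : IsCompact (extChartAt I a '' K) :=
      hK.image_of_continuousOn ((continuousOn_extChartAt a).mono hKs)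
    have hsub : extChartAt I a '' K ⊆ T a := by
      rintro _ ⟨z, hz, rfl⟩; exact (extChartAt I a).map_source (hKs hz)
    refine IntegrableOn.of_forall_sdiff_eq_zero ((hc.mono hsub).integrableOn_compact hK'c)
      (hTm a) ?_
    rintro y ⟨hy, hyK⟩
    rw [hfK, zero_mul]
    exact fun h => hyK ⟨_, h, (extChartAt I a).right_inv hy⟩
  have hwtint : ∀ i : t, IntegrableOn (wt i) (T i) := fun i =>
    hint i (ρ i) (tsupport (ρ i)) (ρ i).contMDiff.continuous (hρc i) (hρ i) (hρ0 i)
  have hwtm : ∀ i : t, AEMeasurable (fun y => (wt i y).toNNReal) (volume.restrict (T i)) := fun i =>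
    (hwtint i).aestronglyMeasurable.aemeasurable.real_toNNReal
  have hsymm : ∀ i : t, AEMeasurable (extChartAt I (i : N)).symm (volume.restrict (T i)) := fun i =>
    (continuousOn_extChartAt_symm (i : N)).aemeasurable (hTm i)
  let ν : t → Measure (Euc (n + 1)) := fun i =>
    (volume.restrict (T i)).withDensity fun y => ((wt i y).toNNReal : ENNReal)
  have hν : ∀ i, IsFiniteMeasure (ν i) := fun i =>
    isFiniteMeasure_withDensity_ofReal (hwtint i).hasFiniteIntegral
  have hsymmν : ∀ i : t, AEMeasurable (extChartAt I (i : N)).symm (ν i) := fun i =>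
    (hsymm i).mono_ac (withDensity_absolutelyContinuous _ _)
  let μ : Measure N := ∑ i : t, (ν i).map (extChartAt I (i : N)).symm
  have hμi : ∀ i : t, IsFiniteMeasure ((ν i).map (extChartAt I (i : N)).symm) := fun i =>
    inferInstance
  have hμf : IsFiniteMeasure μ := inferInstance
  have hfin : ∀ f : N → ℝ, Continuous f → ∀ (m : Measure N) [IsFiniteMeasure m], Integrable f m :=
    fun f hf m _ => hf.integrable_of_hasCompactSupport (HasCompactSupport.of_compactSpace f)
  have hμint : ∀ f : N → ℝ, Continuous f → ∫ x, f x ∂μ =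
      ∑ i : t, ∫ y in T i, (fun x => ρ i x * f x) ((extChartAt I (i : N)).symm y) *
        |chartDensity Ω (i : N) y| := by
    intro f hf
    rw [integral_finsetSum_measure fun i _ => hfin f hf _]
    refine Finset.sum_congr rfl fun i _ => ?_
    rw [integral_map (hsymmν i) (hf.aestronglyMeasurable),
      integral_withDensity_eq_integral_smul₀ (hwtm i)]
    refine integral_congr_ae (Filter.Eventually.of_forall fun y => ?_)
    simp only [NNReal.smul_def, Real.coe_toNNReal _ (hwt0 i y), smul_eq_mul, wt]
    ring
  refine ⟨μ, hμf, ⟨fun U hU hUne h0 => ?_⟩, fun θ hθ hθ0 => ?_⟩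
  · obtain ⟨x, hx⟩ := hUne
    obtain ⟨i, hi⟩ : ∃ i, ρ i x ≠ 0 := by
      by_contra hcon
      push Not at hcon
      have := hρsum x
      simp [hcon] at this
    have hxs : x ∈ (extChartAt I (i : N)).source := hρ i (subset_tsupport _ hi)
    have h1 : (ν i).map (extChartAt I (i : N)).symm U = 0 := by
      have h2 : ∑ j : t, (ν j).map (extChartAt I (j : N)).symm U = 0 := by
        simpa [μ] using h0
      exact (Finset.sum_eq_zero_iff.1 h2) i (Finset.mem_univ i)
    rw [Measure.map_apply_of_aemeasurable (hsymmν i) hU.measurableSet,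
      withDensity_apply_eq_zero' (hwtm i).coe_nnreal_ennreal, Measure.restrict_apply' (hTm i)] at h1
    -- the density is positive on a nonempty open set
    have hV : IsOpen (U ∩ {z | ρ i z ≠ 0}) :=
      hU.inter (isOpen_ne_fun (ρ i).contMDiff.continuous continuous_const)
    set y := extChartAt I (i : N) x with hy
    have hyT : y ∈ T i := (extChartAt I (i : N)).map_source hxs
    have hnear : ∀ᶠ y' in 𝓝[range I] y, y' ∈ T i ∧
        (extChartAt I (i : N)).symm y' ∈ U ∩ {z | ρ i z ≠ 0} := by
      refine Filter.Eventually.and (target_mem_nhdsWithin_range hyT) ?_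
      have hc := (contMDiffWithinAt_chart_symm (I := I) hyT).continuousWithinAt
      refine hc (hV.mem_nhds ?_)
      rw [(extChartAt I (i : N)).left_inv hxs]
      exact ⟨hx, hi⟩
    obtain ⟨u, hu, hyu, hu2⟩ := mem_nhdsWithin.1 hnear
    have hne : (u ∩ interior (range I)).Nonempty :=
      mem_closure_iff.1 (mem_closure_interior_range hyT) u hu hyu
    have hpos := (hu.inter isOpen_interior).measure_pos volume hne
    refine hpos.ne' (measure_mono_null ?_ h1)
    rintro y' ⟨hy1, hy2⟩
    obtain ⟨h3, h4, h5⟩ := hu2 ⟨hy1, interior_subset hy2⟩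
    refine ⟨⟨?_, h4⟩, h3⟩
    have : 0 < wt i y' :=
      mul_pos (lt_of_le_of_ne (ρ.nonneg i _) (Ne.symm h5)) (abs_pos.2 (chartDensity_ne_zero hΩ0 h3))
    simpa using this
  · -- decompose `θ` by the partition of unity
    let θ' : t → DForm (Euc (n + 1)) N n := fun j x => ρ j x • θ x
    have hθ's : ∀ j, (θ' j).IsSmooth I := fun j => hθ.smul (ρ j).contMDiff
    let g : t → N → ℝ := fun j => formRatio ((θ' j).extd I) Ω
    have hgc : ∀ j, Continuous (g j) := fun j => continuous_formRatio (hθ's j).extd hΩ hΩ0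
    have hg : ∀ j x, (θ' j).extd I x = g j x • Ω x := fun j x => eq_formRatio_smul _ (hΩ0 x)
    have hθ'0 : ∀ j, ∀ x ∉ tsupport (ρ j), θ' j x = 0 := fun j x hx => by
      simp only [θ', hρ0 j x hx, zero_smul]
    have hg0 : ∀ j, ∀ x ∉ tsupport (ρ j), g j x = 0 := fun j x hx => by
      have h1 : (θ' j).extd I x = 0 := DForm.extd_eq_zero_of_eventually (by
        filter_upwards [(isClosed_tsupport _).isOpen_compl.mem_nhds hx] with z hz using hθ'0 j z hz)
      simp only [g, formRatio, h1]
      simp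
    have hsum : formRatio (θ.extd I) Ω = fun x => ∑ j, g j x := by
      funext x
      symm
      refine eq_formRatio (hΩ0 x) ?_
      have h1 : θ = fun x => ∑ j : t, θ' j x := by
        funext x
        simp only [θ', ← Finset.sum_smul, hρsum, one_smul]
      conv_lhs => rw [h1]
      rw [DForm.extd_sum _ _ fun j _ => hθ's j, Finset.sum_smul]
      exact Finset.sum_congr rfl fun j _ => hg j x
    rw [hsum, integral_finsetSum _ fun j _ => hfin _ (hgc j) μ]
    refine Finset.sum_eq_zero fun j _ => ?_
    rw [hμint _ (hgc j)]
    -- move all integrals to the chart `j`, where the functions `ρ i` add up to one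
    have hswap : ∀ i : t, ∫ y in T i, (fun x => ρ i x * g j x) ((extChartAt I (i : N)).symm y) *
        |chartDensity Ω (i : N) y| =
        ∫ y in T j, (fun x => ρ i x * g j x) ((extChartAt I (j : N)).symm y) *
        |chartDensity Ω (j : N) y| := fun i =>
      integral_chartDensity_eq Ω (f := fun x => ρ i x * g j x) (a := i) (b := j)
        (fun x hx => by simp only [hρ0 i x fun h => hx (hρ i h), zero_mul])
        (fun x hx => by simp only [hg0 j x fun h => hx (hρ j h), mul_zero])
    simp only [hswap]
    rw [← integral_finsetSum]
    · rw [← integral_chart_extd_eq_zero hΩ hΩ0 (hθ's j)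
        (fun x hx v hv => by simp [θ', hθ0 x hx v hv]) (hρc j) (hρ j) (hθ'0 j) (hg j)]
      refine setIntegral_congr_fun (hTm j) fun y _ => ?_
      rw [← Finset.sum_mul, ← Finset.sum_mul, hρsum, one_mul]
    · intro i _
      exact hint j _ (tsupport (ρ j)) ((ρ i).contMDiff.continuous.mul (hgc j)) (hρc j) (hρ j)
        fun x hx => by rw [Pi.mul_apply, hg0 j x hx, mul_zero]

end Stokes

/-! ### The wedge product with a 1-form -/

section Wedge

variable {E : Type*} [NormedAddCommGroup E] [NormedSpace ℝ E]
  {H : Type*} [TopologicalSpace H] {I : ModelWithCorners ℝ E H}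
  {X : Type*} [TopologicalSpace X] [ChartedSpace H X] [IsManifold I ∞ X]

/-- The wedge product of a covector and an alternating 2-form. -/
def wedge (a : E [⋀^Fin 1]→L[ℝ] ℝ) (b : E [⋀^Fin 2]→L[ℝ] ℝ) : E [⋀^Fin 3]→L[ℝ] ℝ :=
  ContinuousAlternatingMap.alternatizeUncurryFin
    (((ContinuousAlternatingMap.ofSubsingleton ℝ E ℝ (0 : Fin 1)).symm a).smulRight b)

theorem wedge_apply (a : E [⋀^Fin 1]→L[ℝ] ℝ) (b : E [⋀^Fin 2]→L[ℝ] ℝ) (v : Fin 3 → E) :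
    wedge a b v = a ![v 0] * b ![v 1, v 2] - a ![v 1] * b ![v 0, v 2] +
      a ![v 2] * b ![v 0, v 1] := by
  have h0 : (0 : Fin 3).removeNth v = ![v 1, v 2] := by
    funext i; fin_cases i <;> rfl
  have h1 : (1 : Fin 3).removeNth v = ![v 0, v 2] := by
    funext i; fin_cases i <;> rfl
  have h2 : (2 : Fin 3).removeNth v = ![v 0, v 1] := by
    funext i; fin_cases i <;> rfl
  have h3 : ∀ w : E, (ContinuousAlternatingMap.ofSubsingleton ℝ E ℝ (0 : Fin 1)).symm a w =
      a ![w] := fun w => by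
    change a (fun _ => w) = _
    congr 1
    funext i; fin_cases i; rfl
  rw [wedge, ContinuousAlternatingMap.alternatizeUncurryFin_apply]
  refine (Fin.sum_univ_three _).trans ?_
  simp only [ContinuousLinearMap.smulRight_apply,
    ContinuousAlternatingMap.smul_apply, h0, h1, h2, h3]
  simp
  ring

theorem removeNth_four (v : Fin 4 → E) :
    (0 : Fin 4).removeNth v = ![v 1, v 2, v 3] ∧ (1 : Fin 4).removeNth v = ![v 0, v 2, v 3] ∧
    (2 : Fin 4).removeNth v = ![v 0, v 1, v 3] ∧ (3 : Fin 4).removeNth v = ![v 0, v 1, v 2] := by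
  refine ⟨?_, ?_, ?_, ?_⟩ <;> (funext i; fin_cases i <;> rfl)

theorem extDerivWithin_one_apply {a : E → E [⋀^Fin 1]→L[ℝ] ℝ} {s : Set E} {x : E}
    (h : DifferentiableWithinAt ℝ a s x) (hs : UniqueDiffWithinAt ℝ s x) (v : Fin 2 → E) :
    extDerivWithin a s x v = fderivWithin ℝ (fun y => a y ![v 1]) s x (v 0) -
      fderivWithin ℝ (fun y => a y ![v 0]) s x (v 1) := by
  have h0 : (0 : Fin 2).removeNth v = ![v 1] := by
    funext i; fin_cases i; rfl
  have h1 : (1 : Fin 2).removeNth v = ![v 0] := by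
    funext i; fin_cases i; rfl
  rw [extDerivWithin_apply h hs, Fin.sum_univ_two, h0, h1]
  simp
  ring

theorem extDerivWithin_two_apply {b : E → E [⋀^Fin 2]→L[ℝ] ℝ} {s : Set E} {x : E}
    (h : DifferentiableWithinAt ℝ b s x) (hs : UniqueDiffWithinAt ℝ s x) (v : Fin 3 → E) :
    extDerivWithin b s x v = fderivWithin ℝ (fun y => b y ![v 1, v 2]) s x (v 0) -
      fderivWithin ℝ (fun y => b y ![v 0, v 2]) s x (v 1) +
      fderivWithin ℝ (fun y => b y ![v 0, v 1]) s x (v 2) := by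
  have h0 : (0 : Fin 3).removeNth v = ![v 1, v 2] := by
    funext i; fin_cases i <;> rfl
  have h1 : (1 : Fin 3).removeNth v = ![v 0, v 2] := by
    funext i; fin_cases i <;> rfl
  have h2 : (2 : Fin 3).removeNth v = ![v 0, v 1] := by
    funext i; fin_cases i <;> rfl
  rw [extDerivWithin_apply h hs, Fin.sum_univ_three, h0, h1, h2]
  simp
  ring

/-- The Leibniz rule `d(a ∧ b) = da ∧ b - a ∧ db`. -/
theorem extDerivWithin_wedge {a : E → E [⋀^Fin 1]→L[ℝ] ℝ} {b : E → E [⋀^Fin 2]→L[ℝ] ℝ}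
    {s : Set E} {x : E} (ha : DifferentiableWithinAt ℝ a s x)
    (hb : DifferentiableWithinAt ℝ b s x)
    (hw : DifferentiableWithinAt ℝ (fun y => wedge (a y) (b y)) s x)
    (hs : UniqueDiffWithinAt ℝ s x) (v : Fin 4 → E) :
    extDerivWithin (fun y => wedge (a y) (b y)) s x v =
      (extDerivWithin a s x ![v 0, v 1] * b x ![v 2, v 3]
        - extDerivWithin a s x ![v 0, v 2] * b x ![v 1, v 3]
        + extDerivWithin a s x ![v 0, v 3] * b x ![v 1, v 2]
        + extDerivWithin a s x ![v 1, v 2] * b x ![v 0, v 3]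
        - extDerivWithin a s x ![v 1, v 3] * b x ![v 0, v 2]
        + extDerivWithin a s x ![v 2, v 3] * b x ![v 0, v 1])
      - (a x ![v 0] * extDerivWithin b s x ![v 1, v 2, v 3]
        - a x ![v 1] * extDerivWithin b s x ![v 0, v 2, v 3]
        + a x ![v 2] * extDerivWithin b s x ![v 0, v 1, v 3]
        - a x ![v 3] * extDerivWithin b s x ![v 0, v 1, v 2]) := by
  obtain ⟨h0, h1, h2, h3⟩ := removeNth_four v
  have hda : ∀ w, DifferentiableWithinAt ℝ (fun y => a y w) s x := fun w =>
    ((ContinuousAlternatingMap.apply ℝ E ℝ w).differentiableAt).comp_differentiableWithinAt x ha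
  have hdb : ∀ w, DifferentiableWithinAt ℝ (fun y => b y w) s x := fun w =>
    ((ContinuousAlternatingMap.apply ℝ E ℝ w).differentiableAt).comp_differentiableWithinAt x hb
  have key : ∀ p q r u : E, fderivWithin ℝ (fun y => wedge (a y) (b y) ![p, q, r]) s x u =
      (a x ![p] * fderivWithin ℝ (fun y => b y ![q, r]) s x u +
        b x ![q, r] * fderivWithin ℝ (fun y => a y ![p]) s x u) -
      (a x ![q] * fderivWithin ℝ (fun y => b y ![p, r]) s x u +
        b x ![p, r] * fderivWithin ℝ (fun y => a y ![q]) s x u) +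
      (a x ![r] * fderivWithin ℝ (fun y => b y ![p, q]) s x u +
        b x ![p, q] * fderivWithin ℝ (fun y => a y ![r]) s x u) := fun p q r u => by
    have h := (((hda ![p]).hasFDerivWithinAt.mul (hdb ![q, r]).hasFDerivWithinAt).sub
      ((hda ![q]).hasFDerivWithinAt.mul (hdb ![p, r]).hasFDerivWithinAt)).add
      ((hda ![r]).hasFDerivWithinAt.mul (hdb ![p, q]).hasFDerivWithinAt)
    have h' := h.fderivWithin hs
    have he : (fun y => wedge (a y) (b y) ![p, q, r]) = fun y =>
        a y ![p] * b y ![q, r] - a y ![q] * b y ![p, r] + a y ![r] * b y ![p, q] := by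
      funext y; rw [wedge_apply]; rfl
    rw [he]
    refine (DFunLike.congr_fun h' u).trans ?_
    simp
  rw [extDerivWithin_apply hw hs, Fin.sum_univ_four, h0, h1, h2, h3]
  simp only [key, extDerivWithin_one_apply ha hs, extDerivWithin_two_apply hb hs]
  simp
  ring

/-- The wedge product of a 1-form and a 2-form. -/
def DForm.wedge (a : DForm E X 1) (b : DForm E X 2) : DForm E X 3 :=
  fun x => CoassocBdry.wedge (a x) (b x)

theorem DForm.inChart_wedge (a : DForm E X 1) (b : DForm E X 2) (x₀ : X) (y : E) :
    (a.wedge b).inChart I x₀ y = CoassocBdry.wedge (a.inChart I x₀ y) (b.inChart I x₀ y) := by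
  have h1 : ∀ (A : E →L[ℝ] E) (w : Fin 1 → E), A ∘ w = ![A (w 0)] := fun A w => by
    funext i; fin_cases i; rfl
  have h2 : ∀ (A : E →L[ℝ] E) (w : Fin 2 → E), A ∘ w = ![A (w 0), A (w 1)] := fun A w => by
    funext i; fin_cases i <;> rfl
  ext v
  simp only [DForm.inChart, DForm.wedge, wedge_apply,
    ContinuousAlternatingMap.compContinuousLinearMap_apply, h1, h2]
  rfl

theorem DForm.IsSmooth.wedge [FiniteDimensional ℝ E] {a : DForm E X 1} {b : DForm E X 2}
    (ha : a.IsSmooth I) (hb : b.IsSmooth I) : (a.wedge b).IsSmooth I := by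
  refine DForm.isSmooth_of_contDiffWithinAt fun x₀ y hy => contDiffWithinAt_alternating fun v => ?_
  have hda : ∀ w, ContDiffWithinAt ℝ ∞ (fun y => a.inChart I x₀ y w) (range I) y := fun w =>
    contDiffWithinAt_alternating_apply (A := fun _ => w) (ha.contDiffWithinAt hy)
      fun _ => contDiffWithinAt_const
  have hdb : ∀ w, ContDiffWithinAt ℝ ∞ (fun y => b.inChart I x₀ y w) (range I) y := fun w =>
    contDiffWithinAt_alternating_apply (A := fun _ => w) (hb.contDiffWithinAt hy)
      fun _ => contDiffWithinAt_const
  simp only [DForm.inChart_wedge, wedge_apply]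
  exact (((hda _).mul (hdb _)).sub ((hda _).mul (hdb _))).add ((hda _).mul (hdb _))

theorem DForm.inChart_self {k : ℕ} (θ : DForm E X k) (x : X) :
    θ.inChart I x (extChartAt I x x) = θ x := by
  ext v
  have h : (extChartAt I x).symm (extChartAt I x x) = x := by simp
  rw [DForm.inChart, chartInvDeriv_self, h]
  rfl

/-- The Leibniz rule `d(a ∧ b) = da ∧ b - a ∧ db` on a manifold. -/
theorem DForm.extd_wedge [FiniteDimensional ℝ E] {a : DForm E X 1} {b : DForm E X 2}
    (ha : a.IsSmooth I) (hb : b.IsSmooth I) (x : X) (v : Fin 4 → E) :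
    (a.wedge b).extd I x v =
      (a.extd I x ![v 0, v 1] * b x ![v 2, v 3] - a.extd I x ![v 0, v 2] * b x ![v 1, v 3]
        + a.extd I x ![v 0, v 3] * b x ![v 1, v 2] + a.extd I x ![v 1, v 2] * b x ![v 0, v 3]
        - a.extd I x ![v 1, v 3] * b x ![v 0, v 2] + a.extd I x ![v 2, v 3] * b x ![v 0, v 1])
      - (a x ![v 0] * b.extd I x ![v 1, v 2, v 3] - a x ![v 1] * b.extd I x ![v 0, v 2, v 3]
        + a x ![v 2] * b.extd I x ![v 0, v 1, v 3] - a x ![v 3] * b.extd I x ![v 0, v 1, v 2]) := by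
  have hx := mem_extChartAt_target (I := I) x
  have h1 := (ha.contDiffWithinAt hx).differentiableWithinAt (by simp)
  have h2 := (hb.contDiffWithinAt hx).differentiableWithinAt (by simp)
  have h3 := ((ha.wedge hb).contDiffWithinAt hx).differentiableWithinAt (by simp)
  have he : (a.wedge b).inChart I x =
      fun y => CoassocBdry.wedge (a.inChart I x y) (b.inChart I x y) := by
    funext y; exact DForm.inChart_wedge a b x y
  rw [he] at h3
  have h4 := extDerivWithin_wedge h1 h2 h3 (uniqueDiffWithinAt_range hx) v
  rw [← he, DForm.inChart_self, DForm.inChart_self] at h4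
  exact h4

end Wedge

/-! ### The linear algebra of coassociative planes -/

section LinearAlgebra

/-- The cross product on `ℝ⁷` defined by `⟨u × v, w⟩ = φ₀(u, v, w)`. -/
def cross (u v : Euc 7) : Euc 7 :=
  !₂[u 1 * v 2 - u 2 * v 1 + (u 3 * v 4 - u 4 * v 3) + (u 5 * v 6 - u 6 * v 5),
    u 2 * v 0 - u 0 * v 2 + (u 3 * v 5 - u 5 * v 3) - (u 4 * v 6 - u 6 * v 4),
    u 0 * v 1 - u 1 * v 0 - (u 3 * v 6 - u 6 * v 3) - (u 4 * v 5 - u 5 * v 4),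
    u 4 * v 0 - u 0 * v 4 + (u 5 * v 1 - u 1 * v 5) - (u 6 * v 2 - u 2 * v 6),
    u 0 * v 3 - u 3 * v 0 - (u 6 * v 1 - u 1 * v 6) - (u 5 * v 2 - u 2 * v 5),
    u 6 * v 0 - u 0 * v 6 + (u 1 * v 3 - u 3 * v 1) - (u 2 * v 4 - u 4 * v 2),
    u 0 * v 5 - u 5 * v 0 - (u 1 * v 4 - u 4 * v 1) - (u 2 * v 3 - u 3 * v 2)]

theorem inner_seven (u v : Euc 7) : inner ℝ u v = u 0 * v 0 + u 1 * v 1 + u 2 * v 2 + u 3 * v 3 +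
    u 4 * v 4 + u 5 * v 5 + u 6 * v 6 := by
  simp only [PiLp.inner_apply, Fin.sum_univ_seven, RCLike.inner_apply, conj_trivial]
  ring

theorem inner_cross (u v w : Euc 7) : inner ℝ (cross u v) w = phi0 ![u, v, w] := by
  rw [inner_seven]
  simp [cross, phi0, dx, Matrix.det_fin_three]
  ring

theorem inner_cross_cross (u v w : Euc 7) : inner ℝ (cross u v) (cross u w) =
    inner ℝ u u * inner ℝ v w - inner ℝ u v * inner ℝ u w := by
  simp only [inner_seven]
  simp [cross]
  ring

theorem dx_four (i j k l : Fin 7) (u v w z : Euc 7) : dx ![i, j, k, l] ![u, v, w, z] =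
    u i * (v j * (w k * z l - w l * z k) - v k * (w j * z l - w l * z j)
      + v l * (w j * z k - w k * z j))
    - u j * (v i * (w k * z l - w l * z k) - v k * (w i * z l - w l * z i)
      + v l * (w i * z k - w k * z i))
    + u k * (v i * (w j * z l - w l * z j) - v j * (w i * z l - w l * z i)
      + v l * (w i * z j - w j * z i))
    - u l * (v i * (w j * z k - w k * z j) - v j * (w i * z k - w k * z i)
      + v k * (w i * z j - w j * z i)) := by
  rw [dx, Matrix.det_succ_row_zero, Fin.sum_univ_four]
  have h0 : ∀ k, (0 : Fin 4).succAbove k = ![1, 2, 3] k := by decide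
  have h1 : ∀ k, (1 : Fin 4).succAbove k = ![0, 2, 3] k := by decide
  have h2 : ∀ k, (2 : Fin 4).succAbove k = ![0, 1, 3] k := by decide
  have h3 : ∀ k, (3 : Fin 4).succAbove k = ![0, 1, 2] k := by decide
  have hc : ∀ {α : Type} (p q r : α), ![p, q, r] 0 = p ∧ ![p, q, r] 1 = q ∧ ![p, q, r] 2 = r :=
    fun p q r => ⟨rfl, rfl, rfl⟩
  have hi : ![i, j, k, l] 0 = i ∧ ![i, j, k, l] 1 = j ∧ ![i, j, k, l] 2 = k ∧
    ![i, j, k, l] 3 = l := ⟨rfl, rfl, rfl, rfl⟩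
  have hv : ![u, v, w, z] 0 = u ∧ ![u, v, w, z] (Fin.succ 0) = v ∧
    ![u, v, w, z] (Fin.succ 1) = w ∧ ![u, v, w, z] (Fin.succ 2) = z := ⟨rfl, rfl, rfl, rfl⟩
  have hp : (-1 : ℝ) ^ ((0 : Fin 4) : ℕ) = 1 ∧ (-1 : ℝ) ^ ((1 : Fin 4) : ℕ) = -1 ∧
    (-1 : ℝ) ^ ((2 : Fin 4) : ℕ) = 1 ∧ (-1 : ℝ) ^ ((3 : Fin 4) : ℕ) = -1 := by
    refine ⟨pow_zero _, pow_one _, by norm_num, by norm_num [pow_succ]⟩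
  simp only [Matrix.det_fin_three, Matrix.submatrix_apply, Matrix.of_apply, h0, h1, h2, h3, hc,
    hi, hv, hp]
  ring

/-- The dual 4-form in terms of the cross product. -/
theorem psi0_eq (u v w z : Euc 7) : psi0 ![u, v, w, z] =
    inner ℝ (cross u v) (cross w z) - inner ℝ u w * inner ℝ v z + inner ℝ u z * inner ℝ v w := by
  simp only [inner_seven, psi0, dx_four]
  simp [cross]
  ring

theorem cross_swap (u v : Euc 7) : cross u v = -cross v u := by
  ext i
  fin_cases i <;> (simp [cross]; ring)

/-- Four orthonormal vectors on which `φ₀` vanishes, together with three of their cross products,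
form an orthonormal basis of `ℝ⁷`. -/
theorem exists_orthonormalBasis_of_coassociative {e : Fin 4 → Euc 7}
    (he : ∀ a b, inner ℝ (e a) (e b) = if a = b then (1 : ℝ) else 0)
    (hφ : ∀ a b c, phi0 ![e a, e b, e c] = 0) :
    ∃ b : OrthonormalBasis (Fin 7) ℝ (Euc 7),
      ⇑b = ![e 0, e 1, e 2, e 3, cross (e 0) (e 1), cross (e 0) (e 2), cross (e 0) (e 3)] := by
  have h1 : ∀ a b c, inner ℝ (cross (e a) (e b)) (e c) = 0 := fun a b c => by
    rw [inner_cross, hφ]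
  have h1' : ∀ a b c, inner ℝ (e c) (cross (e a) (e b)) = 0 := fun a b c => by
    rw [real_inner_comm, h1]
  have h2 : ∀ a b c, inner ℝ (cross (e a) (e b)) (cross (e a) (e c)) =
      (if b = c then (1 : ℝ) else 0) - (if a = b then (1 : ℝ) else 0) *
        (if a = c then (1 : ℝ) else 0) := fun a b c => by
    rw [inner_cross_cross, he, he, he, he, if_pos rfl, one_mul]
  set v : Fin 7 → Euc 7 :=
    ![e 0, e 1, e 2, e 3, cross (e 0) (e 1), cross (e 0) (e 2), cross (e 0) (e 3)] with hv
  have horth : Orthonormal ℝ v := by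
    rw [orthonormal_iff_ite]
    intro i j
    fin_cases i <;> fin_cases j <;> simp [hv, he, h1, h1', h2, -inner_self_eq_norm_sq_to_K]
  obtain ⟨b, hb⟩ := Orthonormal.exists_orthonormalBasis_extension_of_card_eq (𝕜 := ℝ)
    (E := Euc 7) (ι := Fin 7) (by simp) (v := v) (s := univ)
    (horth.comp Subtype.val Subtype.val_injective)
  exact ⟨b, funext fun i => hb i (mem_univ i)⟩

/-- The calibration identity: the dual 4-form is `±1` on orthonormal frames of coassociative
subspaces. -/
theorem psi0_sq_eq_one {e : Fin 4 → Euc 7}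
    (he : ∀ a b, inner ℝ (e a) (e b) = if a = b then (1 : ℝ) else 0)
    (hφ : ∀ a b c, phi0 ![e a, e b, e c] = 0) : psi0 ![e 0, e 1, e 2, e 3] ^ 2 = 1 := by
  obtain ⟨b, hb⟩ := exists_orthonormalBasis_of_coassociative he hφ
  have h1 := b.sum_sq_norm_inner_right (cross (e 2) (e 3))
  have hn : ‖cross (e 2) (e 3)‖ ^ 2 = 1 := by
    rw [← real_inner_self_eq_norm_sq, inner_cross_cross, he, he, he]
    simp
  have h2 : inner ℝ (cross (e 0) (e 2)) (cross (e 2) (e 3)) = (0 : ℝ) := by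
    rw [cross_swap (e 0), inner_neg_left, inner_cross_cross]
    simp [he]
  have h3 : inner ℝ (cross (e 0) (e 3)) (cross (e 2) (e 3)) = (0 : ℝ) := by
    rw [cross_swap (e 0), cross_swap (e 2), inner_neg_left, inner_neg_right, inner_cross_cross]
    simp [he]
  have h4 : ∀ c, inner ℝ (e c) (cross (e 2) (e 3)) = (0 : ℝ) := fun c => by
    rw [real_inner_comm, inner_cross, hφ]
  rw [hn, hb] at h1
  simp [Fin.sum_univ_succ, h2, h3, h4] at h1
  rw [psi0_eq]
  simpa [he] using h1

/-- A vector orthogonal to a coassociative subspace whose contraction with `φ₀` and one unit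
vector of the subspace vanishes on the subspace is zero. -/
theorem eq_zero_of_coassociative {e : Fin 4 → Euc 7}
    (he : ∀ a b, inner ℝ (e a) (e b) = if a = b then (1 : ℝ) else 0)
    (hφ : ∀ a b c, phi0 ![e a, e b, e c] = 0) {w : Euc 7} (hw : ∀ a, inner ℝ (e a) w = (0 : ℝ))
    (hw' : ∀ a, phi0 ![e 0, e a, w] = 0) : w = 0 := by
  obtain ⟨b, hb⟩ := exists_orthonormalBasis_of_coassociative he hφ
  rw [← norm_eq_zero, ← sq_eq_zero_iff, ← b.sum_sq_norm_inner_right w, hb]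
  simp [Fin.sum_univ_succ, hw, inner_cross, hw']

end LinearAlgebra

/-! ### Components of alternating forms -/

section Components

variable {E : Type*} [NormedAddCommGroup E] [NormedSpace ℝ E]

/-- The sign of a permutation of `{0, 1, 2, 3}` as a Vandermonde product, with
`12 = (1 - 0)(2 - 0)(3 - 0)(2 - 1)(3 - 1)(3 - 2)`. -/
theorem sign_eq_vandermonde (σ : Equiv.Perm (Fin 4)) :
    12 * (Equiv.Perm.sign σ : ℤ) = (σ 1 - σ 0 : ℤ) * (σ 2 - σ 0 : ℤ) * (σ 3 - σ 0 : ℤ) *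
      (σ 2 - σ 1 : ℤ) * (σ 3 - σ 1 : ℤ) * (σ 3 - σ 2 : ℤ) := by
  revert σ; decide

/-- The components of a 4-form with respect to four vectors; the Levi-Civita symbol is written as
a Vandermonde determinant. -/
theorem four_form_components (Ω : E [⋀^Fin 4]→L[ℝ] ℝ) (f : Fin 4 → E) (a b c d : Fin 4) :
    Ω ![f a, f b, f c, f d] = Ω ![f 0, f 1, f 2, f 3] *
      (((b : ℝ) - a) * ((c : ℝ) - a) * ((d : ℝ) - a) * ((c : ℝ) - b) * ((d : ℝ) - b) *
        ((d : ℝ) - c) / 12) := by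
  have hf : ![f 0, f 1, f 2, f 3] = f := by
    funext i; fin_cases i <;> rfl
  have hv : ![f a, f b, f c, f d] = f ∘ ![a, b, c, d] := by
    funext i; fin_cases i <;> rfl
  rw [hf, hv]
  by_cases h : Injective ![a, b, c, d]
  · set σ : Equiv.Perm (Fin 4) := Equiv.ofBijective _ (Finite.injective_iff_bijective.1 h) with hσ
    have h1 : Ω (f ∘ σ) = Equiv.Perm.sign σ • Ω f := Ω.toAlternatingMap.map_perm f σ
    have h2 := sign_eq_vandermonde σ
    have h3 : σ 0 = a ∧ σ 1 = b ∧ σ 2 = c ∧ σ 3 = d := ⟨rfl, rfl, rfl, rfl⟩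
    rw [h3.1, h3.2.1, h3.2.2.1, h3.2.2.2] at h2
    have h4 : (12 : ℝ) * ((Equiv.Perm.sign σ : ℤ) : ℝ) = ((b : ℝ) - a) * ((c : ℝ) - a) *
        ((d : ℝ) - a) * ((c : ℝ) - b) * ((d : ℝ) - b) * ((d : ℝ) - c) := by
      exact_mod_cast h2
    rw [← h4]
    change Ω (f ∘ σ) = _
    rw [h1, Units.smul_def, zsmul_eq_mul]
    ring
  · have h0 : Ω (f ∘ ![a, b, c, d]) = 0 := by
      have h' := h
      simp only [Injective, not_forall] at h'
      obtain ⟨i, j, hij, hne⟩ := h'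
      exact Ω.map_eq_zero_of_eq _ (by simp only [comp, hij]) hne
    rw [h0]
    have : a = b ∨ a = c ∨ a = d ∨ b = c ∨ b = d ∨ c = d := by
      by_contra hcon
      push Not at hcon
      obtain ⟨h1, h2, h3, h4, h5, h6⟩ := hcon
      apply h
      intro i j hij
      fin_cases i <;> fin_cases j <;> simp_all
    rcases this with rfl | rfl | rfl | rfl | rfl | rfl <;> simp

theorem two_form_swap (β : E [⋀^Fin 2]→L[ℝ] ℝ) (u v : E) : β ![v, u] = -β ![u, v] := by
  have h := β.map_swap ![u, v] (i := 0) (j := 1) (by decide)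
  have h1 : ![u, v] ∘ Equiv.swap (0 : Fin 2) 1 = ![v, u] := by
    funext i; fin_cases i <;> rfl
  rwa [h1] at h

theorem two_form_self (β : E [⋀^Fin 2]→L[ℝ] ℝ) (u : E) : β ![u, u] = 0 :=
  β.map_eq_zero_of_eq ![u, u] (i := 0) (j := 1) rfl (by decide)

theorem three_form_swap_left (η : E [⋀^Fin 3]→L[ℝ] ℝ) (u v w : E) :
    η ![v, u, w] = -η ![u, v, w] := by
  have h := η.map_swap ![u, v, w] (i := 0) (j := 1) (by decide)
  have h1 : ![u, v, w] ∘ Equiv.swap (0 : Fin 3) 1 = ![v, u, w] := by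
    funext i; fin_cases i <;> rfl
  rwa [h1] at h

theorem three_form_swap_right (η : E [⋀^Fin 3]→L[ℝ] ℝ) (u v w : E) :
    η ![u, w, v] = -η ![u, v, w] := by
  have h := η.map_swap ![u, v, w] (i := 1) (j := 2) (by decide)
  have h1 : ![u, v, w] ∘ Equiv.swap (1 : Fin 3) 2 = ![u, w, v] := by
    funext i; fin_cases i <;> rfl
  rwa [h1] at h

theorem three_form_perm (η : E [⋀^Fin 3]→L[ℝ] ℝ) (u v w : E) :
    η ![v, u, w] = -η ![u, v, w] ∧ η ![u, w, v] = -η ![u, v, w] ∧ η ![v, w, u] = η ![u, v, w] ∧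
    η ![w, u, v] = η ![u, v, w] ∧ η ![w, v, u] = -η ![u, v, w] := by
  have h1 := three_form_swap_left η u v w
  have h2 := three_form_swap_right η u v w
  have h3 := three_form_swap_right η v u w
  have h4 := three_form_swap_left η u w v
  have h5 := three_form_swap_left η v w u
  refine ⟨h1, h2, ?_, ?_, ?_⟩ <;> linarith

/-- The Hodge star of a 3-form, with respect to four vectors. -/
theorem sum_star_three (Ω : E [⋀^Fin 4]→L[ℝ] ℝ) (η : E [⋀^Fin 3]→L[ℝ] ℝ) (f : Fin 4 → E) (s : ℝ)
    (hs : Ω ![f 0, f 1, f 2, f 3] = s) (ξ : Fin 4 → ℝ)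
    (hξ : ∀ d, ξ d = ∑ a, ∑ b, ∑ c, η ![f a, f b, f c] * Ω ![f a, f b, f c, f d]) :
    ξ 0 = -(6 * s * η ![f 1, f 2, f 3]) ∧ ξ 1 = 6 * s * η ![f 0, f 2, f 3] ∧
    ξ 2 = -(6 * s * η ![f 0, f 1, f 3]) ∧ ξ 3 = 6 * s * η ![f 0, f 1, f 2] := by
  obtain ⟨a1, a2, a3, a4, a5⟩ := three_form_perm η (f 0) (f 1) (f 2)
  obtain ⟨b1, b2, b3, b4, b5⟩ := three_form_perm η (f 0) (f 1) (f 3)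
  obtain ⟨c1, c2, c3, c4, c5⟩ := three_form_perm η (f 0) (f 2) (f 3)
  obtain ⟨d1, d2, d3, d4, d5⟩ := three_form_perm η (f 1) (f 2) (f 3)
  have hc : ∀ a b c d, Ω ![f a, f b, f c, f d] = s *
      (((b : ℝ) - a) * ((c : ℝ) - a) * ((d : ℝ) - a) * ((c : ℝ) - b) * ((d : ℝ) - b) *
        ((d : ℝ) - c) / 12) := fun a b c d => hs ▸ four_form_components Ω f a b c d
  refine ⟨?_, ?_, ?_, ?_⟩ <;>
  · simp only [hξ, Fin.sum_univ_four, hc, a1, a2, a3, a4, a5, b1, b2, b3, b4,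
      b5, c1, c2, c3, c4, c5, d1, d2, d3, d4, d5]
    simp only [Fin.val_zero, Fin.val_one, Fin.val_two, show ((3 : Fin 4) : ℕ) = 3 from rfl]
    norm_num
    try ring

/-- The Hodge star of a 2-form, with respect to four vectors. -/
theorem sum_star_two (Ω : E [⋀^Fin 4]→L[ℝ] ℝ) (β : E [⋀^Fin 2]→L[ℝ] ℝ) (f : Fin 4 → E) (s : ℝ)
    (hs : Ω ![f 0, f 1, f 2, f 3] = s) (ζ : Fin 4 → Fin 4 → ℝ)
    (hζ : ∀ c d, ζ c d = ∑ a, ∑ b, β ![f a, f b] * Ω ![f a, f b, f c, f d]) :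
    ζ 0 1 = 2 * s * β ![f 2, f 3] ∧ ζ 0 2 = -(2 * s * β ![f 1, f 3]) ∧
    ζ 0 3 = 2 * s * β ![f 1, f 2] ∧ ζ 1 2 = 2 * s * β ![f 0, f 3] ∧
    ζ 1 3 = -(2 * s * β ![f 0, f 2]) ∧ ζ 2 3 = 2 * s * β ![f 0, f 1] := by
  have hc : ∀ a b c d, Ω ![f a, f b, f c, f d] = s *
      (((b : ℝ) - a) * ((c : ℝ) - a) * ((d : ℝ) - a) * ((c : ℝ) - b) * ((d : ℝ) - b) *
        ((d : ℝ) - c) / 12) := fun a b c d => hs ▸ four_form_components Ω f a b c d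
  refine ⟨?_, ?_, ?_, ?_, ?_, ?_⟩ <;>
  · simp only [hζ, Fin.sum_univ_four, hc, two_form_self,
      two_form_swap β (f 0) (f 1), two_form_swap β (f 0) (f 2), two_form_swap β (f 0) (f 3),
      two_form_swap β (f 1) (f 2), two_form_swap β (f 1) (f 3), two_form_swap β (f 2) (f 3)]
    simp only [Fin.val_zero, Fin.val_one, Fin.val_two, show ((3 : Fin 4) : ℕ) = 3 from rfl]
    norm_num
    try ring

end Components

/-! ### Smooth dependence of solutions of linear systems -/

section LinearSystem

variable {V F G : Type*} [NormedAddCommGroup V] [NormedSpace ℝ V]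
  [NormedAddCommGroup F] [NormedSpace ℝ F] [FiniteDimensional ℝ F]
  [NormedAddCommGroup G] [NormedSpace ℝ G] [CompleteSpace G]

/-- The solution of a smooth family of (possibly overdetermined) linear systems which is injective
at one point is smooth near that point. -/
theorem contDiffWithinAt_of_injective_system {A : V → F →L[ℝ] G} {b : V → G} {w : V → F}
    {s : Set V} {y : V} (hA : ContDiffWithinAt ℝ ∞ A s y) (hb : ContDiffWithinAt ℝ ∞ b s y)
    (hinj : Injective (A y)) (hw : ∀ᶠ z in 𝓝[s] y, A z (w z) = b z) (hwy : A y (w y) = b y) :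
    ContDiffWithinAt ℝ ∞ w s y := by
  have : CompleteSpace F := FiniteDimensional.complete ℝ F
  have hfin : FiniteDimensional ℝ (A y).range := inferInstance
  obtain ⟨l, hl⟩ :=
    ContinuousLinearMap.HasLeftInverse.of_injective_of_isClosed_range_of_closedComplement_range
    hinj (Submodule.closed_of_finiteDimensional (A y).range)
    (Submodule.ClosedComplemented.of_finiteDimensional (A y).range)
  -- a left inverse of `A y` turns the system into a square one, invertible near `y`
  let B : V → F →L[ℝ] F := fun z => l.comp (A z)
  have hB : ContDiffWithinAt ℝ ∞ B s y := contDiffWithinAt_const.clm_comp hA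
  have hBy : B y = 1 := ContinuousLinearMap.ext fun v => hl v
  have hinv : ContDiffAt ℝ ∞ Ring.inverse (B y) := by
    have := contDiffAt_ringInverse (n := ∞) ℝ (1 : (F →L[ℝ] F)ˣ)
    rwa [hBy]
  have h1 : ContDiffWithinAt ℝ ∞ (fun z => Ring.inverse (B z) (l (b z))) s y :=
    (hinv.comp_contDiffWithinAt y hB).clm_apply (l.contDiff.comp_contDiffWithinAt hb)
  have hunit : ∀ᶠ z in 𝓝[s] y, IsUnit (B z) := by
    apply hB.continuousWithinAt.eventually
    rw [hBy]
    exact Units.isOpen.mem_nhds isUnit_one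
  have key : ∀ z, IsUnit (B z) → A z (w z) = b z → w z = Ring.inverse (B z) (l (b z)) := by
    intro z hz hwz
    rw [← hwz]
    have := Ring.inverse_mul_cancel (B z) hz
    exact (congrArg (fun T : F →L[ℝ] F => T (w z)) this).symm
  refine h1.congr_of_eventuallyEq ?_ (key y (by rw [hBy]; exact isUnit_one) hwy)
  filter_upwards [hunit, hw] with z hz hwz using key z hz hwz

/-- A version of `contDiffWithinAt_of_injective_system` for finitely many scalar equations. -/
theorem contDiffWithinAt_of_linear_equations {K : Type*} [Fintype K] {A : V → K → F → ℝ}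
    {b : V → K → ℝ} {w : V → F} {s : Set V} {y : V} (hys : y ∈ s)
    (hlin : ∀ z k, IsLinearMap ℝ (A z k))
    (hA : ∀ k c, ContDiffWithinAt ℝ ∞ (fun z => A z k c) s y)
    (hb : ∀ k, ContDiffWithinAt ℝ ∞ (fun z => b z k) s y)
    (hinj : ∀ c, (∀ k, A y k c = 0) → c = 0)
    (hw : ∀ᶠ z in 𝓝[s] y, ∀ k, A z k (w z) = b z k) : ContDiffWithinAt ℝ ∞ w s y := by
  let B : V → F →L[ℝ] (K → ℝ) := fun z =>
    LinearMap.toContinuousLinearMap (LinearMap.pi fun k => (hlin z k).mk' (A z k))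
  have hB : ∀ z c k, B z c k = A z k c := fun z c k => rfl
  refine contDiffWithinAt_of_injective_system (A := B) (b := b) ?_ (contDiffWithinAt_pi.2 hb)
    ?_ (hw.mono fun z hz => funext fun k => hz k)
    (funext fun k => (hw.self_of_nhdsWithin hys) k)
  · let e := Module.finBasis ℝ F
    have hBe : B = fun z => ∑ i, (LinearMap.toContinuousLinearMap (e.coord i)).smulRight
        (B z (e i)) := by
      funext z
      ext c : 1
      conv_lhs => rw [← e.sum_repr c, map_sum]
      simp
    rw [hBe]
    refine ContDiffWithinAt.sum fun i _ => ContDiffWithinAt.smulRight contDiffWithinAt_const ?_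
    exact contDiffWithinAt_pi.2 fun k => hA k (e i)
  · refine (injective_iff_map_eq_zero _).2 fun c hc => hinj c fun k => ?_
    exact congrFun hc k

end LinearSystem

/-! ### Smooth vector fields along maps -/

section Sections

variable {E : Type*} [NormedAddCommGroup E] [NormedSpace ℝ E]
  {H : Type*} [TopologicalSpace H] {I : ModelWithCorners ℝ E H}
  {X : Type*} [TopologicalSpace X] [ChartedSpace H X]
  {E' : Type*} [NormedAddCommGroup E'] [NormedSpace ℝ E']
  {H' : Type*} [TopologicalSpace H'] {I' : ModelWithCorners ℝ E' H'}
  {X' : Type*} [TopologicalSpace X'] [ChartedSpace H' X'] [IsManifold I' ∞ X'] [IsManifold I' 1 X']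

/-- The coordinates of a tangent vector in the preferred chart at `q`. -/
def coordVec (I' : ModelWithCorners ℝ E' H') (q : X') (w : TangentBundle I' X') : E' :=
  tmap I' 𝓘(ℝ, E') (extChartAt I' q) w.proj w.snd

theorem chartInvDeriv_coordVec {q : X'} {w : TangentBundle I' X'}
    (hw : w.proj ∈ (extChartAt I' q).source) :
    chartInvDeriv I' q (extChartAt I' q w.proj) (coordVec I' q w) = w.snd := by
  have := mfderivWithin_extChartAt_symm_comp_mfderiv_extChartAt' (I := I') hw
  exact congrArg (fun T : E' →L[ℝ] E' => T w.snd) this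

theorem coordVec_chartInvDeriv {q x : X'} (hx : x ∈ (extChartAt I' q).source) (c : E') :
    coordVec I' q ⟨x, chartInvDeriv I' q (extChartAt I' q x) c⟩ = c := by
  have := mfderiv_extChartAt_comp_mfderivWithin_extChartAt_symm' (I := I') hx
  exact congrArg (fun T : E' →L[ℝ] E' => T c) this

/-- A vector field along a map is smooth if its base point and its coordinates in one chart are. -/
theorem contMDiffWithinAt_tangentBundle_iff {f : X → TangentBundle I' X'} {s : Set X} {x : X}
    {q : X'} (hq : (f x).proj ∈ (extChartAt I' q).source) :
    ContMDiffWithinAt I I'.tangent ∞ f s x ↔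
      ContMDiffWithinAt I I' ∞ (fun z => (f z).proj) s x ∧
      ContMDiffWithinAt I 𝓘(ℝ, E') ∞ (fun z => coordVec I' q (f z)) s x := by
  have hq' : (f x).proj ∈ (chartAt H' q).source := by rwa [← extChartAt_source (I := I')]
  rw [Trivialization.contMDiffWithinAt_iff (e := trivializationAt E' (TangentSpace I') q)
    (by simpa using hq')]
  refine and_congr_right fun h => ?_
  have key : ∀ z, (f z).proj ∈ (chartAt H' q).source →
      ((trivializationAt E' (TangentSpace I') q) (f z)).2 = coordVec I' q (f z) := by
    intro z hz
    have h1 := TangentBundle.continuousLinearMapAt_trivializationAt (I := I') hz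
    have h2 := congrArg (fun T : E' →L[ℝ] E' => T (f z).snd) h1
    refine Eq.trans ?_ h2
    have := Trivialization.coe_linearMapAt_of_mem (R := ℝ) (trivializationAt E' (TangentSpace I') q)
      (b := (f z).proj) (by simpa using hz)
    exact (congrFun this _).symm
  have hev : ∀ᶠ z in 𝓝[s] x, (f z).proj ∈ (chartAt H' q).source :=
    h.continuousWithinAt.eventually ((chartAt H' q).open_source.mem_nhds hq')
  constructor
  · intro h'
    exact h'.congr_of_eventuallyEq (hev.mono fun z hz => (key z hz).symm) (key x hq').symm
  · intro h'
    exact h'.congr_of_eventuallyEq (hev.mono fun z hz => key z hz) (key x hq')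

end Sections

/-! ### Metrics in coordinates -/

section MetricSmooth

variable {M : Type*} [TopologicalSpace M] [ChartedSpace (Euc 7) M] [IsManifold (𝓡 7) ∞ M]

theorem contDiffAt_inChart (h : Metric M) {q : M} {y : Euc 7} (hy : y ∈ (extChartAt (𝓡 7) q).target)
    (u v : Euc 7) : ContDiffAt ℝ ∞ (fun z => h.inChart q z u v) y := by
  have hs : ContMDiffAt 𝓘(ℝ, Euc 7) (𝓡 7) ∞ (extChartAt (𝓡 7) q).symm y := by
    have := contMDiffWithinAt_chart_symm (I := 𝓡 7) hy
    rwa [ModelWithCorners.range_eq_univ] at this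
  have hsec : ∀ u : Euc 7, ContMDiffAt 𝓘(ℝ, Euc 7) (𝓡 7).tangent ∞
      (fun z => (⟨(extChartAt (𝓡 7) q).symm z, chartInvDeriv (𝓡 7) q z u⟩ :
        TangentBundle (𝓡 7) M)) y := by
    intro u
    refine (contMDiffWithinAt_tangentBundle_iff (q := q) (s := univ)
      ((extChartAt (𝓡 7) q).map_target hy)).2 ⟨hs, ?_⟩
    have hc : ContMDiffAt 𝓘(ℝ, Euc 7) 𝓘(ℝ, Euc 7) ∞ (fun _ : Euc 7 => u) y := contMDiffAt_const
    refine ContMDiffAt.congr_of_eventuallyEq hc ?_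
    filter_upwards [(isOpen_extChartAt_target q).mem_nhds hy] with z hz
    have := coordVec_chartInvDeriv (I' := 𝓡 7) ((extChartAt (𝓡 7) q).map_target hz) u
    rwa [(extChartAt (𝓡 7) q).right_inv hz] at this
  have h1 := ContMDiffAt.clm_bundle_apply₂ (F₁ := Euc 7) (F₂ := Euc 7) (F₃ := ℝ)
    (E₁ := fun x : M => TangentSpace (𝓡 7) x) (E₂ := fun x : M => TangentSpace (𝓡 7) x)
    (E₃ := fun _ : M => ℝ) (b := (extChartAt (𝓡 7) q).symm) (h.contMDiff.contMDiffAt.comp y hs)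
    (hsec u) (hsec v)
  rw [← contMDiffAt_iff_contDiffAt]
  exact (contMDiffAt_totalSpace.1 h1).2

/-- The metric in the coordinates of the preferred chart at `q`, as a bilinear map. -/
def Metric.chartForm (h : Metric M) (q : M) (y : Euc 7) : Euc 7 →L[ℝ] Euc 7 →L[ℝ] ℝ :=
  ((h.inner ((extChartAt (𝓡 7) q).symm y) : Euc 7 →L[ℝ] Euc 7 →L[ℝ] ℝ)).bilinearComp
    (chartInvDeriv (𝓡 7) q y) (chartInvDeriv (𝓡 7) q y)

theorem Metric.chartForm_apply (h : Metric M) (q : M) (y u v : Euc 7) :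
    h.chartForm q y u v = h.inChart q y u v := rfl

theorem contDiffAt_chartForm (h : Metric M) {q : M} {y : Euc 7}
    (hy : y ∈ (extChartAt (𝓡 7) q).target) : ContDiffAt ℝ ∞ (h.chartForm q) y := by
  have : ContDiffOn ℝ ∞ (h.chartForm q) (extChartAt (𝓡 7) q).target :=
    contDiffOn_clm_apply.2 fun u => contDiffOn_clm_apply.2 fun v z hz =>
      (contDiffAt_inChart h hz u v).contDiffWithinAt
  exact this.contDiffAt ((isOpen_extChartAt_target q).mem_nhds hy)

end MetricSmooth

/-! ### Tangent spaces of coassociative submanifolds -/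

section Pointwise

variable {M : Type*} [TopologicalSpace M] [ChartedSpace (Euc 7) M] [IsManifold (𝓡 7) ∞ M]
  {N : Type*} [TopologicalSpace N] [ChartedSpace (EuclideanHalfSpace 4) N]
  {P : AlmostG2 M} {ι : N → M}

theorem Metric.ip_eq_zero (h : Metric M) {x : M} {w : Euc 7} (hw : h.ip x w w = 0) : w = 0 := by
  by_contra hne
  exact (h.pos x w hne).ne' hw

theorem Metric.ip_add_left (h : Metric M) (x : M) (u v w : Euc 7) :
    h.ip x (u + v) w = h.ip x u w + h.ip x v w := by
  have := congrArg (fun T : Euc 7 →L[ℝ] ℝ => T w) ((h.inner x).map_add u v)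
  exact this

theorem Metric.ip_smul_left (h : Metric M) (x : M) (c : ℝ) (u w : Euc 7) :
    h.ip x (c • u) w = c * h.ip x u w := by
  have := congrArg (fun T : Euc 7 →L[ℝ] ℝ => T w) ((h.inner x).map_smul c u)
  exact this

theorem Metric.ip_comm (h : Metric M) (x : M) (u w : Euc 7) : h.ip x u w = h.ip x w u :=
  h.symm x u w

/-- At each point the map to the standard model restricts to an isometric linear embedding of the
tangent space of a coassociative submanifold. -/
theorem IsCoassociative.exists_model (hι : IsCoassociative P ι) (x : N) :
    ∃ e : Euc 7 ≃L[ℝ] Euc 7, (∀ v : Fin 3 → Euc 7, P.φ (ι x) v = phi0 (e ∘ v)) ∧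
      (∀ v : Fin 4 → Euc 7, P.ψ (ι x) v = psi0 (e ∘ v)) ∧
      (∀ u v : Euc 7, P.g.ip (ι x) u v = inner ℝ (e u) (e v)) ∧
      ∀ u v w : Euc 4, phi0 ![e (tmap (𝓡∂ 4) (𝓡 7) ι x u), e (tmap (𝓡∂ 4) (𝓡 7) ι x v),
        e (tmap (𝓡∂ 4) (𝓡 7) ι x w)] = 0 := by
  obtain ⟨e, h1, h2, h3⟩ := P.model (ι x)
  refine ⟨e, h1, h2, h3, fun u v w => ?_⟩
  have h4 := congrArg (fun T : Euc 4 [⋀^Fin 3]→L[ℝ] ℝ => T ![u, v, w]) (hι.vanishes x)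
  have h5 : P.φ (ι x) (tmap (𝓡∂ 4) (𝓡 7) ι x ∘ ![u, v, w]) = 0 := h4
  rw [h1] at h5
  rw [← h5]
  congr 1
  funext i; fin_cases i <;> rfl

/-- There are orthonormal frames with prescribed direction of the first vector. -/
theorem IsCoassociative.exists_orthonormalFrame (hι : IsCoassociative P ι) (x : N) {u : Euc 4}
    (hu : u ≠ 0) : ∃ e, IsOrthonormalFrame P ι x e ∧ ∃ c : ℝ, c ≠ 0 ∧ u = c • e 0 := by
  obtain ⟨m, -, -, hg, -⟩ := hι.exists_model x
  let A : Euc 4 →L[ℝ] Euc 7 := (m : Euc 7 →L[ℝ] Euc 7).comp (tmap (𝓡∂ 4) (𝓡 7) ι x)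
  have hA : Injective A := m.injective.comp (hι.embedded.immersion x)
  let W := A.range
  have hdim : Module.finrank ℝ W = 4 := by
    rw [LinearMap.finrank_range_of_inj (f := A.toLinearMap) hA]; simp
  let v : Fin 4 → W := fun _ => (‖A u‖⁻¹ : ℝ) • ⟨A u, ⟨u, rfl⟩⟩
  have hAu : A u ≠ 0 := fun h => hu (hA (by rw [h, map_zero]))
  have hv : Orthonormal ℝ (({0} : Set (Fin 4)).domRestrict v) := by
    refine ⟨fun i => ?_, fun i j hij => absurd (Subsingleton.elim i j) hij⟩
    change ‖v i‖ = 1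
    simp only [v, norm_smul, norm_inv, norm_norm]
    exact inv_mul_cancel₀ (norm_ne_zero_iff.2 hAu)
  obtain ⟨b, hb⟩ := hv.exists_orthonormalBasis_extension_of_card_eq (by simpa using hdim)
  choose e he using fun i => (b i).2
  have he' : ∀ i, A (e i) = b i := he
  refine ⟨e, fun i k => ?_, ‖A u‖, norm_ne_zero_iff.2 hAu, ?_⟩
  · rw [hg]
    change inner ℝ (A (e i)) (A (e k)) = _
    rw [he', he', ← Submodule.coe_inner, orthonormal_iff_ite.1 b.orthonormal]
  · apply hA
    rw [map_smul, he', hb 0 rfl]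
    simp only [v, Submodule.coe_smul, smul_smul]
    rw [mul_inv_cancel₀ (norm_ne_zero_iff.2 hAu), one_smul]

theorem IsCoassociative.frame_spec (hι : IsCoassociative P ι) (x : N) :
    IsOrthonormalFrame P ι x (frame P ι x) := by
  have h : ∃ e, IsOrthonormalFrame P ι x e := by
    obtain ⟨e, he, -⟩ := hι.exists_orthonormalFrame x
      (u := EuclideanSpace.single 0 1) (by simp)
    exact ⟨e, he⟩
  rw [frame, dif_pos h]
  exact h.choose_spec

/-- The metric induced on the submanifold. -/
def inducedIp (P : AlmostG2 M) (ι : N → M) (x : N) (u v : Euc 4) : ℝ :=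
  P.g.ip (ι x) (tmap (𝓡∂ 4) (𝓡 7) ι x u) (tmap (𝓡∂ 4) (𝓡 7) ι x v)

theorem inducedIp_sum_left (x : N) (c : Fin 4 → ℝ) (e : Fin 4 → Euc 4) (v : Euc 4) :
    inducedIp P ι x (∑ a, c a • e a) v = ∑ a, c a * inducedIp P ι x (e a) v := by
  simp only [inducedIp, Fin.sum_univ_four, map_add, map_smul, Metric.ip_add_left,
    Metric.ip_smul_left]

theorem IsOrthonormalFrame.linearIndependent {x : N} {e : Fin 4 → Euc 4}
    (he : IsOrthonormalFrame P ι x e) : LinearIndependent ℝ e := by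
  rw [Fintype.linearIndependent_iff]
  intro c hc i
  have h1 : inducedIp P ι x (∑ a, c a • e a) (e i) = c i := by
    rw [inducedIp_sum_left]
    have : ∀ a, inducedIp P ι x (e a) (e i) = if a = i then 1 else 0 := fun a => he a i
    simp [this]
  rw [← h1, hc, inducedIp, map_zero, ← zero_smul ℝ (0 : Euc 7), Metric.ip_smul_left, zero_mul]

theorem IsOrthonormalFrame.eq_sum {x : N} {e : Fin 4 → Euc 4}
    (he : IsOrthonormalFrame P ι x e) (u : Euc 4) :
    u = ∑ a, inducedIp P ι x u (e a) • e a := by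
  let b := basisOfLinearIndependentOfCardEqFinrank he.linearIndependent (by simp)
  have hb : ∀ a, b a = e a := fun a => by simp [b]
  have h0 : u = ∑ a, b.repr u a • e a := by
    simpa [hb] using (b.sum_repr u).symm
  have h1 : ∀ i, inducedIp P ι x u (e i) = b.repr u i := by
    intro i
    have : ∀ a, inducedIp P ι x (e a) (e i) = if a = i then 1 else 0 := fun a => he a i
    conv_lhs => rw [h0]
    rw [inducedIp_sum_left]
    simp [this]
  simp only [h1]
  exact h0

theorem IsCoassociative.pull_psi_sq (hι : IsCoassociative P ι) {x : N} {e : Fin 4 → Euc 4}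
    (he : IsOrthonormalFrame P ι x e) : (P.ψ.pull (𝓡∂ 4) (𝓡 7) ι x e) ^ 2 = 1 := by
  obtain ⟨m, -, hψ, hg, h0⟩ := hι.exists_model x
  have h1 := psi0_sq_eq_one (e := fun a => m (tmap (𝓡∂ 4) (𝓡 7) ι x (e a)))
    (fun a b => by rw [← hg]; exact he a b) (fun a b c => h0 _ _ _)
  rw [← h1]
  congr 1
  change P.ψ (ι x) (tmap (𝓡∂ 4) (𝓡 7) ι x ∘ e) = _
  rw [hψ]
  congr 1
  funext i; fin_cases i <;> rfl

/-- By the calibration identity no normalisation is needed: the volume form is the restriction of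
`*φ`. -/
theorem IsCoassociative.vol_eq (hι : IsCoassociative P ι) :
    vol P ι = P.ψ.pull (𝓡∂ 4) (𝓡 7) ι := by
  funext x
  have h := hι.pull_psi_sq (hι.frame_spec x)
  have h1 : |P.ψ.pull (𝓡∂ 4) (𝓡 7) ι x (frame P ι x)| = 1 := by
    rwa [← sq_eq_sq₀ (abs_nonneg _) zero_le_one, sq_abs, one_pow]
  rw [vol, h1, inv_one, one_smul]

theorem IsCoassociative.vol_sq (hι : IsCoassociative P ι) {x : N} {e : Fin 4 → Euc 4}
    (he : IsOrthonormalFrame P ι x e) : (vol P ι x e) ^ 2 = 1 := by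
  rw [hι.vol_eq]; exact hι.pull_psi_sq he

theorem IsCoassociative.isSmooth_vol (hι : IsCoassociative P ι) [IsManifold (𝓡∂ 4) ∞ N] :
    (vol P ι).IsSmooth (𝓡∂ 4) := by
  rw [hι.vol_eq]; exact P.smooth_ψ.pull hι.embedded.smooth

theorem IsCoassociative.vol_ne_zero (hι : IsCoassociative P ι) (x : N) : vol P ι x ≠ 0 := by
  intro h
  have := hι.vol_sq (hι.frame_spec x)
  rw [h] at this
  simp at this

theorem three_form_add {E : Type*} [NormedAddCommGroup E] [NormedSpace ℝ E]
    (η : E [⋀^Fin 3]→L[ℝ] ℝ) (u u' v w : E) :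
    η ![u + u', v, w] = η ![u, v, w] + η ![u', v, w] := by
  have h (z : E) : ![z, v, w] = update ![u, v, w] 0 z := by
    funext i; fin_cases i <;> rfl
  rw [h (u + u'), η.map_update_add, ← h, ← h]

theorem three_form_smul {E : Type*} [NormedAddCommGroup E] [NormedSpace ℝ E]
    (η : E [⋀^Fin 3]→L[ℝ] ℝ) (c : ℝ) (u v w : E) :
    η ![c • u, v, w] = c * η ![u, v, w] := by
  have h (z : E) : ![z, v, w] = update ![u, v, w] 0 z := by
    funext i; fin_cases i <;> rfl
  rw [h (c • u), η.map_update_smul, ← h, smul_eq_mul]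

theorem three_form_isLinearMap_right {E : Type*} [NormedAddCommGroup E] [NormedSpace ℝ E]
    (η : E [⋀^Fin 3]→L[ℝ] ℝ) (u v : E) : IsLinearMap ℝ (fun w => η ![u, v, w]) := by
  have h : ∀ w, η ![u, v, w] = η ![w, u, v] := fun w => (three_form_perm η u v w).2.2.2.1.symm
  simp only [h]
  exact ⟨fun w w' => three_form_add _ _ _ _ _, fun c w => three_form_smul _ _ _ _ _⟩

theorem IsCoassociative.phi_eq_zero (hι : IsCoassociative P ι) (x : N) (u v w : Euc 4) :
    P.φ (ι x) ![tmap (𝓡∂ 4) (𝓡 7) ι x u, tmap (𝓡∂ 4) (𝓡 7) ι x v, tmap (𝓡∂ 4) (𝓡 7) ι x w] = 0 := by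
  obtain ⟨m, hφ, -, -, h0⟩ := hι.exists_model x
  rw [hφ, ← h0 u v w]
  congr 1
  funext i; fin_cases i <;> rfl

/-- A vector normal to a coassociative submanifold, with respect to any metric, is determined by
the restriction to the submanifold of its contraction with `φ` and one tangent vector. -/
theorem IsCoassociative.eq_zero_of_normal (hι : IsCoassociative P ι) (h : Metric M) (x : N)
    {w : Euc 7} {n : Euc 4} (hn : n ≠ 0)
    (hw : ∀ u, h.ip (ι x) w (tmap (𝓡∂ 4) (𝓡 7) ι x u) = 0)
    (hφ : ∀ u, P.φ (ι x) ![w, tmap (𝓡∂ 4) (𝓡 7) ι x n, tmap (𝓡∂ 4) (𝓡 7) ι x u] = 0) : w = 0 := by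
  obtain ⟨e, he, c, hc, hnc⟩ := hι.exists_orthonormalFrame x hn
  obtain ⟨m, hmφ, -, hg, h0⟩ := hι.exists_model x
  set A := tmap (𝓡∂ 4) (𝓡 7) ι x with hA
  -- subtract the tangential component with respect to `g`
  let t : Euc 4 := ∑ a, P.g.ip (ι x) w (A (e a)) • e a
  have hAt : ∀ b, P.g.ip (ι x) (A t) (A (e b)) = P.g.ip (ι x) w (A (e b)) := by
    intro b
    have h1 := inducedIp_sum_left (P := P) (ι := ι) x (fun a => P.g.ip (ι x) w (A (e a))) e (e b)
    have : ∀ a, inducedIp P ι x (e a) (e b) = if a = b then 1 else 0 := fun a => he a b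
    simp only [this] at h1
    rw [show P.g.ip (ι x) (A t) (A (e b)) = _ from h1]
    simp
  have hwt : w = A t + (w - A t) := by abel
  have hz : m (w - A t) = 0 := by
    refine eq_zero_of_coassociative (e := fun a => m (A (e a)))
      (fun a b => by rw [← hg]; exact he a b) (fun a b c => h0 _ _ _) (fun a => ?_) fun a => ?_
    · rw [← hg, Metric.ip_comm, sub_eq_add_neg, Metric.ip_add_left, ← neg_one_smul ℝ,
        Metric.ip_smul_left, hAt]
      ring
    · have h1 : P.φ (ι x) ![w, A (e 0), A (e a)] = 0 := by
        have h2 := hφ (e a)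
        rw [hnc, map_smul, three_form_swap_left, three_form_smul, three_form_swap_left] at h2
        have : c * P.φ (ι x) ![w, A (e 0), A (e a)] = 0 := by linarith
        exact (mul_eq_zero.1 this).resolve_left hc
      rw [hwt, three_form_add, hι.phi_eq_zero, zero_add] at h1
      rw [← (three_form_perm (P.φ (ι x)) (w - A t) (A (e 0)) (A (e a))).2.2.1, hmφ] at h1
      rw [← h1]
      congr 1
      funext i; fin_cases i <;> rfl
  have hz' : w = A t := sub_eq_zero.1 (m.injective (by rw [hz, map_zero]))
  apply h.ip_eq_zero (x := ι x)
  conv_lhs => arg 4; rw [hz']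
  exact hw t

theorem jN_apply (x : N) (w : TangentBundle (𝓡 7) M) (u v : Euc 4) :
    jN P ι x w ![u, v] = P.φ (ι x) ![w.snd, tmap (𝓡∂ 4) (𝓡 7) ι x u, tmap (𝓡∂ 4) (𝓡 7) ι x v] := by
  change P.φ (ι x) (Matrix.vecCons w.snd (tmap (𝓡∂ 4) (𝓡 7) ι x ∘ ![u, v])) = _
  congr 1
  funext i; fin_cases i <;> rfl

theorem Metric.ip_sub_left (h : Metric M) (x : M) (u v w : Euc 7) :
    h.ip x (u - v) w = h.ip x u w - h.ip x v w := by
  rw [sub_eq_add_neg, h.ip_add_left, ← neg_one_smul ℝ, h.ip_smul_left]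
  ring

/-- `ȷ_N` is injective on the normal bundle with respect to any metric, not only to the one induced
by `φ`, because `φ` vanishes on triples of tangent vectors. -/
theorem IsCoassociative.jN_injective (hι : IsCoassociative P ι) (h : Metric M) (x : N)
    {w w' : TangentBundle (𝓡 7) M} (hw : w.proj = ι x) (hw' : w'.proj = ι x)
    (hn : ∀ u, h.ip (ι x) w.snd (tmap (𝓡∂ 4) (𝓡 7) ι x u) = 0)
    (hn' : ∀ u, h.ip (ι x) w'.snd (tmap (𝓡∂ 4) (𝓡 7) ι x u) = 0)
    (hj : jN P ι x w = jN P ι x w') : w = w' := by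
  obtain ⟨a, ha⟩ : ∃ a : Euc 7, a = w.snd := ⟨_, rfl⟩
  obtain ⟨b, hb⟩ : ∃ b : Euc 7, b = w'.snd := ⟨_, rfl⟩
  have h1 : a - b = 0 := by
    rw [← ha] at hn
    rw [← hb] at hn'
    refine hι.eq_zero_of_normal h x (n := EuclideanSpace.single 0 1) (by simp) (fun u => ?_)
      fun u => ?_
    · rw [h.ip_sub_left, hn, hn', sub_zero]
    · have h2 := congrArg (fun T : Euc 4 [⋀^Fin 2]→L[ℝ] ℝ =>
        T ![EuclideanSpace.single 0 1, u]) hj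
      simp only [jN_apply, ← ha, ← hb] at h2
      rw [sub_eq_add_neg, three_form_add, ← neg_one_smul ℝ, three_form_smul, h2]
      ring
  obtain ⟨p, v⟩ := w
  obtain ⟨p', v'⟩ := w'
  obtain rfl : p = p' := hw.trans hw'.symm
  have : v = v' := ha.symm.trans ((sub_eq_zero.1 h1).trans hb)
  rw [this]

end Pointwise

/-! ### The normal field of a self-dual form -/

section NormalField

variable {M : Type*} [TopologicalSpace M] [ChartedSpace (Euc 7) M] [IsManifold (𝓡 7) ∞ M]
  {N : Type*} [TopologicalSpace N] [ChartedSpace (EuclideanHalfSpace 4) N]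
  {P : AlmostG2 M} {ι : N → M} {h : Metric M} {V : Set (TangentBundle (𝓡 7) M)}
  {α : DForm (Euc 4) N 2}

/-- The normal field takes its values in `V`; the choice in its definition is unique by
`jN_injective`. -/
theorem normalField_spec (hι : IsCoassociative P ι) (hV : V ⊆ normalBundle ι h)
    (hα : α ∈ GammaU P ι V) (x : N) :
    normalField P ι h α x ∈ V ∧ (normalField P ι h α x).proj = ι x ∧
      (∀ u, h.ip (ι x) (normalField P ι h α x).snd (tmap (𝓡∂ 4) (𝓡 7) ι x u) = 0) ∧
      jN P ι x (normalField P ι h α x) = α x := by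
  have hnormal : ∀ w ∈ normalBundle ι h, w.proj = ι x →
      ∀ u, h.ip (ι x) w.snd (tmap (𝓡∂ 4) (𝓡 7) ι x u) = 0 := by
    rintro w ⟨x', hx', hw'⟩ hw
    obtain rfl : x' = x := hι.embedded.embedding.injective (hx'.symm.trans hw)
    exact hw'
  obtain ⟨w, hwV, hw, hwj⟩ := hα.2.2 x
  have hex : ∃ w ∈ normalBundle ι h, w.proj = ι x ∧ jN P ι x w = α x := ⟨w, hV hwV, hw, hwj⟩
  have hspec := hex.choose_spec
  have heq : normalField P ι h α x = hex.choose := by rw [normalField, dif_pos hex]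
  rw [← heq] at hspec
  obtain ⟨h1, h2, h3⟩ := hspec
  have hwv : w = normalField P ι h α x :=
    hι.jN_injective h x hw h2 (hnormal w (hV hwV) hw) (hnormal _ h1 h2) (hwj.trans h3.symm)
  exact ⟨hwv ▸ hwV, h2, hnormal _ h1 h2, h3⟩

variable [IsManifold (𝓡∂ 4) ∞ N]

instance instIsManifoldOne : IsManifold (𝓡∂ 4) 1 N := IsManifold.of_le (n := ∞) (by simp)

instance instIsManifoldOneM : IsManifold (𝓡 7) 1 M := IsManifold.of_le (n := ∞) (by simp)

theorem euc_four_ext {T : Euc 4 → ℝ} (hT : IsLinearMap ℝ T)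
    (h : ∀ a, T (EuclideanSpace.single a 1) = 0) (u : Euc 4) : T u = 0 := by
  have : hT.mk' T = 0 := by
    refine (EuclideanSpace.basisFun (Fin 4) ℝ).toBasis.ext fun a => ?_
    simpa using h a
  exact LinearMap.congr_fun this u

/-- The normal field corresponding to a smooth self-dual form is smooth: in coordinates it solves a
smooth linear system which is injective. -/
theorem contMDiff_normalField (hι : IsCoassociative P ι) (hV : V ⊆ normalBundle ι h)
    (hα : α ∈ GammaU P ι V) :
    ContMDiff (𝓡∂ 4) (𝓡 7).tangent ∞ (normalField P ι h α) := by
  intro x₀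
  have hspec := fun x => normalField_spec hι hV hα x
  set v := normalField P ι h α with hv
  set q := ι x₀ with hq
  have hproj : (fun z => (v z).proj) = ι := funext fun z => (hspec z).2.1
  refine (contMDiffWithinAt_tangentBundle_iff (q := q) (s := univ) ?_).2 ⟨?_, ?_⟩
  · rw [(hspec x₀).2.1]; exact mem_extChartAt_source q
  · rw [hproj]; exact hι.embedded.smooth x₀
  set y₀ := extChartAt (𝓡∂ 4) x₀ x₀ with hy₀
  have hy₀t : y₀ ∈ (extChartAt (𝓡∂ 4) x₀).target := mem_extChartAt_target x₀
  have hsy₀ : (extChartAt (𝓡∂ 4) x₀).symm y₀ = x₀ := extChartAt_to_inv x₀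
  have hq₀ : ι ((extChartAt (𝓡∂ 4) x₀).symm y₀) ∈ (extChartAt (𝓡 7) q).source := by
    rw [hsy₀]; exact mem_extChartAt_source q
  set ℓ := localRep (𝓡∂ 4) (𝓡 7) ι x₀ q with hℓ
  have hℓsm : ContDiffWithinAt ℝ ∞ ℓ (range (𝓡∂ 4)) y₀ :=
    contDiffWithinAt_localRep (hι.embedded.smooth _) hy₀t hq₀
  set D := fderivWithin ℝ ℓ (range (𝓡∂ 4)) with hD
  have hDsm : ContDiffWithinAt ℝ ∞ D (range (𝓡∂ 4)) y₀ :=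
    contDiffWithinAt_fderivWithin_range hy₀t hℓsm
  let e : Fin 4 → Euc 4 := fun a => EuclideanSpace.single a 1
  let A : Euc 4 → (Fin 4 ⊕ Fin 4 × Fin 4) → Euc 7 → ℝ := fun y k c =>
    Sum.elim (fun a => h.inChart q (ℓ y) c (D y (e a)))
      (fun p => P.φ.inChart (𝓡 7) q (ℓ y) ![c, D y (e p.1), D y (e p.2)]) k
  let b : Euc 4 → (Fin 4 ⊕ Fin 4 × Fin 4) → ℝ := fun y k =>
    Sum.elim (fun _ => 0) (fun p => α.inChart (𝓡∂ 4) x₀ y ![e p.1, e p.2]) k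
  have hℓt : ℓ y₀ ∈ (extChartAt (𝓡 7) q).target := localRep_mem_target hq₀
  have hsys : ContDiffWithinAt ℝ ∞
      (fun y => coordVec (𝓡 7) q (v ((extChartAt (𝓡∂ 4) x₀).symm y))) (range (𝓡∂ 4)) y₀ := by
    refine contDiffWithinAt_of_linear_equations (A := A) (b := b)
      (extChartAt_target_subset_range x₀ hy₀t) ?_ ?_ ?_ ?_ ?_
    · rintro z (a | ⟨a, a'⟩)
      · constructor
        · intro c c'
          exact congrArg (fun T : Euc 7 →L[ℝ] ℝ => T (D z (e a)))
            ((h.chartForm q (ℓ z)).map_add c c')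
        · intro r c
          exact congrArg (fun T : Euc 7 →L[ℝ] ℝ => T (D z (e a)))
            ((h.chartForm q (ℓ z)).map_smul r c)
      · exact ⟨fun c c' => three_form_add _ _ _ _ _, fun r c => three_form_smul _ _ _ _ _⟩
    · rintro (a | ⟨a, a'⟩) c
      · have h1 := (contDiffAt_chartForm h hℓt).comp_contDiffWithinAt y₀ hℓsm
        exact (h1.clm_apply contDiffWithinAt_const).clm_apply
          (hDsm.clm_apply contDiffWithinAt_const)
      · have h1 : ContDiffWithinAt ℝ ∞ (P.φ.inChart (𝓡 7) q) (range (𝓡 7)) (ℓ y₀) :=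
          P.smooth_φ.contDiffWithinAt hℓt
        refine contDiffWithinAt_alternating_apply
          (h1.comp y₀ hℓsm (mapsTo_localRep _ _ _ _)) fun i => ?_
        fin_cases i
        · exact contDiffWithinAt_const
        · exact hDsm.clm_apply contDiffWithinAt_const
        · exact hDsm.clm_apply contDiffWithinAt_const
    · rintro (a | ⟨a, a'⟩)
      · exact contDiffWithinAt_const
      · refine contDiffWithinAt_alternating_apply (A := fun _ => ![e a, e a'])
          (hα.1.contDiffWithinAt hy₀t) fun i => contDiffWithinAt_const
    · intro c hc
      have hℓy : ℓ y₀ = extChartAt (𝓡 7) q q := by rw [hℓ, localRep, hsy₀]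
      have hDy : D y₀ = tmap (𝓡∂ 4) (𝓡 7) ι x₀ :=
        (tmap_eq_fderivWithin (hι.embedded.smooth x₀)).symm
      have hsq : (extChartAt (𝓡 7) q).symm (ℓ y₀) = q := by rw [hℓy]; simp
      have h1 : ∀ u u', h.inChart q (ℓ y₀) u u' = h.ip q u u' := by
        intro u u'
        rw [Metric.inChart, hsq, hℓy, chartInvDeriv_self]
        rfl
      have h2 : P.φ.inChart (𝓡 7) q (ℓ y₀) = P.φ q := by
        rw [hℓy, DForm.inChart_self]
      refine hι.eq_zero_of_normal h x₀ (n := e 0) (by simp [e]) ?_ ?_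
      · refine euc_four_ext ?_ fun a => ?_
        · constructor
          · intro u u'
            rw [map_add, h.ip_comm, h.ip_add_left, h.ip_comm, h.ip_comm _ _ c]
          · intro r u
            rw [map_smul, h.ip_comm, h.ip_smul_left, h.ip_comm]; rfl
        · have := hc (Sum.inl a)
          rw [← h1, ← hDy]; exact this
      · refine euc_four_ext ?_ fun a => ?_
        · exact (((three_form_isLinearMap_right (P.φ (ι x₀)) c _).mk' _).comp
            (tmap (𝓡∂ 4) (𝓡 7) ι x₀).toLinearMap).isLinear
        · have := hc (Sum.inr (0, a))
          rw [← hDy, ← hq, ← h2]; exact this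
    · filter_upwards [eventually_mem_source hι.embedded.smooth.continuous.continuousAt hy₀t hq₀]
        with y hy
      set z := (extChartAt (𝓡∂ 4) x₀).symm y with hz
      have hcomp := tmap_comp_chartInvDeriv (hι.embedded.smooth z) hy.1 hy.2
      have hcomp' : ∀ u, chartInvDeriv (𝓡 7) q (ℓ y) (D y u) =
          tmap (𝓡∂ 4) (𝓡 7) ι z (chartInvDeriv (𝓡∂ 4) x₀ y u) := fun u =>
        (congrArg (fun T : Euc 4 →L[ℝ] Euc 7 => T u) hcomp).symm
      have hsℓ : (extChartAt (𝓡 7) q).symm (ℓ y) = ι z := (extChartAt (𝓡 7) q).left_inv hy.2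
      have hvc : chartInvDeriv (𝓡 7) q (ℓ y) (coordVec (𝓡 7) q (v z)) = (v z).snd := by
        have := chartInvDeriv_coordVec (I' := 𝓡 7) (q := q) (w := v z)
          (by rw [(hspec z).2.1]; exact hy.2)
        rwa [(hspec z).2.1] at this
      rintro (a | ⟨a, a'⟩)
      · change h.inChart q (ℓ y) _ (D y (e a)) = 0
        rw [Metric.inChart, hcomp', hvc, hsℓ]
        exact (hspec z).2.2.1 _
      · change P.φ.inChart (𝓡 7) q (ℓ y) ![_, D y (e a), D y (e a')] =
          α.inChart (𝓡∂ 4) x₀ y ![e a, e a']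
        have h1 : α.inChart (𝓡∂ 4) x₀ y ![e a, e a'] =
            α z ![chartInvDeriv (𝓡∂ 4) x₀ y (e a), chartInvDeriv (𝓡∂ 4) x₀ y (e a')] := by
          change α z (chartInvDeriv (𝓡∂ 4) x₀ y ∘ ![e a, e a']) = _
          congr 1
          funext i; fin_cases i <;> rfl
        rw [h1, ← (hspec z).2.2.2, jN_apply, ← hcomp', ← hcomp', ← hvc, ← hsℓ]
        change P.φ _ (chartInvDeriv (𝓡 7) q (ℓ y) ∘ ![_, D y (e a), D y (e a')]) = _
        congr 1
        funext i; fin_cases i <;> rfl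
  have h1 : ContMDiffWithinAt (𝓡∂ 4) 𝓘(ℝ, Euc 4) ∞ (extChartAt (𝓡∂ 4) x₀) univ x₀ :=
    contMDiffAt_extChartAt
  have h2 := (contMDiffWithinAt_iff_contDiffWithinAt.2 hsys).comp x₀ h1
    (fun z _ => by simp [extChartAt])
  refine h2.congr_of_eventuallyEq ?_ ?_
  · rw [nhdsWithin_univ]
    filter_upwards [extChartAt_source_mem_nhds (I := 𝓡∂ 4) x₀] with z hz
    simp only [comp, (extChartAt (𝓡∂ 4) x₀).left_inv hz]
  · simp only [comp, (extChartAt (𝓡∂ 4) x₀).left_inv (mem_extChartAt_source x₀)]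

end NormalField

/-! ### The Hodge star in an orthonormal frame -/

section Star

variable {M : Type*} [TopologicalSpace M] [ChartedSpace (Euc 7) M] [IsManifold (𝓡 7) ∞ M]
  {N : Type*} [TopologicalSpace N] [ChartedSpace (EuclideanHalfSpace 4) N]
  {P : AlmostG2 M} {ι : N → M}

theorem star3_apply (η : DForm (Euc 4) N 3) (x : N) (u : Euc 4) :
    star3 P ι η x ![u] = 1 / 6 * ∑ a, ∑ b, ∑ c,
      η x ![frame P ι x a, frame P ι x b, frame P ι x c] *
        vol P ι x ![frame P ι x a, frame P ι x b, frame P ι x c, u] := by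
  have hcons : ∀ a b c, vol P ι x ![frame P ι x a, frame P ι x b, frame P ι x c, u] =
    ((((vol P ι x).curryLeft (frame P ι x a)).curryLeft (frame P ι x b)).curryLeft (frame P ι x c))
      ![u] := fun a b c => rfl
  simp only [hcons]
  rw [star3]
  simp only [ContinuousAlternatingMap.smul_apply, ContinuousAlternatingMap.sum_apply, smul_eq_mul]

theorem star2_apply (η : DForm (Euc 4) N 2) (x : N) (u v : Euc 4) :
    star2 P ι η x ![u, v] = 1 / 2 * ∑ a, ∑ b,
      η x ![frame P ι x a, frame P ι x b] * vol P ι x ![frame P ι x a, frame P ι x b, u, v] := by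
  have hcons : ∀ a b, vol P ι x ![frame P ι x a, frame P ι x b, u, v] =
    (((vol P ι x).curryLeft (frame P ι x a)).curryLeft (frame P ι x b)) ![u, v] := fun a b => rfl
  simp only [hcons]
  rw [star2]
  simp only [ContinuousAlternatingMap.smul_apply, ContinuousAlternatingMap.sum_apply, smul_eq_mul]

theorem frame_vec (x : N) : ![frame P ι x 0, frame P ι x 1, frame P ι x 2, frame P ι x 3] =
    frame P ι x := by
  funext i; fin_cases i <;> rfl

theorem star3_frame (η : DForm (Euc 4) N 3) (x : N) {f : Fin 4 → Euc 4} (hf : f = frame P ι x)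
    {s : ℝ} (hs : vol P ι x f = s) :
    star3 P ι η x ![f 0] = -(s * η x ![f 1, f 2, f 3]) ∧
    star3 P ι η x ![f 1] = s * η x ![f 0, f 2, f 3] ∧
    star3 P ι η x ![f 2] = -(s * η x ![f 0, f 1, f 3]) ∧
    star3 P ι η x ![f 3] = s * η x ![f 0, f 1, f 2] := by
  subst hf
  obtain ⟨h0, h1, h2, h3⟩ := sum_star_three (vol P ι x) (η x) (frame P ι x) s
    (by rw [frame_vec, hs]) (fun d => _) (fun d => rfl)
  simp only [star3_apply, h0, h1, h2, h3]
  refine ⟨?_, ?_, ?_, ?_⟩ <;> ring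

theorem star2_frame (η : DForm (Euc 4) N 2) (x : N) {f : Fin 4 → Euc 4} (hf : f = frame P ι x)
    {s : ℝ} (hs : vol P ι x f = s) :
    star2 P ι η x ![f 0, f 1] = s * η x ![f 2, f 3] ∧
    star2 P ι η x ![f 0, f 2] = -(s * η x ![f 1, f 3]) ∧
    star2 P ι η x ![f 0, f 3] = s * η x ![f 1, f 2] ∧
    star2 P ι η x ![f 1, f 2] = s * η x ![f 0, f 3] ∧
    star2 P ι η x ![f 1, f 3] = -(s * η x ![f 0, f 2]) ∧
    star2 P ι η x ![f 2, f 3] = s * η x ![f 0, f 1] := by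
  subst hf
  obtain ⟨h0, h1, h2, h3, h4, h5⟩ := sum_star_two (vol P ι x) (η x) (frame P ι x) s
    (by rw [frame_vec, hs]) (fun c d => _) (fun c d => rfl)
  simp only [star2_apply, h0, h1, h2, h3, h4, h5]
  refine ⟨?_, ?_, ?_, ?_, ?_, ?_⟩ <;> ring

/-- Two-forms agreeing on the pairs of a basis are equal. -/
theorem two_form_ext {f : Fin 4 → Euc 4} (hf : LinearIndependent ℝ f)
    {β β' : Euc 4 [⋀^Fin 2]→L[ℝ] ℝ} (h01 : β ![f 0, f 1] = β' ![f 0, f 1])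
    (h02 : β ![f 0, f 2] = β' ![f 0, f 2]) (h03 : β ![f 0, f 3] = β' ![f 0, f 3])
    (h12 : β ![f 1, f 2] = β' ![f 1, f 2]) (h13 : β ![f 1, f 3] = β' ![f 1, f 3])
    (h23 : β ![f 2, f 3] = β' ![f 2, f 3]) : β = β' := by
  let b := basisOfLinearIndependentOfCardEqFinrank hf (by simp)
  have key : ∀ a c, β ![f a, f c] = β' ![f a, f c] := by
    intro a c
    fin_cases a <;> fin_cases c <;>
      simp [two_form_self, two_form_swap _ (f 0) (f 1), two_form_swap _ (f 0) (f 2),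
        two_form_swap _ (f 0) (f 3), two_form_swap _ (f 1) (f 2), two_form_swap _ (f 1) (f 3),
        two_form_swap _ (f 2) (f 3), *]
  apply ContinuousAlternatingMap.toAlternatingMap_injective
  refine Module.Basis.ext_alternating b fun i _ => ?_
  have : (fun k => b (i k)) = ![f (i 0), f (i 1)] := by
    funext k; fin_cases k <;> simp [b]
  rw [this]
  exact key _ _

theorem three_form_self (η : Euc 4 [⋀^Fin 3]→L[ℝ] ℝ) (u v : Euc 4) :
    η ![u, u, v] = 0 ∧ η ![u, v, u] = 0 ∧ η ![v, u, u] = 0 :=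
  ⟨η.map_eq_zero_of_eq ![u, u, v] (i := 0) (j := 1) rfl (by decide),
    η.map_eq_zero_of_eq ![u, v, u] (i := 0) (j := 2) rfl (by decide),
    η.map_eq_zero_of_eq ![v, u, u] (i := 1) (j := 2) rfl (by decide)⟩

/-- Three-forms agreeing on the triples of a basis are equal. -/
theorem three_form_ext {f : Fin 4 → Euc 4} (hf : LinearIndependent ℝ f)
    {β β' : Euc 4 [⋀^Fin 3]→L[ℝ] ℝ} (h0 : β ![f 1, f 2, f 3] = β' ![f 1, f 2, f 3])
    (h1 : β ![f 0, f 2, f 3] = β' ![f 0, f 2, f 3]) (h2 : β ![f 0, f 1, f 3] = β' ![f 0, f 1, f 3])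
    (h3 : β ![f 0, f 1, f 2] = β' ![f 0, f 1, f 2]) : β = β' := by
  let b := basisOfLinearIndependentOfCardEqFinrank hf (by simp)
  have key : ∀ a c d, β ![f a, f c, f d] = β' ![f a, f c, f d] := by
    obtain ⟨a1, a2, a3, a4, a5⟩ := three_form_perm β (f 0) (f 1) (f 2)
    obtain ⟨b1, b2, b3, b4, b5⟩ := three_form_perm β (f 0) (f 1) (f 3)
    obtain ⟨c1, c2, c3, c4, c5⟩ := three_form_perm β (f 0) (f 2) (f 3)
    obtain ⟨d1, d2, d3, d4, d5⟩ := three_form_perm β (f 1) (f 2) (f 3)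
    obtain ⟨a1', a2', a3', a4', a5'⟩ := three_form_perm β' (f 0) (f 1) (f 2)
    obtain ⟨b1', b2', b3', b4', b5'⟩ := three_form_perm β' (f 0) (f 1) (f 3)
    obtain ⟨c1', c2', c3', c4', c5'⟩ := three_form_perm β' (f 0) (f 2) (f 3)
    obtain ⟨d1', d2', d3', d4', d5'⟩ := three_form_perm β' (f 1) (f 2) (f 3)
    have e1 : ∀ (θ : Euc 4 [⋀^Fin 3]→L[ℝ] ℝ) u v, θ ![u, u, v] = 0 :=
      fun θ u v => (three_form_self θ u v).1
    have e2 : ∀ (θ : Euc 4 [⋀^Fin 3]→L[ℝ] ℝ) u v, θ ![u, v, u] = 0 :=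
      fun θ u v => (three_form_self θ u v).2.1
    have e3 : ∀ (θ : Euc 4 [⋀^Fin 3]→L[ℝ] ℝ) u v, θ ![v, u, u] = 0 :=
      fun θ u v => (three_form_self θ u v).2.2
    intro a c d
    fin_cases a <;> fin_cases c <;> fin_cases d <;>
      simp [*]
  apply ContinuousAlternatingMap.toAlternatingMap_injective
  refine Module.Basis.ext_alternating b fun i _ => ?_
  have : (fun k => b (i k)) = ![f (i 0), f (i 1), f (i 2)] := by
    funext k; fin_cases k <;> simp [b]
  rw [this]
  exact key _ _ _

/-- The Hodge star is an involution on 2-forms. -/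
theorem IsCoassociative.star2_star2 (hι : IsCoassociative P ι) (β : DForm (Euc 4) N 2) (x : N) :
    star2 P ι (star2 P ι β) x = β x := by
  have hf := hι.frame_spec x
  have hs := hι.vol_sq hf
  obtain ⟨s, hs'⟩ : ∃ s, vol P ι x (frame P ι x) = s := ⟨_, rfl⟩
  obtain ⟨a1, a2, a3, a4, a5, a6⟩ := star2_frame β x rfl hs'
  obtain ⟨b1, b2, b3, b4, b5, b6⟩ := star2_frame (star2 P ι β) x rfl hs'
  rw [hs'] at hs
  have key : ∀ t : ℝ, s * (s * t) = t := fun t => by rw [← mul_assoc, ← sq, hs, one_mul]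
  apply two_form_ext hf.linearIndependent <;> simp [*]

theorem one_form_isLinearMap {E : Type*} [NormedAddCommGroup E] [NormedSpace ℝ E]
    (ξ : E [⋀^Fin 1]→L[ℝ] ℝ) : IsLinearMap ℝ (fun u => ξ ![u]) := by
  have h : ∀ u z : E, update ![u] 0 z = ![z] := by
    intro u z; funext i; fin_cases i; rfl
  constructor
  · intro u v
    have := ξ.map_update_add ![0] 0 u v
    simpa only [h] using this
  · intro c u
    have := ξ.map_update_smul ![0] 0 c u
    simpa only [h] using this

/-- The vector whose contraction with the volume form is a given 3-form. -/
def starVec (P : AlmostG2 M) (ι : N → M) (η : DForm (Euc 4) N 3) (x : N) : Euc 4 :=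
  -∑ a, star3 P ι η x ![frame P ι x a] • frame P ι x a

theorem IsCoassociative.star3_eq_inducedIp (hι : IsCoassociative P ι) (η : DForm (Euc 4) N 3)
    (x : N) (u : Euc 4) : star3 P ι η x ![u] = -inducedIp P ι x (starVec P ι η x) u := by
  have hf := hι.frame_spec x
  have h1 : starVec P ι η x = ∑ a, (-star3 P ι η x ![frame P ι x a]) • frame P ι x a := by
    simp [starVec]
  have hT := one_form_isLinearMap (star3 P ι η x)
  have h2 : star3 P ι η x ![u] =
      ∑ a, inducedIp P ι x u (frame P ι x a) * star3 P ι η x ![frame P ι x a] := by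
    have := congrArg (hT.mk' _) (hf.eq_sum u)
    rw [map_sum] at this
    simpa using this
  rw [h1, inducedIp_sum_left, h2, ← Finset.sum_neg_distrib]
  refine Finset.sum_congr rfl fun a _ => ?_
  have : inducedIp P ι x u (frame P ι x a) = inducedIp P ι x (frame P ι x a) u :=
    P.g.ip_comm _ _ _
  rw [this]; ring

theorem IsCoassociative.vol_starVec (hι : IsCoassociative P ι) (η : DForm (Euc 4) N 3) (x : N) :
    (vol P ι x).curryLeft (starVec P ι η x) = η x := by
  have hf := hι.frame_spec x
  have hs := hι.vol_sq hf
  obtain ⟨f, hff⟩ : ∃ f, f = frame P ι x := ⟨_, rfl⟩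
  obtain ⟨s, hs'⟩ : ∃ s, vol P ι x f = s := ⟨_, rfl⟩
  obtain ⟨a1, a2, a3, a4⟩ := star3_frame η x hff hs'
  rw [← hff] at hf hs
  rw [hs'] at hs
  have key : ∀ t : ℝ, s * t * s = t := fun t => by
    rw [mul_right_comm, ← sq, hs, one_mul]
  have hv : ![f 0, f 1, f 2, f 3] = f := by funext i; fin_cases i <;> rfl
  have hc : ∀ a b c d, vol P ι x ![f a, f b, f c, f d] = s *
      (((b : ℝ) - a) * ((c : ℝ) - a) * ((d : ℝ) - a) * ((c : ℝ) - b) * ((d : ℝ) - b) *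
        ((d : ℝ) - c) / 12) := fun a b c d => by
    rw [four_form_components, hv, hs']
  have hX : ∀ b c d, (vol P ι x).curryLeft (starVec P ι η x) ![f b, f c, f d] =
      -∑ a, star3 P ι η x ![f a] * vol P ι x ![f a, f b, f c, f d] := by
    intro b c d
    rw [starVec, ← hff, map_neg, map_sum, ContinuousAlternatingMap.neg_apply,
      ContinuousAlternatingMap.sum_apply]
    congr 1
    refine Finset.sum_congr rfl fun a _ => ?_
    rw [map_smul]; rfl
  apply three_form_ext hf.linearIndependent <;>
  · rw [hX]
    simp only [hc, Fin.sum_univ_four, a1, a2, a3, a4]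
    simp only [Fin.val_zero, Fin.val_one, Fin.val_two, show ((3 : Fin 4) : ℕ) = 3 from rfl]
    norm_num
    try linarith [key (η x ![f 1, f 2, f 3]), key (η x ![f 0, f 2, f 3]),
      key (η x ![f 0, f 1, f 3]), key (η x ![f 0, f 1, f 2])]

end Star

/-! ### Smoothness of the Hodge star -/

section StarSmooth

variable {M : Type*} [TopologicalSpace M] [ChartedSpace (Euc 7) M] [IsManifold (𝓡 7) ∞ M]
  {N : Type*} [TopologicalSpace N] [ChartedSpace (EuclideanHalfSpace 4) N]
  [IsManifold (𝓡∂ 4) ∞ N] {P : AlmostG2 M} {ι : N → M}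

theorem IsCoassociative.eq_zero_of_curryLeft_vol (hι : IsCoassociative P ι) {x : N} {u : Euc 4}
    (hu : (vol P ι x).curryLeft u = 0) : u = 0 := by
  by_contra hne
  obtain ⟨e, he, c, hc, huc⟩ := hι.exists_orthonormalFrame x hne
  have h1 : (vol P ι x).curryLeft (e 0) = 0 := by
    rw [huc, map_smul] at hu
    exact (smul_eq_zero.1 hu).resolve_left hc
  have h2 : vol P ι x e = (vol P ι x).curryLeft (e 0) ![e 1, e 2, e 3] := by
    change _ = vol P ι x ![e 0, e 1, e 2, e 3]
    congr 1
    funext i; fin_cases i <;> rfl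
  have h3 := hι.vol_sq he
  rw [h2, h1] at h3
  simp at h3

theorem curryLeft_inChart_apply (θ : DForm (Euc 4) N 4) (x₀ : N) (y c : Euc 4)
    (v : Fin 3 → Euc 4) : (θ.inChart (𝓡∂ 4) x₀ y).curryLeft c v =
      (θ ((extChartAt (𝓡∂ 4) x₀).symm y)).curryLeft (chartInvDeriv (𝓡∂ 4) x₀ y c)
        (chartInvDeriv (𝓡∂ 4) x₀ y ∘ v) := by
  change θ _ (chartInvDeriv (𝓡∂ 4) x₀ y ∘ Matrix.vecCons c v) = θ _ (Matrix.vecCons _ _)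
  congr 1
  funext i
  refine Fin.cases rfl (fun k => rfl) i

/-- The Hodge star of a smooth 3-form is smooth. The frame in its definition is chosen pointwise and
need not even be continuous; but the vector dual to `*η` is characterised by the linear equations
`X ⌟ vol = η`, which have smooth coefficients. -/
theorem IsCoassociative.isSmooth_star3 (hι : IsCoassociative P ι) {η : DForm (Euc 4) N 3}
    (hη : η.IsSmooth (𝓡∂ 4)) : (star3 P ι η).IsSmooth (𝓡∂ 4) := by
  refine DForm.isSmooth_of_contDiffWithinAt fun x₀ y hy => ?_
  set z₀ := (extChartAt (𝓡∂ 4) x₀).symm y with hz₀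
  set q := ι z₀ with hq
  have hq₀ : ι ((extChartAt (𝓡∂ 4) x₀).symm y) ∈ (extChartAt (𝓡 7) q).source :=
    mem_extChartAt_source q
  set ℓ := localRep (𝓡∂ 4) (𝓡 7) ι x₀ q with hℓ
  have hℓsm : ContDiffWithinAt ℝ ∞ ℓ (range (𝓡∂ 4)) y :=
    contDiffWithinAt_localRep (hι.embedded.smooth _) hy hq₀
  set D := fderivWithin ℝ ℓ (range (𝓡∂ 4)) with hD
  have hDsm : ContDiffWithinAt ℝ ∞ D (range (𝓡∂ 4)) y :=
    contDiffWithinAt_fderivWithin_range hy hℓsm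
  have hℓt : ℓ y ∈ (extChartAt (𝓡 7) q).target := localRep_mem_target hq₀
  let X : N → TangentBundle (𝓡∂ 4) N := fun z => ⟨z, starVec P ι η z⟩
  let c : Euc 4 → Euc 4 := fun y => coordVec (𝓡∂ 4) x₀ (X ((extChartAt (𝓡∂ 4) x₀).symm y))
  have hXc : ∀ y' ∈ (extChartAt (𝓡∂ 4) x₀).target, chartInvDeriv (𝓡∂ 4) x₀ y' (c y') =
      starVec P ι η ((extChartAt (𝓡∂ 4) x₀).symm y') := by
    intro y' hy'
    have := chartInvDeriv_coordVec (I' := 𝓡∂ 4) (q := x₀)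
      (w := X ((extChartAt (𝓡∂ 4) x₀).symm y')) ((extChartAt (𝓡∂ 4) x₀).map_target hy')
    rwa [show (X ((extChartAt (𝓡∂ 4) x₀).symm y')).proj = (extChartAt (𝓡∂ 4) x₀).symm y' from rfl,
      (extChartAt (𝓡∂ 4) x₀).right_inv hy'] at this
  let e := Module.finBasis ℝ (Euc 4)
  let A : Euc 4 → (Fin 3 → Fin (Module.finrank ℝ (Euc 4))) → Euc 4 → ℝ := fun y k c =>
    ((vol P ι).inChart (𝓡∂ 4) x₀ y).curryLeft c (e ∘ k)
  have hcsm : ContDiffWithinAt ℝ ∞ c (range (𝓡∂ 4)) y := by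
    refine contDiffWithinAt_of_linear_equations (A := A)
      (b := fun y k => η.inChart (𝓡∂ 4) x₀ y (e ∘ k))
      (extChartAt_target_subset_range x₀ hy) ?_ ?_ ?_ ?_ ?_
    · intro z k
      exact ⟨fun a b => by simp only [A, map_add, ContinuousAlternatingMap.add_apply],
        fun r a => by simp only [A, map_smul, ContinuousAlternatingMap.smul_apply]⟩
    · intro k a
      exact contDiffWithinAt_alternating_apply (A := fun _ => Matrix.vecCons a (e ∘ k))
        (hι.isSmooth_vol.contDiffWithinAt hy) fun i => contDiffWithinAt_const
    · intro k
      exact contDiffWithinAt_alternating_apply (A := fun _ => e ∘ k)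
        (hη.contDiffWithinAt hy) fun i => contDiffWithinAt_const
    · intro a ha
      have h1 : ((vol P ι).inChart (𝓡∂ 4) x₀ y).curryLeft a = 0 := by
        apply ContinuousAlternatingMap.toAlternatingMap_injective
        exact Module.Basis.ext_alternating e fun i _ => ha i
      apply (bijective_chartInvDeriv (I := 𝓡∂ 4) hy).1
      rw [map_zero]
      apply hι.eq_zero_of_curryLeft_vol (x := z₀)
      ext v
      choose v' hv' using fun i => (bijective_chartInvDeriv (I := 𝓡∂ 4) hy).2 (v i)
      have h2 : v = chartInvDeriv (𝓡∂ 4) x₀ y ∘ v' := funext fun i => (hv' i).symm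
      rw [h2, ← curryLeft_inChart_apply, h1]
      rfl
    · filter_upwards [target_mem_nhdsWithin_range hy] with y' hy' k
      change ((vol P ι).inChart (𝓡∂ 4) x₀ y').curryLeft (c y') (e ∘ k) = _
      rw [curryLeft_inChart_apply, hXc y' hy', hι.vol_starVec]
      rfl
  refine contDiffWithinAt_alternating fun v => ?_
  have h1 := (contDiffAt_chartForm P.g hℓt).comp_contDiffWithinAt y hℓsm
  have h2 : ContDiffWithinAt ℝ ∞ (fun y => -P.g.chartForm q (ℓ y) (D y (c y)) (D y (v 0)))
      (range (𝓡∂ 4)) y :=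
    ((h1.clm_apply (hDsm.clm_apply hcsm)).clm_apply (hDsm.clm_apply contDiffWithinAt_const)).neg
  have hev : ∀ y', y' ∈ (extChartAt (𝓡∂ 4) x₀).target ∧
      ι ((extChartAt (𝓡∂ 4) x₀).symm y') ∈ (extChartAt (𝓡 7) q).source →
      (star3 P ι η).inChart (𝓡∂ 4) x₀ y' v =
        -P.g.chartForm q (ℓ y') (D y' (c y')) (D y' (v 0)) := by
    intro y' hy'
    set z := (extChartAt (𝓡∂ 4) x₀).symm y' with hz
    have hcomp := tmap_comp_chartInvDeriv (hι.embedded.smooth z) hy'.1 hy'.2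
    have hcomp' : ∀ u, chartInvDeriv (𝓡 7) q (ℓ y') (D y' u) =
        tmap (𝓡∂ 4) (𝓡 7) ι z (chartInvDeriv (𝓡∂ 4) x₀ y' u) := fun u =>
      (congrArg (fun T : Euc 4 →L[ℝ] Euc 7 => T u) hcomp).symm
    have hsℓ : (extChartAt (𝓡 7) q).symm (ℓ y') = ι z := (extChartAt (𝓡 7) q).left_inv hy'.2
    rw [Metric.chartForm_apply, Metric.inChart, hcomp', hcomp', hsℓ, hXc y' hy'.1]
    have h3 : (star3 P ι η).inChart (𝓡∂ 4) x₀ y' v =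
        star3 P ι η z ![chartInvDeriv (𝓡∂ 4) x₀ y' (v 0)] := by
      change star3 P ι η z (chartInvDeriv (𝓡∂ 4) x₀ y' ∘ v) = _
      congr 1
      funext i; fin_cases i; rfl
    rw [h3, hι.star3_eq_inducedIp]
    rfl
  refine h2.congr_of_eventuallyEq ?_ (hev y ⟨hy, hq₀⟩)
  filter_upwards [eventually_mem_source hι.embedded.smooth.continuous.continuousAt hy hq₀]
    with y' hy' using hev y' hy'

end StarSmooth

/-! ### Smooth families of forms -/

section Families

variable {E : Type*} [NormedAddCommGroup E] [NormedSpace ℝ E]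
  {H : Type*} [TopologicalSpace H] {I : ModelWithCorners ℝ E H}
  {X : Type*} [TopologicalSpace X] [ChartedSpace H X] [IsManifold I ∞ X]

/-- Smoothness of a family of forms, jointly in the parameter. -/
def IsSmoothFamily (I : ModelWithCorners ℝ E H) {k : ℕ} (θ : ℝ → DForm E X k) : Prop :=
  ∀ x₀ : X, ContDiffOn ℝ ∞ (fun p : ℝ × E => (θ p.1).inChart I x₀ p.2)
    (univ ×ˢ (extChartAt I x₀).target)

theorem univ_prod_target_mem {x₀ : X} {y : E} (hy : y ∈ (extChartAt I x₀).target) (t : ℝ) :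
    (univ : Set ℝ) ×ˢ (extChartAt I x₀).target ∈ 𝓝[univ ×ˢ range I] (t, y) := by
  rw [nhdsWithin_prod_eq]
  exact Filter.prod_mem_prod Filter.univ_mem (target_mem_nhdsWithin_range hy)

theorem uniqueDiffOn_univ_prod_range : UniqueDiffOn ℝ ((univ : Set ℝ) ×ˢ range I) :=
  uniqueDiffOn_univ.prod I.uniqueDiffOn

theorem IsSmoothFamily.contDiffWithinAt {k : ℕ} {θ : ℝ → DForm E X k} (h : IsSmoothFamily I θ)
    {x₀ : X} {y : E} (hy : y ∈ (extChartAt I x₀).target) (t : ℝ) :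
    ContDiffWithinAt ℝ ∞ (fun p : ℝ × E => (θ p.1).inChart I x₀ p.2) (univ ×ˢ range I) (t, y) :=
  (h x₀ (t, y) ⟨mem_univ _, hy⟩).mono_of_mem_nhdsWithin (univ_prod_target_mem hy t)

theorem IsSmoothFamily.isSmooth {k : ℕ} {θ : ℝ → DForm E X k} (h : IsSmoothFamily I θ) (t : ℝ) :
    (θ t).IsSmooth I := fun x₀ =>
  (h x₀).comp (contDiff_prodMk_right t).contDiffOn fun _ hy => ⟨mem_univ _, hy⟩

theorem IsSmoothFamily.wedge [FiniteDimensional ℝ E] {ξ : DForm E X 1} (hξ : ξ.IsSmooth I)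
    {θ : ℝ → DForm E X 2} (h : IsSmoothFamily I θ) :
    IsSmoothFamily I (fun t => ξ.wedge (θ t)) := by
  intro x₀ p hp
  refine contDiffWithinAt_alternating fun v => ?_
  have hda : ∀ w, ContDiffWithinAt ℝ ∞ (fun p : ℝ × E => ξ.inChart I x₀ p.2 w)
      (univ ×ˢ (extChartAt I x₀).target) p := fun w =>
    contDiffWithinAt_alternating_apply (A := fun _ => w)
      ((hξ x₀ p.2 hp.2).comp p contDiff_snd.contDiffWithinAt fun z hz => hz.2)
      fun _ => contDiffWithinAt_const
  have hdb : ∀ w, ContDiffWithinAt ℝ ∞ (fun p : ℝ × E => (θ p.1).inChart I x₀ p.2 w)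
      (univ ×ˢ (extChartAt I x₀).target) p := fun w =>
    contDiffWithinAt_alternating_apply (A := fun _ => w) (h x₀ p hp)
      fun _ => contDiffWithinAt_const
  simp only [DForm.inChart_wedge, wedge_apply]
  exact (((hda _).mul (hdb _)).sub ((hda _).mul (hdb _))).add ((hda _).mul (hdb _))

/-- The partial derivative of a jointly smooth function on the second factor. -/
theorem fderivWithin_prodMk_right {F : Type*} [NormedAddCommGroup F] [NormedSpace ℝ F]
    {g : ℝ × E → F} {x₀ : X} {y : E} {t : ℝ} (hy : y ∈ (extChartAt I x₀).target)
    (hg : ContDiffWithinAt ℝ ∞ g (univ ×ˢ range I) (t, y)) (v : E) :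
    fderivWithin ℝ (fun z => g (t, z)) (range I) y v =
      fderivWithin ℝ g (univ ×ˢ range I) (t, y) (0, v) := by
  have h1 := (hg.differentiableWithinAt (by simp)).hasFDerivWithinAt
  have h2 : HasFDerivWithinAt (fun z : E => (t, z)) (ContinuousLinearMap.inr ℝ ℝ E) (range I) y :=
    (hasFDerivAt_prodMk_right t y).hasFDerivWithinAt
  have h3 := h1.comp y h2 (fun z hz => ⟨mem_univ _, hz⟩)
  have h4 := h3.fderivWithin (uniqueDiffWithinAt_range hy)
  exact congrArg (fun T : E →L[ℝ] F => T v) h4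

theorem IsSmoothFamily.continuousOn_extd {k : ℕ} {θ : ℝ → DForm E X k} (h : IsSmoothFamily I θ)
    (x₀ : X) (v : Fin (k + 1) → E) :
    ContinuousOn (fun p : ℝ × E => ((θ p.1).extd I).inChart I x₀ p.2 v)
      (univ ×ˢ (extChartAt I x₀).target) := by
  have h1 : ∀ p ∈ (univ : Set ℝ) ×ˢ (extChartAt I x₀).target,
      ((θ p.1).extd I).inChart I x₀ p.2 v = ∑ i : Fin (k + 1), (-1 : ℤ) ^ i.val •
        fderivWithin ℝ (fun p : ℝ × E => (θ p.1).inChart I x₀ p.2 (i.removeNth v))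
          (univ ×ˢ range I) p (0, v i) := by
    rintro ⟨t, y⟩ ⟨-, hy⟩
    have hy' : y ∈ (extChartAt I x₀).target := hy
    rw [DForm.inChart_extd (h.isSmooth t) hy', extDerivWithin_apply
      (((h.isSmooth t).contDiffWithinAt hy').differentiableWithinAt (by simp))
      (uniqueDiffWithinAt_range hy')]
    refine Finset.sum_congr rfl fun i _ => ?_
    congr 1
    exact fderivWithin_prodMk_right (g := fun p : ℝ × E => (θ p.1).inChart I x₀ p.2 (i.removeNth v))
      hy' (contDiffWithinAt_alternating_apply (A := fun _ => i.removeNth v)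
        (h.contDiffWithinAt hy' t) fun _ => contDiffWithinAt_const) (v i)
  refine ContinuousOn.congr ?_ h1
  refine continuousOn_finsetSum _ fun i _ => ?_
  suffices hs : ContinuousOn (fun p => fderivWithin ℝ (fun p : ℝ × E =>
      (θ p.1).inChart I x₀ p.2 (i.removeNth v)) (univ ×ˢ range I) p (0, v i))
      (univ ×ˢ (extChartAt I x₀).target) from
      hs.const_smul ((-1 : ℤ) ^ i.val)
  rintro ⟨t, y⟩ ⟨-, hy⟩
  have h2 : ContDiffWithinAt ℝ ∞ (fun p : ℝ × E => (θ p.1).inChart I x₀ p.2 (i.removeNth v))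
      (univ ×ˢ range I) (t, y) := contDiffWithinAt_alternating_apply (A := fun _ => i.removeNth v)
        (h.contDiffWithinAt hy t) fun _ => contDiffWithinAt_const
  have h3 := h2.fderivWithin_right (m := ∞) uniqueDiffOn_univ_prod_range (by simp)
    ⟨mem_univ _, extChartAt_target_subset_range x₀ hy⟩
  exact (h3.continuousWithinAt.mono
    (prod_mono_right (extChartAt_target_subset_range x₀))).clm_apply continuousWithinAt_const

/-- The restrictions of a form on `ℝ × X` to the slices `{t} × X`. -/
def DForm.slice {k : ℕ} (Θ : DForm (ℝ × E) (ℝ × X) k) (t : ℝ) : DForm E X k := fun x =>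
  (Θ (t, x)).compContinuousLinearMap (ContinuousLinearMap.inr ℝ ℝ E)

/-- The restrictions to the slices of the contraction of a form on `ℝ × X` with `∂/∂t`. -/
def DForm.contract {k : ℕ} (Θ : DForm (ℝ × E) (ℝ × X) (k + 1)) (t : ℝ) : DForm E X k := fun x =>
  ((Θ (t, x)).curryLeft ((1 : ℝ), (0 : E))).compContinuousLinearMap (ContinuousLinearMap.inr ℝ ℝ E)

theorem extChartAt_prod_real (x₀ : X) (t₀ : ℝ) :
    extChartAt (𝓘(ℝ, ℝ).prod I) (t₀, x₀) = (PartialEquiv.refl ℝ).prod (extChartAt I x₀) := by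
  rw [extChartAt_prod, extChartAt_model_space_eq_id]

theorem mem_target_prod {x₀ : X} {y : E} (hy : y ∈ (extChartAt I x₀).target) (t : ℝ) :
    (t, y) ∈ (extChartAt (𝓘(ℝ, ℝ).prod I) ((0 : ℝ), x₀)).target := by
  rw [extChartAt_prod_real]; exact ⟨mem_univ _, hy⟩

theorem extChartAt_prod_symm (x₀ : X) (t : ℝ) (y : E) :
    (extChartAt (𝓘(ℝ, ℝ).prod I) ((0 : ℝ), x₀)).symm (t, y) = (t, (extChartAt I x₀).symm y) := by
  rw [extChartAt_prod_real]; rfl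

theorem range_prod_real : range (𝓘(ℝ, ℝ).prod I) = univ ×ˢ range I := by
  rw [ModelWithCorners.range_prod]; simp

theorem chartInvDeriv_prod {x₀ : X} {y : E} (hy : y ∈ (extChartAt I x₀).target) (t : ℝ) :
    chartInvDeriv (𝓘(ℝ, ℝ).prod I) ((0 : ℝ), x₀) (t, y) =
      (ContinuousLinearMap.id ℝ ℝ).prodMap (chartInvDeriv I x₀ y) := by
  have h1 : MDifferentiableWithinAt 𝓘(ℝ, E) I (extChartAt I x₀).symm (range I) y :=
    (contMDiffWithinAt_chart_symm hy).mdifferentiableWithinAt (by simp)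
  have h2 := mfderivWithin_prodMap (p := ((t, y) : ℝ × E)) (s := (univ : Set ℝ))
    (f := (id : ℝ → ℝ)) (I := 𝓘(ℝ, ℝ)) (J := 𝓘(ℝ, ℝ))
    mdifferentiableWithinAt_id h1 (uniqueMDiffWithinAt_univ _)
    (uniqueDiffWithinAt_range hy).uniqueMDiffWithinAt
  have h3 : ((extChartAt (𝓘(ℝ, ℝ).prod I) ((0 : ℝ), x₀)).symm : ℝ × E → ℝ × X) =
      Prod.map id (extChartAt I x₀).symm := by
    rw [extChartAt_prod_real]; rfl
  rw [chartInvDeriv, range_prod_real, h3]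
  rw [← modelWithCornersSelf_prod, chartedSpaceSelf_prod] at h2
  refine Eq.trans h2 ?_
  · rw [mfderivWithin_univ, mfderiv_id]; rfl

theorem DForm.inChart_slice {k : ℕ} (Θ : DForm (ℝ × E) (ℝ × X) k) {x₀ : X} {y : E}
    (hy : y ∈ (extChartAt I x₀).target) (t : ℝ) (v : Fin k → E) :
    (Θ.slice t).inChart I x₀ y v =
      Θ.inChart (𝓘(ℝ, ℝ).prod I) ((0 : ℝ), x₀) (t, y) (fun i => (0, v i)) := by
  rw [DForm.inChart, DForm.inChart, chartInvDeriv_prod hy, extChartAt_prod_symm]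
  change Θ _ _ = Θ _ _
  congr 1

theorem DForm.inChart_contract {k : ℕ} (Θ : DForm (ℝ × E) (ℝ × X) (k + 1)) {x₀ : X} {y : E}
    (hy : y ∈ (extChartAt I x₀).target) (t : ℝ) (v : Fin k → E) :
    (Θ.contract t).inChart I x₀ y v =
      Θ.inChart (𝓘(ℝ, ℝ).prod I) ((0 : ℝ), x₀) (t, y)
        (Matrix.vecCons (1, 0) fun i => (0, v i)) := by
  rw [DForm.inChart, DForm.inChart, chartInvDeriv_prod hy, extChartAt_prod_symm]
  change Θ _ (Matrix.vecCons _ _) = Θ _ _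
  congr 1
  funext i
  refine Fin.cases ?_ (fun k => rfl) i
  simp

theorem DForm.IsSmooth.contDiffWithinAt_prod {k : ℕ} {Θ : DForm (ℝ × E) (ℝ × X) k}
    (hΘ : Θ.IsSmooth (𝓘(ℝ, ℝ).prod I)) {x₀ : X} {y : E} (hy : y ∈ (extChartAt I x₀).target)
    (t : ℝ) (v : Fin k → ℝ × E) :
    ContDiffWithinAt ℝ ∞ (fun p => Θ.inChart (𝓘(ℝ, ℝ).prod I) ((0 : ℝ), x₀) p v)
      (univ ×ˢ range I) (t, y) := by
  have := hΘ.contDiffWithinAt (mem_target_prod hy t)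
  rw [range_prod_real] at this
  exact contDiffWithinAt_alternating_apply (A := fun _ => v) this fun _ => contDiffWithinAt_const

theorem DForm.IsSmooth.contract [FiniteDimensional ℝ E] {k : ℕ}
    {Θ : DForm (ℝ × E) (ℝ × X) (k + 1)} (hΘ : Θ.IsSmooth (𝓘(ℝ, ℝ).prod I)) :
    IsSmoothFamily I Θ.contract := by
  rintro x₀ ⟨t, y⟩ ⟨-, hy⟩
  refine contDiffWithinAt_alternating fun v => ?_
  refine ((hΘ.contDiffWithinAt_prod hy t (Matrix.vecCons (1, 0) fun i => (0, v i))).mono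
    (prod_mono_right (extChartAt_target_subset_range x₀))).congr ?_ ?_
  · rintro ⟨t', y'⟩ ⟨-, hy'⟩
    exact DForm.inChart_contract Θ hy' t' v
  · exact DForm.inChart_contract Θ hy t v

/-- Cartan's formula for closed forms: the derivative in `t` of the restriction to `{t} × X` of a
closed form is the exterior derivative of the restriction of its contraction with `∂/∂t`. -/
theorem DForm.hasDerivAt_slice [FiniteDimensional ℝ E] {Θ : DForm (ℝ × E) (ℝ × X) 3}
    (hΘ : Θ.IsSmooth (𝓘(ℝ, ℝ).prod I)) (hd : ∀ p, Θ.extd (𝓘(ℝ, ℝ).prod I) p = 0) (t : ℝ) (x : X)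
    (v : Fin 3 → E) :
    HasDerivAt (fun t => Θ.slice t x v) ((Θ.contract t).extd I x v) t := by
  set J := 𝓘(ℝ, ℝ).prod I with hJ
  set y := extChartAt I x x with hy₀
  have hy : y ∈ (extChartAt I x).target := mem_extChartAt_target x
  set B := Θ.inChart J ((0 : ℝ), x) with hB
  have hBsm : ∀ v, ContDiffWithinAt ℝ ∞ (fun p => B p v) (univ ×ˢ range I) (t, y) :=
    fun v => hΘ.contDiffWithinAt_prod hy t v
  -- closedness in coordinates, evaluated on `∂/∂t` and three vectors of the slice
  have hBd : extDerivWithin B (univ ×ˢ range I) (t, y) = 0 := by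
    rw [← range_prod_real, ← DForm.inChart_extd hΘ (mem_target_prod hy t)]
    ext v
    rw [DForm.inChart, hd]; rfl
  have hBdiff : DifferentiableWithinAt ℝ B (univ ×ˢ range I) (t, y) := by
    have := hΘ.contDiffWithinAt (mem_target_prod hy t)
    rw [range_prod_real] at this
    exact this.differentiableWithinAt (by simp)
  have hud : UniqueDiffWithinAt ℝ ((univ : Set ℝ) ×ˢ range I) (t, y) :=
    uniqueDiffOn_univ_prod_range _ ⟨mem_univ _, extChartAt_target_subset_range x hy⟩
  let w : Fin 4 → ℝ × E := ![(1, 0), (0, v 0), (0, v 1), (0, v 2)]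
  obtain ⟨r0, r1, r2, r3⟩ := removeNth_four w
  have h1 : extDerivWithin B (univ ×ˢ range I) (t, y) w = 0 := by rw [hBd]; rfl
  rw [extDerivWithin_apply hBdiff hud, Fin.sum_univ_four, r0, r1, r2, r3] at h1
  -- the exterior derivative of the contraction
  have hcs := (hΘ.contract).isSmooth t
  have h2 : (Θ.contract t).extd I x v =
      fderivWithin ℝ (fun p => B p ![w 0, w 2, w 3]) (univ ×ˢ range I) (t, y) (w 1) -
      fderivWithin ℝ (fun p => B p ![w 0, w 1, w 3]) (univ ×ˢ range I) (t, y) (w 2) +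
      fderivWithin ℝ (fun p => B p ![w 0, w 1, w 2]) (univ ×ˢ range I) (t, y) (w 3) := by
    have hc : ∀ a b c : E, fderivWithin ℝ (fun z => (Θ.contract t).inChart I x z ![a, b])
        (range I) y c = fderivWithin ℝ (fun p => B p ![(1, 0), (0, a), (0, b)])
          (univ ×ˢ range I) (t, y) (0, c) := by
      intro a b c
      rw [← fderivWithin_prodMk_right hy (hBsm _) c]
      have hz : ∀ z ∈ (extChartAt I x).target, (Θ.contract t).inChart I x z ![a, b] =
          B (t, z) ![(1, 0), (0, a), (0, b)] := by
        intro z hz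
        rw [DForm.inChart_contract Θ hz t]
        congr 1
        funext i; fin_cases i <;> rfl
      have : (fun z => (Θ.contract t).inChart I x z ![a, b]) =ᶠ[𝓝[range I] y]
          fun z => B (t, z) ![(1, 0), (0, a), (0, b)] := by
        filter_upwards [target_mem_nhdsWithin_range hy] with z hz' using hz z hz'
      rw [this.fderivWithin_eq (hz y hy)]
    rw [DForm.extd, extDerivWithin_two_apply
      ((hcs.contDiffWithinAt hy).differentiableWithinAt (by simp)) (uniqueDiffWithinAt_range hy)]
    simp only [hc]
    rfl
  have h3 : HasDerivAt (fun τ => B (τ, y) ![w 1, w 2, w 3])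
      (fderivWithin ℝ (fun p => B p ![w 1, w 2, w 3]) (univ ×ˢ range I) (t, y) (1, 0)) t := by
    have h4 := ((hBsm ![w 1, w 2, w 3]).differentiableWithinAt (by simp)).hasFDerivWithinAt
    have h5 : HasFDerivWithinAt (fun τ : ℝ => (τ, y)) (ContinuousLinearMap.inl ℝ ℝ E) univ t :=
      (hasFDerivAt_prodMk_left t y).hasFDerivWithinAt
    have hm : MapsTo (fun τ : ℝ => (τ, y)) univ ((univ : Set ℝ) ×ˢ range I) :=
      fun τ _ => ⟨mem_univ _, extChartAt_target_subset_range x hy⟩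
    have h6 := h4.comp t h5 hm
    rw [hasFDerivWithinAt_univ] at h6
    exact h6.hasDerivAt
  have h7 : (fun τ => Θ.slice τ x v) = fun τ => B (τ, y) ![w 1, w 2, w 3] := by
    funext τ
    rw [← DForm.inChart_self (I := I) (Θ.slice τ) x, DForm.inChart_slice Θ hy τ]
    congr 1
    funext i; fin_cases i <;> rfl
  rw [h7, h2]
  convert h3 using 1
  change _ = fderivWithin ℝ (fun p => B p ![w 1, w 2, w 3]) (univ ×ˢ range I) (t, y) (w 0)
  simp at h1
  linarith

end Families

/-! ### Integrals of smooth families -/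

section Integration

open MeasureTheory

theorem four_sq_nonneg (a b c d : ℝ) : 0 ≤ a ^ 2 + b ^ 2 + c ^ 2 + d ^ 2 := by positivity

theorem four_sq_eq_zero {a b c d : ℝ} (h : a ^ 2 + b ^ 2 + c ^ 2 + d ^ 2 = 0) :
    a = 0 ∧ b = 0 ∧ c = 0 ∧ d = 0 := by
  refine ⟨?_, ?_, ?_, ?_⟩ <;> refine pow_eq_zero_iff two_ne_zero |>.1 ?_ <;>
    linarith [sq_nonneg a, sq_nonneg b, sq_nonneg c, sq_nonneg d]

theorem eq_zero_of_integral_eq_zero {Y : Type*} [TopologicalSpace Y] [CompactSpace Y]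
    [MeasurableSpace Y] [BorelSpace Y] {μ : Measure Y} [IsFiniteMeasure μ] [μ.IsOpenPosMeasure]
    {F : Y → ℝ} (hF : Continuous F) (h0 : ∀ x, 0 ≤ F x) (hint : ∫ x, F x ∂μ = 0) (x : Y) :
    F x = 0 := by
  have h1 : Integrable F μ :=
    hF.integrable_of_hasCompactSupport (HasCompactSupport.of_compactSpace F)
  have h2 := (integral_eq_zero_iff_of_nonneg h0 h1).1 hint
  exact congrFun (hF.ae_eq_iff_eq μ continuous_const |>.1 h2) x

theorem integral_intervalIntegral_eq_zero {Y : Type*} [TopologicalSpace Y] [CompactSpace Y]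
    [T2Space Y] [SecondCountableTopology Y] [MeasurableSpace Y] [BorelSpace Y] {μ : Measure Y}
    [IsFiniteMeasure μ] {F : Y → ℝ → ℝ} (hF : Continuous (uncurry F))
    (h : ∀ t, ∫ x, F x t ∂μ = 0) : ∫ x, (∫ t in (0 : ℝ)..1, F x t) ∂μ = 0 := by
  rw [← intervalIntegral_integral_swap (f := fun t x => F x t)]
  · simp [h]
  · have hF' : Continuous (uncurry fun t x => F x t) := hF.comp continuous_swap
    have hc : IntegrableOn (uncurry fun t x => F x t) (uIcc (0 : ℝ) 1 ×ˢ (univ : Set Y))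
        (volume.prod μ) :=
      hF'.continuousOn.integrableOn_compact (isCompact_uIcc.prod isCompact_univ)
    rw [IntegrableOn, ← Measure.prod_restrict, Measure.restrict_univ] at hc
    exact hc.mono_measure (Measure.prod_mono (Measure.restrict_mono uIoc_subset_uIcc le_rfl)
      le_rfl)

theorem continuous_formRatio_family {n : ℕ} {N : Type*} [TopologicalSpace N]
    [ChartedSpace (EuclideanHalfSpace (n + 1)) N] [IsManifold (𝓡∂ (n + 1)) ∞ N]
    {Ω : DForm (Euc (n + 1)) N (n + 1)} (hΩ : Ω.IsSmooth (𝓡∂ (n + 1))) (hΩ0 : ∀ x, Ω x ≠ 0)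
    {θ : ℝ → DForm (Euc (n + 1)) N n} (hθ : IsSmoothFamily (𝓡∂ (n + 1)) θ) :
    Continuous (fun p : N × ℝ => formRatio ((θ p.2).extd (𝓡∂ (n + 1))) Ω p.1) := by
  rw [continuous_iff_continuousAt]
  rintro ⟨x, t⟩
  set I := 𝓡∂ (n + 1) with hI
  let G : ℝ × Euc (n + 1) → ℝ := fun p =>
    chartDensity ((θ p.1).extd I) x p.2 / chartDensity Ω x p.2
  have hG : ContinuousOn G (univ ×ˢ (extChartAt I x).target) := by
    have ha : ContinuousOn (fun p : ℝ × Euc (n + 1) => chartDensity ((θ p.1).extd I) x p.2)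
        (univ ×ˢ (extChartAt I x).target) :=
      hθ.continuousOn_extd x fun i => EuclideanSpace.single i 1
    have hb : ContinuousOn (fun p : ℝ × Euc (n + 1) => chartDensity Ω x p.2)
        (univ ×ˢ (extChartAt I x).target) :=
      (continuousOn_chartDensity hΩ x).comp continuousOn_snd fun p hp => hp.2
    exact ha.div hb fun p hp => chartDensity_ne_zero hΩ0 hp.2
  have h1 : ContinuousOn (fun p : N × ℝ => G (p.2, extChartAt I x p.1))
      ((extChartAt I x).source ×ˢ univ) := by
    have hm : ContinuousOn (fun p : N × ℝ => ((p.2, extChartAt I x p.1) : ℝ × Euc (n + 1)))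
        ((extChartAt I x).source ×ˢ univ) :=
      continuousOn_snd.prodMk
        ((continuousOn_extChartAt x).comp continuousOn_fst fun p hp => hp.1)
    exact hG.comp hm fun p hp => ⟨mem_univ _, (extChartAt I x).map_source hp.1⟩
  have hnhds : (extChartAt I x).source ×ˢ (univ : Set ℝ) ∈ 𝓝 (x, t) :=
    prod_mem_nhds (extChartAt_source_mem_nhds x) Filter.univ_mem
  have hev : (fun p : N × ℝ => G (p.2, extChartAt I x p.1)) =ᶠ[𝓝 (x, t)]
      fun p => formRatio ((θ p.2).extd I) Ω p.1 := by
    filter_upwards [hnhds] with p hp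
    have hy := (extChartAt I x).map_source hp.1
    have hne := chartDensity_ne_zero hΩ0 hy
    simp only [G]
    rw [chartDensity_eq_mul (eq_formRatio_smul ((θ p.2).extd I) (hΩ0 _)),
      (extChartAt I x).left_inv hp.1]
    field_simp
  exact (h1.continuousAt hnhds).congr hev

end Integration

/-! ### Vanishing of closed and coclosed forms -/

section CoclosedForms

open MeasureTheory

variable {M : Type*} [TopologicalSpace M] [ChartedSpace (Euc 7) M] [IsManifold (𝓡 7) ∞ M]
  {N : Type*} [TopologicalSpace N] [ChartedSpace (EuclideanHalfSpace 4) N]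
  [IsManifold (𝓡∂ 4) ∞ N] {P : AlmostG2 M} {ι : N → M}

theorem IsCoassociative.formRatio_vol (hι : IsCoassociative P ι) (θ : DForm (Euc 4) N 4) (x : N) :
    formRatio θ (vol P ι) x = vol P ι x (frame P ι x) * θ x (frame P ι x) := by
  have h1 := eq_formRatio_smul θ (hι.vol_ne_zero x)
  have h2 := hι.vol_sq (hι.frame_spec x)
  rw [h1, ContinuousAlternatingMap.smul_apply, smul_eq_mul]
  linear_combination (-formRatio θ (vol P ι) x) * h2

theorem star2_neg_apply (β : DForm (Euc 4) N 2) (x : N) :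
    star2 P ι (fun x => -β x) x = -star2 P ι β x := by
  simp [star2]

/-- Since `*` is an involution on 2-forms, `d^*_+ η` is minus the self-dual part of `d * η`. -/
theorem IsCoassociative.codiffPlus_eq (hι : IsCoassociative P ι) (η : DForm (Euc 4) N 3) (x : N) :
    codiffPlus P ι η x = -(1 / 2 : ℝ) • (star2 P ι ((star3 P ι η).extd (𝓡∂ 4)) x +
      (star3 P ι η).extd (𝓡∂ 4) x) := by
  have h1 : star2 P ι (codiff P ι η) x = -(star3 P ι η).extd (𝓡∂ 4) x := by
    have : codiff P ι η = fun x => -star2 P ι ((star3 P ι η).extd (𝓡∂ 4)) x := rfl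
    rw [this, star2_neg_apply, hι.star2_star2]
  rw [codiffPlus, h1, codiff]
  module

theorem alternating_zero_apply {E : Type*} [NormedAddCommGroup E] [NormedSpace ℝ E] {k : ℕ}
    (v : Fin k → E) : (0 : E [⋀^Fin k]→L[ℝ] ℝ) v = 0 := rfl

theorem wedge_eq_zero {E : Type*} [NormedAddCommGroup E] [NormedSpace ℝ E]
    {a : E [⋀^Fin 1]→L[ℝ] ℝ} {v : Fin 3 → E} (h : ∀ i, a ![v i] = 0) (b : E [⋀^Fin 2]→L[ℝ] ℝ) :
    wedge a b v = 0 := by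
  rw [wedge_apply, h, h, h]; ring

theorem extd_wedge_of_closed {a : DForm (Euc 4) N 1} (ha : a.IsSmooth (𝓡∂ 4)) {x : N}
    (hd : a.extd (𝓡∂ 4) x = 0) {b : DForm (Euc 4) N 2} (hb : b.IsSmooth (𝓡∂ 4))
    (v : Fin 4 → Euc 4) : (a.wedge b).extd (𝓡∂ 4) x v =
      -(a x ![v 0] * b.extd (𝓡∂ 4) x ![v 1, v 2, v 3] -
        a x ![v 1] * b.extd (𝓡∂ 4) x ![v 0, v 2, v 3] +
        a x ![v 2] * b.extd (𝓡∂ 4) x ![v 0, v 1, v 3] -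
        a x ![v 3] * b.extd (𝓡∂ 4) x ![v 0, v 1, v 2]) := by
  rw [DForm.extd_wedge ha hb]
  simp only [hd, alternating_zero_apply, zero_mul, sub_zero, add_zero, zero_sub]

/-- For closed `ξ` the form `d(ξ ∧ τ_t) = -ξ ∧ dτ_t` is the derivative in `t` of `-ξ ∧ σ_t`; its
integral over `t` is therefore `-ξ ∧ η`. -/
theorem IsCoassociative.integral_formRatio_wedge (hι : IsCoassociative P ι)
    {ξ : DForm (Euc 4) N 1} (hξ : ξ.IsSmooth (𝓡∂ 4)) {x : N} (hcl : ξ.extd (𝓡∂ 4) x = 0)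
    {τ : ℝ → DForm (Euc 4) N 2} (hτ : IsSmoothFamily (𝓡∂ 4) τ)
    (hF : Continuous fun t => formRatio ((ξ.wedge (τ t)).extd (𝓡∂ 4)) (vol P ι) x)
    {σ : ℝ → DForm (Euc 4) N 3} {η : DForm (Euc 4) N 3}
    (hσ : ∀ t v, HasDerivAt (fun t => σ t x v) ((τ t).extd (𝓡∂ 4) x v) t)
    (hσ0 : σ 0 x = 0) (hσ1 : σ 1 x = η x) :
    ∫ t in (0 : ℝ)..1, formRatio ((ξ.wedge (τ t)).extd (𝓡∂ 4)) (vol P ι) x =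
      vol P ι x (frame P ι x) *
        -(ξ x ![frame P ι x 0] * η x ![frame P ι x 1, frame P ι x 2, frame P ι x 3] -
        ξ x ![frame P ι x 1] * η x ![frame P ι x 0, frame P ι x 2, frame P ι x 3] +
        ξ x ![frame P ι x 2] * η x ![frame P ι x 0, frame P ι x 1, frame P ι x 3] -
        ξ x ![frame P ι x 3] * η x ![frame P ι x 0, frame P ι x 1, frame P ι x 2]) := by
  generalize hf : frame P ι x = f
  let g : ℝ → ℝ := fun t => vol P ι x f * -(ξ x ![f 0] * σ t x ![f 1, f 2, f 3] -
      ξ x ![f 1] * σ t x ![f 0, f 2, f 3] + ξ x ![f 2] * σ t x ![f 0, f 1, f 3] -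
      ξ x ![f 3] * σ t x ![f 0, f 1, f 2])
  have hder : ∀ t, HasDerivAt g (formRatio ((ξ.wedge (τ t)).extd (𝓡∂ 4)) (vol P ι) x) t := by
    intro t
    rw [hι.formRatio_vol, hf, extd_wedge_of_closed hξ hcl (hτ.isSmooth t)]
    exact ((((((hσ t ![f 1, f 2, f 3]).const_mul (ξ x ![f 0])).sub
      ((hσ t ![f 0, f 2, f 3]).const_mul (ξ x ![f 1]))).add
      ((hσ t ![f 0, f 1, f 3]).const_mul (ξ x ![f 2]))).sub
      ((hσ t ![f 0, f 1, f 2]).const_mul (ξ x ![f 3]))).neg).const_mul _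
  have h4 := intervalIntegral.integral_eq_sub_of_hasDerivAt (fun t _ => hder t)
    (hF.intervalIntegrable 0 1)
  have h5 : g 0 = 0 := by
    simp only [g, hσ0, alternating_zero_apply, mul_zero, sub_zero, add_zero, neg_zero]
  rw [h4, h5, sub_zero]
  simp only [g, hσ1]

variable [T2Space N] [CompactSpace N]

/-- If `ξ` vanishes on the boundary and `dξ` is anti-self-dual then `ξ` is closed, since
`d(ξ ∧ dξ) = dξ ∧ dξ = -|dξ|² vol`. -/
theorem IsCoassociative.extd_eq_zero_of_antiSelfDual (hι : IsCoassociative P ι)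
    {ξ : DForm (Euc 4) N 1} (hξ : ξ.IsSmooth (𝓡∂ 4))
    (hbd : ∀ x ∈ (𝓡∂ 4).boundary N, ∀ v : Euc 4, v 0 = 0 → ξ x ![v] = 0)
    (hasd : ∀ x, star2 P ι (ξ.extd (𝓡∂ 4)) x = -ξ.extd (𝓡∂ 4) x) (x : N) :
    ξ.extd (𝓡∂ 4) x = 0 := by
  borelize N
  obtain ⟨μ, hfin, hpos, hstokes⟩ := exists_stokes_measure hι.isSmooth_vol hι.vol_ne_zero
  set χ := ξ.extd (𝓡∂ 4) with hχ
  have hχs : χ.IsSmooth (𝓡∂ 4) := hξ.extd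
  have hw := hξ.wedge hχs
  have h1 := hstokes (ξ.wedge χ) hw fun x hx v hv => wedge_eq_zero (fun i => hbd x hx _ (hv i)) _
  have hQ : ∀ x, formRatio ((ξ.wedge χ).extd (𝓡∂ 4)) (vol P ι) x =
      -(2 * (χ x ![frame P ι x 0, frame P ι x 1] ^ 2 + χ x ![frame P ι x 0, frame P ι x 2] ^ 2 +
        χ x ![frame P ι x 0, frame P ι x 3] ^ 2)) := by
    intro x
    have hs := hι.vol_sq (hι.frame_spec x)
    obtain ⟨s, hs'⟩ : ∃ s, vol P ι x (frame P ι x) = s := ⟨_, rfl⟩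
    obtain ⟨a1, a2, a3, a4, a5, a6⟩ := star2_frame χ x rfl hs'
    rw [hasd] at a1 a2 a3 a4 a5 a6
    simp only [ContinuousAlternatingMap.neg_apply] at a1 a2 a3 a4 a5 a6
    rw [hι.formRatio_vol, DForm.extd_wedge hξ hχs, hs']
    have hd : χ.extd (𝓡∂ 4) x = 0 := DForm.extd_extd hξ x
    rw [hs'] at hs
    simp only [← hχ, hd, alternating_zero_apply]
    set p := χ x ![frame P ι x 0, frame P ι x 1]
    set q := χ x ![frame P ι x 0, frame P ι x 2]
    set r := χ x ![frame P ι x 0, frame P ι x 3]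
    linear_combination (-2 * p) * a1 + (-2 * q) * (a2) + (-2 * r) * a3
  have hcont : Continuous (fun x => -formRatio ((ξ.wedge χ).extd (𝓡∂ 4)) (vol P ι) x) :=
    (continuous_formRatio hw.extd hι.isSmooth_vol hι.vol_ne_zero).neg
  have h2 := eq_zero_of_integral_eq_zero (μ := μ) hcont
    (fun x => by rw [hQ, neg_neg]; positivity) (by rw [integral_neg, h1, neg_zero]) x
  rw [hQ, neg_neg] at h2
  have hf := hι.frame_spec x
  have hs := hι.vol_sq hf
  obtain ⟨s, hs'⟩ : ∃ s, vol P ι x (frame P ι x) = s := ⟨_, rfl⟩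
  obtain ⟨a1, a2, a3, a4, a5, a6⟩ := star2_frame χ x rfl hs'
  rw [hasd] at a1 a2 a3 a4 a5 a6
  simp only [ContinuousAlternatingMap.neg_apply] at a1 a2 a3 a4 a5 a6
  set p := χ x ![frame P ι x 0, frame P ι x 1] with hp
  set q := χ x ![frame P ι x 0, frame P ι x 2] with hq
  set r := χ x ![frame P ι x 0, frame P ι x 3] with hr
  obtain ⟨hp0, hq0, hr0, -⟩ := four_sq_eq_zero (a := p) (b := q) (c := r) (d := 0) (by linarith)
  rw [hp0, mul_zero] at a6
  rw [hq0, mul_zero] at a5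
  rw [hr0, mul_zero] at a4
  apply two_form_ext hf.linearIndependent <;>
    simp only [alternating_zero_apply] <;> linarith

/-- A 3-form `η` joined to zero by a family with exact derivative vanishes if `*η` is closed and
vanishes on the boundary: the forms `*η ∧ dτ_t = -d(*η ∧ τ_t)` have integral zero, hence so does
`*η ∧ η = -|η|² vol`. -/
theorem IsCoassociative.eq_zero_of_closed_star (hι : IsCoassociative P ι)
    {η : DForm (Euc 4) N 3} (hη : η.IsSmooth (𝓡∂ 4))
    (hbd : ∀ x ∈ (𝓡∂ 4).boundary N, ∀ v : Euc 4, v 0 = 0 → star3 P ι η x ![v] = 0)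
    (hcl : ∀ x, (star3 P ι η).extd (𝓡∂ 4) x = 0)
    {τ : ℝ → DForm (Euc 4) N 2} (hτ : IsSmoothFamily (𝓡∂ 4) τ) {σ : ℝ → DForm (Euc 4) N 3}
    (hσ : ∀ t x v, HasDerivAt (fun t => σ t x v) ((τ t).extd (𝓡∂ 4) x v) t)
    (hσ0 : ∀ x, σ 0 x = 0) (hσ1 : ∀ x, σ 1 x = η x) (x : N) : η x = 0 := by
  borelize N
  have : SecondCountableTopology (EuclideanHalfSpace 4) :=
    TopologicalSpace.Subtype.secondCountableTopology {x : Euc 4 | 0 ≤ x 0}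
  have : SecondCountableTopology N :=
    ChartedSpace.secondCountable_of_sigmaCompact (EuclideanHalfSpace 4) N
  obtain ⟨μ, hfin, hpos, hstokes⟩ := exists_stokes_measure hι.isSmooth_vol hι.vol_ne_zero
  have hξ := hι.isSmooth_star3 hη
  have hframe := fun x f hf s hs => star3_frame (P := P) (ι := ι) η x (f := f) hf (s := s) hs
  generalize star3 P ι η = ξ at hξ hframe hbd hcl
  have hθ := hτ.wedge hξ
  let F : N → ℝ → ℝ := fun x t => formRatio ((ξ.wedge (τ t)).extd (𝓡∂ 4)) (vol P ι) x
  have hF : Continuous (uncurry F) :=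
    continuous_formRatio_family (n := 3) (θ := fun t => ξ.wedge (τ t)) hι.isSmooth_vol
      hι.vol_ne_zero hθ
  have h1 : ∀ t, ∫ x, F x t ∂μ = 0 := fun t => hstokes (ξ.wedge (τ t)) (hθ.isSmooth t)
    fun x hx v hv => wedge_eq_zero (fun i => hbd x hx _ (hv i)) _
  have hQc : Continuous (fun x => ∫ t in (0 : ℝ)..1, F x t) :=
    intervalIntegral.continuous_parametric_intervalIntegral_of_continuous' hF 0 1
  have hswap := integral_intervalIntegral_eq_zero hF h1
  have hQ : ∀ x, ∫ t in (0 : ℝ)..1, F x t =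
      η x ![frame P ι x 1, frame P ι x 2, frame P ι x 3] ^ 2 +
      η x ![frame P ι x 0, frame P ι x 2, frame P ι x 3] ^ 2 +
      η x ![frame P ι x 0, frame P ι x 1, frame P ι x 3] ^ 2 +
      η x ![frame P ι x 0, frame P ι x 1, frame P ι x 2] ^ 2 := by
    intro x
    have hs := hι.vol_sq (hι.frame_spec x)
    obtain ⟨f, hf⟩ : ∃ f, f = frame P ι x := ⟨_, rfl⟩
    obtain ⟨s, hs'⟩ : ∃ s, vol P ι x f = s := ⟨_, rfl⟩
    obtain ⟨a1, a2, a3, a4⟩ := hframe x f hf s hs'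
    rw [← hf, hs'] at hs
    have hFx : Continuous (F x) := hF.uncurry_left x
    rw [hι.integral_formRatio_wedge hξ (hcl x) hτ hFx (hσ · x) (hσ0 x) (hσ1 x), ← hf, hs', a1, a2,
      a3, a4]
    generalize η x ![f 1, f 2, f 3] = b0
    generalize η x ![f 0, f 2, f 3] = b1
    generalize η x ![f 0, f 1, f 3] = b2
    generalize η x ![f 0, f 1, f 2] = b3
    linear_combination (b0 ^ 2 + b1 ^ 2 + b2 ^ 2 + b3 ^ 2) * hs
  clear_value F
  have h2 := eq_zero_of_integral_eq_zero (μ := μ) hQc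
    (fun x => by rw [hQ]; exact four_sq_nonneg _ _ _ _) hswap x
  rw [hQ] at h2
  obtain ⟨h3, h4, h5, h6⟩ := four_sq_eq_zero h2
  exact three_form_ext (hι.frame_spec x).linearIndependent h3 h4 h5 h6

end CoclosedForms

/-! ### Geodesics and the zero section -/

section Geodesics

variable {M : Type*} [TopologicalSpace M] [ChartedSpace (Euc 7) M] [IsManifold (𝓡 7) ∞ M]
  {h : Metric M} {γ : ℝ → M} {J : Set ℝ}

theorem contDiffAt_chart_comp (hJ : IsOpen J) (hγ : ContMDiffOn 𝓘(ℝ, ℝ) (𝓡 7) ∞ γ J) {q : M}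
    {τ : ℝ} (hτ : τ ∈ J) (hq : γ τ ∈ (extChartAt (𝓡 7) q).source) :
    ContDiffAt ℝ ∞ (fun τ => extChartAt (𝓡 7) q (γ τ)) τ := by
  have h1 : ContMDiffAt 𝓘(ℝ, ℝ) (𝓡 7) ∞ γ τ := hγ.contMDiffAt (hJ.mem_nhds hτ)
  have h2 : ContMDiffAt (𝓡 7) 𝓘(ℝ, Euc 7) ∞ (extChartAt (𝓡 7) q) (γ τ) :=
    contMDiffAt_extChartAt' (by simpa using hq)
  exact (h2.comp τ h1).contDiffAt

theorem tmap_eq_chartInvDeriv_deriv (hJ : IsOpen J) (hγ : ContMDiffOn 𝓘(ℝ, ℝ) (𝓡 7) ∞ γ J) {q : M}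
    {τ : ℝ} (hτ : τ ∈ J) (hq : γ τ ∈ (extChartAt (𝓡 7) q).source) :
    tmap 𝓘(ℝ, ℝ) (𝓡 7) γ τ 1 = chartInvDeriv (𝓡 7) q (extChartAt (𝓡 7) q (γ τ))
      (deriv (fun τ => extChartAt (𝓡 7) q (γ τ)) τ) := by
  have h1 : ContMDiffAt 𝓘(ℝ, ℝ) (𝓡 7) ∞ γ τ := hγ.contMDiffAt (hJ.mem_nhds hτ)
  have h2 := tmap_comp_chartInvDeriv (I := 𝓘(ℝ, ℝ)) (I' := 𝓡 7) (f := γ) (x₀ := τ) (q := q)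
    (y := extChartAt 𝓘(ℝ, ℝ) τ τ) h1 (mem_extChartAt_target τ) hq
  rw [chartInvDeriv_self] at h2
  have h3 := congrArg (fun T : ℝ →L[ℝ] Euc 7 => T 1) h2
  refine Eq.trans h3 ?_
  change chartInvDeriv (𝓡 7) q _ (fderivWithin ℝ (fun τ => extChartAt (𝓡 7) q (γ τ)) (range id) τ 1)
    = _
  rw [range_id, fderivWithin_univ, fderiv_apply_one_eq_deriv]
  rfl

/-- The energy density of a curve. -/
def energy (h : Metric M) (γ : ℝ → M) (τ : ℝ) : ℝ :=
  h.ip (γ τ) (tmap 𝓘(ℝ, ℝ) (𝓡 7) γ τ 1) (tmap 𝓘(ℝ, ℝ) (𝓡 7) γ τ 1)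

theorem energy_eq_chartForm (h : Metric M) (hJ : IsOpen J)
    (hγ : ContMDiffOn 𝓘(ℝ, ℝ) (𝓡 7) ∞ γ J) {q : M}
    {τ : ℝ} (hτ : τ ∈ J) (hq : γ τ ∈ (extChartAt (𝓡 7) q).source) :
    energy h γ τ = h.chartForm q (extChartAt (𝓡 7) q (γ τ))
      (deriv (fun τ => extChartAt (𝓡 7) q (γ τ)) τ)
      (deriv (fun τ => extChartAt (𝓡 7) q (γ τ)) τ) := by
  rw [energy, tmap_eq_chartInvDeriv_deriv hJ hγ hτ hq, Metric.chartForm_apply, Metric.inChart,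
    (extChartAt (𝓡 7) q).left_inv hq]

theorem eventually_mem_chart (hJ : IsOpen J) (hγ : ContMDiffOn 𝓘(ℝ, ℝ) (𝓡 7) ∞ γ J) {t : ℝ}
    (ht : t ∈ J) : ∀ᶠ τ in 𝓝 t, τ ∈ J ∧ γ τ ∈ (extChartAt (𝓡 7) (γ t)).source :=
  Filter.Eventually.and (hJ.mem_nhds ht)
    ((hγ.contMDiffAt (hJ.mem_nhds ht)).continuousAt (extChartAt_source_mem_nhds (γ t)))

/-- Conservation of energy, in coordinates: insert the velocity into the Euler-Lagrange equation. -/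
theorem hasDerivAt_energy_of_eulerLagrange {E : Type*} [NormedAddCommGroup E] [NormedSpace ℝ E]
    {B : E → E → E → ℝ} {c : ℝ → E} {t : ℝ} {b : E} (h1 : HasDerivAt c (deriv c t) t)
    (h2 : HasDerivAt (deriv c) b t)
    (hB : DifferentiableAt ℝ (fun z : E × E × E => B z.1 z.2.1 z.2.2) (c t, deriv c t, deriv c t))
    (hsymm : ∀ y u v, B y u v = B y v u)
    (hEL : HasDerivAt (fun τ => B (c τ) (deriv c τ) (deriv c t))
      (1 / 2 * fderiv ℝ (fun y => B y (deriv c t) (deriv c t)) (c t) (deriv c t)) t) :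
    HasDerivAt (fun τ => B (c τ) (deriv c τ) (deriv c τ)) 0 t := by
  set a := deriv c t with ha
  obtain ⟨D, hD⟩ := hB
  have h3 := hasDerivAt_const t a
  have h4 : HasDerivAt (fun τ => B (c τ) (deriv c τ) a) (D (a, b, 0)) t :=
    HasFDerivAt.comp_hasDerivAt (l := fun z : E × E × E => B z.1 z.2.1 z.2.2) t hD
      (h1.prodMk (h2.prodMk h3))
  have h5 : HasDerivAt (fun τ => B (c τ) a (deriv c τ)) (D (a, 0, b)) t :=
    HasFDerivAt.comp_hasDerivAt (l := fun z : E × E × E => B z.1 z.2.1 z.2.2) t hD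
      (h1.prodMk (h3.prodMk h2))
  have h6 : HasDerivAt (fun τ => B (c τ) (deriv c τ) (deriv c τ)) (D (a, b, b)) t :=
    HasFDerivAt.comp_hasDerivAt (l := fun z : E × E × E => B z.1 z.2.1 z.2.2) t hD
      (h1.prodMk (h2.prodMk h2))
  have h7 : fderiv ℝ (fun y => B y a a) (c t) a = D (a, 0, 0) := by
    have h8 : HasFDerivAt (fun y => B y a a) (D.comp (ContinuousLinearMap.inl ℝ E (E × E))) (c t) :=
      HasFDerivAt.comp (g := fun z : E × E × E => B z.1 z.2.1 z.2.2) (f := fun y => (y, a, a))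
        (c t) hD (hasFDerivAt_prodMk_left (𝕜 := ℝ) (c t) (a, a))
    rw [h8.fderiv]
    rfl
  have h8 : D (a, 0, b) = D (a, b, 0) := by
    refine h5.unique ?_
    simpa only [fun τ => hsymm (c τ) a (deriv c τ)] using h4
  have h9 := h4.unique hEL
  rw [h7] at h9
  have h10 : D (a, b, b) = D (a, b, 0) + D (a, 0, b) - D (a, 0, 0) := by
    rw [← map_add, ← map_sub]
    simp
  have h11 : D (a, b, b) = 0 := by rw [h10, h8, h9]; ring
  rwa [h11] at h6

/-- Conservation of energy. -/
theorem IsGeodesicOn.hasDerivAt_energy (hJ : IsOpen J) (hγ : IsGeodesicOn h γ J) {t : ℝ}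
    (ht : t ∈ J) : HasDerivAt (energy h γ) 0 t := by
  set q := γ t with hq
  set c : ℝ → Euc 7 := fun τ => extChartAt (𝓡 7) q (γ τ) with hc
  have hqs : γ t ∈ (extChartAt (𝓡 7) q).source := mem_extChartAt_source q
  have hcs : ContDiffAt ℝ ∞ c t := contDiffAt_chart_comp hJ hγ.smooth ht hqs
  have hct : c t ∈ (extChartAt (𝓡 7) q).target := (extChartAt (𝓡 7) q).map_source hqs
  have h1 : HasDerivAt c (deriv c t) t := (hcs.differentiableAt (by simp)).hasDerivAt
  have h2 : HasDerivAt (deriv c) (deriv (deriv c) t) t := by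
    have h3 : ContDiffAt ℝ ∞ (fun τ => fderiv ℝ c τ 1) t :=
      (hcs.fderiv_right (m := ∞) (by simp)).clm_apply contDiffAt_const
    simp only [fderiv_apply_one_eq_deriv] at h3
    exact (h3.differentiableAt (by simp)).hasDerivAt
  have hB : DifferentiableAt ℝ (fun z : Euc 7 × Euc 7 × Euc 7 => h.chartForm q z.1 z.2.1 z.2.2)
      (c t, deriv c t, deriv c t) := by
    have h3 : ContDiffAt ℝ ∞ (fun z : Euc 7 × Euc 7 × Euc 7 => h.chartForm q z.1)
        (c t, deriv c t, deriv c t) :=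
      ContDiffAt.comp (g := h.chartForm q) (c t, deriv c t, deriv c t)
        (contDiffAt_chartForm h hct) contDiffAt_fst
    exact ((h3.clm_apply (contDiffAt_fst.comp _ contDiffAt_snd)).clm_apply
      (contDiffAt_snd.comp _ contDiffAt_snd)).differentiableAt (by simp)
  have h6 := hasDerivAt_energy_of_eulerLagrange h1 h2
    (B := fun y u v => h.chartForm q y u v) hB (fun y u v => h.symm _ _ _)
    (hγ.eulerLagrange t ht (deriv c t))
  refine h6.congr_of_eventuallyEq ?_
  filter_upwards [eventually_mem_chart hJ hγ.smooth ht] with τ hτ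
  exact energy_eq_chartForm h hJ hγ.smooth hτ.1 hτ.2

/-- A geodesic with vanishing initial velocity is constant. -/
theorem IsGeodesicOn.eq_of_velocity_eq_zero {a b : ℝ} (hγ : IsGeodesicOn h γ (Ioo a b)) {s t : ℝ}
    (hs : s ∈ Ioo a b) (ht : t ∈ Ioo a b) (h0 : tmap 𝓘(ℝ, ℝ) (𝓡 7) γ s 1 = 0) : γ t = γ s := by
  have hE : ∀ τ ∈ Ioo a b, energy h γ τ = 0 := by
    intro τ hτ
    have h1 := (convex_Ioo a b).is_const_of_fderivWithin_eq_zero (𝕜 := ℝ) (f := energy h γ)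
      (fun x hx => (hγ.hasDerivAt_energy isOpen_Ioo hx).differentiableAt.differentiableWithinAt)
      (fun x hx => by
        rw [fderivWithin_of_isOpen isOpen_Ioo hx]
        ext
        simpa using (hγ.hasDerivAt_energy isOpen_Ioo hx).deriv) hτ hs
    rw [h1, energy, h0, ← zero_smul ℝ (0 : Euc 7), Metric.ip_smul_left, zero_mul]
  have hv : ∀ τ ∈ Ioo a b, tmap 𝓘(ℝ, ℝ) (𝓡 7) γ τ 1 = 0 := fun τ hτ =>
    h.ip_eq_zero (hE τ hτ)
  have : PreconnectedSpace (Ioo a b) := Subtype.preconnectedSpace isPreconnected_Ioo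
  have hloc : IsLocallyConstant (fun τ : Ioo a b => γ τ) := by
    rw [IsLocallyConstant.iff_eventually_eq]
    rintro ⟨t₀, ht₀⟩
    have hev := eventually_mem_chart isOpen_Ioo hγ.smooth ht₀
    obtain ⟨ε, hε, hball⟩ := Metric.eventually_nhds_iff_ball.1 hev
    have hd : ∀ τ ∈ Metric.ball t₀ ε, HasDerivAt (fun τ => extChartAt (𝓡 7) (γ t₀) (γ τ)) 0 τ := by
      intro τ hτ
      have h1 := contDiffAt_chart_comp isOpen_Ioo hγ.smooth (hball τ hτ).1 (hball τ hτ).2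
      have h2 := tmap_eq_chartInvDeriv_deriv isOpen_Ioo hγ.smooth (hball τ hτ).1 (hball τ hτ).2
      rw [hv τ (hball τ hτ).1] at h2
      have h3 := (bijective_chartInvDeriv (I := 𝓡 7)
        ((extChartAt (𝓡 7) (γ t₀)).map_source (hball τ hτ).2)).1 (h2.symm.trans (map_zero _).symm)
      rw [← h3]
      exact (h1.differentiableAt (by simp)).hasDerivAt
    have hev2 : ∀ᶠ τ in 𝓝 t₀, γ τ = γ t₀ := by
      filter_upwards [Metric.ball_mem_nhds t₀ hε] with τ hτ
      have h1 := (convex_ball t₀ ε).is_const_of_fderivWithin_eq_zero (𝕜 := ℝ)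
        (f := fun τ => extChartAt (𝓡 7) (γ t₀) (γ τ))
        (fun x hx => (hd x hx).differentiableAt.differentiableWithinAt)
        (fun x hx => by
          rw [fderivWithin_of_isOpen Metric.isOpen_ball hx]
          ext1
          simpa using (hd x hx).deriv) hτ (Metric.mem_ball_self hε)
      exact (extChartAt (𝓡 7) (γ t₀)).injOn (hball τ hτ).2 (mem_extChartAt_source _) h1
    exact (continuous_subtype_val.continuousAt (x := (⟨t₀, ht₀⟩ : Ioo a b))).eventually hev2
  exact hloc.apply_eq_of_preconnectedSpace ⟨t, ht⟩ ⟨s, hs⟩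

/-- The exponential map is the identity on the zero section: whichever geodesic was chosen, energy
conservation makes it constant. -/
theorem expMap_zero {p : M} (hp : (⟨p, 0⟩ : TangentBundle (𝓡 7) M) ∈ expDomain h) :
    expMap h (⟨p, 0⟩ : TangentBundle (𝓡 7) M) = p := by
  have hp' : ∃ y, IsExp h (⟨p, 0⟩ : TangentBundle (𝓡 7) M) y := hp
  rw [expMap, dif_pos hp']
  obtain ⟨ε, hε, γ, hγ, h0, hv, h1⟩ := hp'.choose_spec
  rw [← h1]
  have h2 := hγ.eq_of_velocity_eq_zero (s := 0) (t := 1) ⟨by linarith, by linarith⟩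
    ⟨by linarith, by linarith⟩ hv
  exact h2.trans h0

end Geodesics

/-! ### The homotopy from a submanifold to its deformation -/

section Homotopy

section Slices

variable {E : Type*} [NormedAddCommGroup E] [NormedSpace ℝ E]
  {H : Type*} [TopologicalSpace H] {I : ModelWithCorners ℝ E H}
  {X : Type*} [TopologicalSpace X] [ChartedSpace H X] [IsManifold I ∞ X]
  {E' : Type*} [NormedAddCommGroup E'] [NormedSpace ℝ E']
  {H' : Type*} [TopologicalSpace H'] {I' : ModelWithCorners ℝ E' H'}
  {X' : Type*} [TopologicalSpace X'] [ChartedSpace H' X'] [IsManifold I' ∞ X'] [IsManifold I' 1 X']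

theorem DForm.slice_pull {k : ℕ} (θ : DForm E' X' k) {f : ℝ × X → X'}
    (hf : ContMDiff (𝓘(ℝ, ℝ).prod I) I' ∞ f) (t : ℝ) :
    (θ.pull (𝓘(ℝ, ℝ).prod I) I' f).slice t = θ.pull I I' (fun x => f (t, x)) := by
  funext x
  have h1 : tmap I I' (fun x => f (t, x)) x =
      (tmap (𝓘(ℝ, ℝ).prod I) I' f (t, x)).comp (ContinuousLinearMap.inr ℝ ℝ E) := by
    have h2 := mfderiv_comp (I := I) (I' := 𝓘(ℝ, ℝ).prod I) (I'' := I') (g := f)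
      (f := fun x : X => (t, x)) x ((hf _).mdifferentiableAt (by simp))
      (mdifferentiableAt_const.prodMk mdifferentiableAt_id)
    rw [mfderiv_prod_right] at h2
    exact h2
  ext v
  simp only [DForm.pull, h1]
  rfl

theorem coordVec_smul (q x : X') (r : ℝ) (u : E') :
    coordVec I' q (⟨x, r • u⟩ : TangentBundle I' X') =
      r • coordVec I' q (⟨x, u⟩ : TangentBundle I' X') :=
  (tmap I' 𝓘(ℝ, E') (extChartAt I' q) x).map_smul r u

/-- Scaling a vector field along a map by a function of time. -/
theorem contMDiff_smul_field {v : X → TangentBundle I' X'} (hv : ContMDiff I I'.tangent ∞ v)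
    {s : ℝ → ℝ} (hs : ContDiff ℝ ∞ s) :
    ContMDiff (𝓘(ℝ, ℝ).prod I) I'.tangent ∞
      (fun p : ℝ × X => (⟨(v p.2).proj, s p.1 • (v p.2).snd⟩ : TangentBundle I' X')) := by
  rintro ⟨t, x⟩
  have hq : (v x).proj ∈ (extChartAt I' (v x).proj).source := mem_extChartAt_source _
  obtain ⟨h1, h2⟩ := (contMDiffWithinAt_tangentBundle_iff (I := I) (f := v) (s := univ) hq).1 (hv x)
  refine (contMDiffWithinAt_tangentBundle_iff (X := ℝ × X) (x := (t, x)) (s := univ)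
    (q := (v x).proj) hq).2 ⟨?_, ?_⟩
  · exact ContMDiffAt.comp (g := fun z => (v z).proj) (t, x) h1 contMDiffAt_snd
  · have h3 : ∀ z : ℝ × X, coordVec I' (v x).proj ⟨(v z.2).proj, s z.1 • (v z.2).snd⟩ =
        s z.1 • coordVec I' (v x).proj (v z.2) := fun z => coordVec_smul _ _ _ _
    refine ContMDiffWithinAt.congr ?_ (fun z _ => h3 z) (h3 _)
    exact ContMDiffAt.smul (hs.contMDiff.contMDiffAt.comp (t, x) contMDiffAt_fst)
      (ContMDiffAt.comp (g := fun z => coordVec I' (v x).proj (v z)) (t, x) h2 contMDiffAt_snd)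

end Slices

variable {M : Type*} [TopologicalSpace M] [ChartedSpace (Euc 7) M] [IsManifold (𝓡 7) ∞ M]
  {N : Type*} [TopologicalSpace N] [ChartedSpace (EuclideanHalfSpace 4) N]
  [IsManifold (𝓡∂ 4) ∞ N]
  {L : Type*} [TopologicalSpace L] [ChartedSpace (Euc 3) L]
  {S : Type*} [TopologicalSpace S] [ChartedSpace (Euc 6) S]
  {P : AlmostG2 M} {ι : N → M} {j : L → N} {C : Scaffold P ι j S} {h : Metric M}
  {V : Set (TangentBundle (𝓡 7) M)} {α : DForm (Euc 4) N 2}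

theorem contMDiff_deform (hι : IsCoassociative P ι) (hV : IsTubular C h V)
    (hα : α ∈ GammaU P ι V) : ContMDiff (𝓡∂ 4) (𝓡 7) ∞ (deform P ι h α) :=
  hV.smooth.comp_contMDiff (contMDiff_normalField hι hV.subset hα)
    fun x => (normalField_spec hι hV.subset hα x).1

theorem isSmooth_Fhat (hι : IsCoassociative P ι) (hV : IsTubular C h V)
    (hα : α ∈ GammaU P ι V) : (Fhat P ι h α).IsSmooth (𝓡∂ 4) :=
  P.smooth_φ.pull (contMDiff_deform hι hV hα)

/-- The homotopy `exp_{s v}` from `ι` to the deformation, reparametrised so that it is defined for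
all times. -/
def deformHomotopy (P : AlmostG2 M) (ι : N → M) (h : Metric M) (α : DForm (Euc 4) N 2)
    (p : ℝ × N) : M :=
  expMap h ⟨(normalField P ι h α p.2).proj,
    Real.smoothTransition p.1 • (normalField P ι h α p.2).snd⟩

theorem contMDiff_deformHomotopy (hι : IsCoassociative P ι) (hV : IsTubular C h V)
    (hα : α ∈ GammaU P ι V) :
    ContMDiff (𝓘(ℝ, ℝ).prod (𝓡∂ 4)) (𝓡 7) ∞ (deformHomotopy P ι h α) :=
  hV.smooth.comp_contMDiff
    (contMDiff_smul_field (contMDiff_normalField hι hV.subset hα) Real.smoothTransition.contDiff)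
    fun p => hV.starShaped _ (normalField_spec hι hV.subset hα p.2).1 _
      ⟨Real.smoothTransition.nonneg _, Real.smoothTransition.le_one _⟩

theorem deformHomotopy_zero (hι : IsCoassociative P ι) (hV : IsTubular C h V)
    (hα : α ∈ GammaU P ι V) (x : N) : deformHomotopy P ι h α (0, x) = ι x := by
  rw [deformHomotopy, Real.smoothTransition.zero, (normalField_spec hι hV.subset hα x).2.1]
  have h1 : (⟨ι x, (0 : ℝ) • (normalField P ι h α x).snd⟩ : TangentBundle (𝓡 7) M) = ⟨ι x, 0⟩ :=
    congrArg (TotalSpace.mk (ι x)) (zero_smul ℝ ((normalField P ι h α x).snd : Euc 7))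
  refine Eq.trans (congrArg (expMap h) h1) ?_
  exact expMap_zero (hV.subset_domain (hV.zero_mem x))

theorem deformHomotopy_one (x : N) : deformHomotopy P ι h α (1, x) = deform P ι h α x := by
  rw [deformHomotopy, Real.smoothTransition.one, deform]
  congr 1
  exact congrArg (TotalSpace.mk (normalField P ι h α x).proj)
    (one_smul ℝ ((normalField P ι h α x).snd : Euc 7))

variable [T2Space N] [CompactSpace N]

/-- If `*F̂(α)` vanishes on the boundary then `G(α) = 0` implies `F̂(α) = 0`: the equation says that
`d * F̂(α)` is anti-self-dual, hence zero, and `F̂(α)` is joined to `ι^* φ = 0` by the forms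
`exp_{s v}^* φ`. -/
theorem IsCoassociative.Fhat_eq_zero (hι : IsCoassociative P ι) (hV : IsTubular C h V)
    (hα : α ∈ GammaU P ι V)
    (hbd : ∀ x ∈ (𝓡∂ 4).boundary N, ∀ v : Euc 4, v 0 = 0 →
      star3 P ι (Fhat P ι h α) x ![v] = 0)
    (hG : ∀ x, Gmap P ι h α x = 0) (x : N) : Fhat P ι h α x = 0 := by
  have hη := isSmooth_Fhat hι hV hα
  have hasd : ∀ x, star2 P ι ((star3 P ι (Fhat P ι h α)).extd (𝓡∂ 4)) x =
      -(star3 P ι (Fhat P ι h α)).extd (𝓡∂ 4) x := by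
    intro x
    have h1 := hG x
    rw [Gmap, hι.codiffPlus_eq] at h1
    have h2 := (smul_eq_zero.1 h1).resolve_left (by norm_num)
    exact eq_neg_of_add_eq_zero_left h2
  have hcl := hι.extd_eq_zero_of_antiSelfDual (hι.isSmooth_star3 hη) hbd hasd
  have hH := contMDiff_deformHomotopy hι hV hα
  have hΘ : (P.φ.pull (𝓘(ℝ, ℝ).prod (𝓡∂ 4)) (𝓡 7) (deformHomotopy P ι h α)).IsSmooth
      (𝓘(ℝ, ℝ).prod (𝓡∂ 4)) := P.smooth_φ.pull hH
  have hΘd : ∀ p, (P.φ.pull (𝓘(ℝ, ℝ).prod (𝓡∂ 4)) (𝓡 7) (deformHomotopy P ι h α)).extd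
      (𝓘(ℝ, ℝ).prod (𝓡∂ 4)) p = 0 := by
    intro p
    rw [DForm.extd_pull P.smooth_φ hH, P.closed]
    rfl
  refine hι.eq_zero_of_closed_star hη hbd hcl hΘ.contract (DForm.hasDerivAt_slice hΘ hΘd)
    (fun x => ?_) (fun x => ?_) x
  · rw [DForm.slice_pull _ hH]
    have h1 : (fun x => deformHomotopy P ι h α (0, x)) = ι :=
      funext fun x => deformHomotopy_zero hι hV hα x
    rw [h1]
    exact hι.vanishes x
  · rw [DForm.slice_pull _ hH]
    have h1 : (fun x => deformHomotopy P ι h α (1, x)) = deform P ι h α :=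
      funext fun x => deformHomotopy_one x
    rw [h1, Fhat]

theorem IsCoassociative.Gmap_eq_zero (hι : IsCoassociative P ι)
    (hF : ∀ x, Fhat P ι h α x = 0) (x : N) : Gmap P ι h α x = 0 := by
  have h1 : Fhat P ι h α = fun _ => 0 := funext hF
  have h2 : star3 P ι (Fhat P ι h α) = fun _ => 0 := by
    funext x
    simp [star3, h1, alternating_zero_apply]
  have h3 : (star3 P ι (Fhat P ι h α)).extd (𝓡∂ 4) x = 0 := by
    have h4 : DForm.inChart (𝓡∂ 4) (fun _ : N => (0 : Euc 4 [⋀^Fin 1]→L[ℝ] ℝ)) x = fun _ => 0 := by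
      funext y; rfl
    rw [h2, DForm.extd, h4]
    simp only [extDerivWithin, fderivWithin_fun_const, Pi.zero_apply]
    exact map_zero (ContinuousAlternatingMap.alternatizeUncurryFinCLM ℝ (Euc 4) ℝ)
  rw [Gmap, hι.codiffPlus_eq, h3]
  simp [star2, h3, alternating_zero_apply]

end Homotopy

/-! ### The deformation is embedded -/

section DeformEmbedding

theorem injective_tmap_of_comp {E : Type*} [NormedAddCommGroup E] [NormedSpace ℝ E]
    {H : Type*} [TopologicalSpace H] {I : ModelWithCorners ℝ E H}
    {X : Type*} [TopologicalSpace X] [ChartedSpace H X]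
    {E' : Type*} [NormedAddCommGroup E'] [NormedSpace ℝ E']
    {H' : Type*} [TopologicalSpace H'] {I' : ModelWithCorners ℝ E' H'}
    {X' : Type*} [TopologicalSpace X'] [ChartedSpace H' X']
    {E'' : Type*} [NormedAddCommGroup E''] [NormedSpace ℝ E'']
    {H'' : Type*} [TopologicalSpace H''] {I'' : ModelWithCorners ℝ E'' H''}
    {X'' : Type*} [TopologicalSpace X''] [ChartedSpace H'' X'']
    {f : X → X'} {g : X' → X''} {k : X → X''} {s : Set X'} {x : X} (hf : ContMDiffAt I I' ∞ f x)
    (hg : ContMDiffWithinAt I' I'' ∞ g s (f x)) (hs : ∀ z, f z ∈ s) (hk : k = g ∘ f)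
    (hinj : Injective (tmap I I'' k x)) : Injective (tmap I I' f x) := by
  subst hk
  have h1 := (hg.mdifferentiableWithinAt (by simp)).hasMFDerivWithinAt
  have h2 := (hf.mdifferentiableAt (by simp)).hasMFDerivAt.hasMFDerivWithinAt (s := univ)
  have h3 := h1.comp x h2 (fun z _ => hs z)
  rw [hasMFDerivWithinAt_univ] at h3
  have h4 : tmap I I'' (g ∘ f) x = (mfderivWithin I' I'' g s (f x)).comp (mfderiv I I' f x) :=
    h3.mfderiv
  rw [h4] at hinj
  exact Injective.of_comp (f := mfderivWithin I' I'' g s (f x)) hinj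

variable {M : Type*} [TopologicalSpace M] [ChartedSpace (Euc 7) M] [IsManifold (𝓡 7) ∞ M]
  {N : Type*} [TopologicalSpace N] [ChartedSpace (EuclideanHalfSpace 4) N]
  [IsManifold (𝓡∂ 4) ∞ N]
  {L : Type*} [TopologicalSpace L] [ChartedSpace (Euc 3) L]
  {S : Type*} [TopologicalSpace S] [ChartedSpace (Euc 6) S]
  {P : AlmostG2 M} {ι : N → M} {j : L → N} {C : Scaffold P ι j S} {h : Metric M}
  {V : Set (TangentBundle (𝓡 7) M)} {α : DForm (Euc 4) N 2}

/-- The deformed submanifold is embedded: composing `exp_v` with the smooth inverse of the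
exponential map and the bundle projection gives back `ι`. -/
theorem isEmbedded_deform [T2Space M] [CompactSpace N] (hι : IsCoassociative P ι)
    (hV : IsTubular C h V) (hα : α ∈ GammaU P ι V) :
    IsEmbedded (𝓡∂ 4) (𝓡 7) (deform P ι h α) := by
  have hsm := contMDiff_deform hι hV hα
  obtain ⟨σ, hσ, hinv⟩ := hV.smooth_inv
  have hspec := fun x => normalField_spec hι hV.subset hα x
  have hι' : (fun y => (σ y).proj) ∘ deform P ι h α = ι := by
    funext x
    change (σ (expMap h (normalField P ι h α x))).proj = ι x
    rw [hinv (hspec x).1, (hspec x).2.1]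
  have hmem : ∀ x, deform P ι h α x ∈ expMap h '' V := fun x => mem_image_of_mem _ (hspec x).1
  have hg : ContMDiffOn (𝓡 7) (𝓡 7) ∞ (fun y => (σ y).proj) (expMap h '' V) :=
    (contMDiff_proj (TangentSpace (𝓡 7) : M → Type _)).comp_contMDiffOn hσ
  refine ⟨hsm, fun x => ?_, ?_⟩
  · exact injective_tmap_of_comp (hsm x) (hg _ (hmem x)) hmem hι'.symm
      (hι.embedded.immersion x)
  · refine (hsm.continuous.isClosedEmbedding fun x x' hx => ?_).isEmbedding
    apply hι.embedded.embedding.injective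
    rw [← hι']
    exact congrArg (fun y => (σ y).proj) hx

end DeformEmbedding

/-! ### Boundary points -/

section Boundary

/-- An injective linear map into the kernel of a nonzero functional is onto it if the dimensions
permit. -/
theorem exists_of_injective_of_finrank {E F : Type*} [AddCommGroup E] [Module ℝ E]
    [AddCommGroup F] [Module ℝ F] [FiniteDimensional ℝ F] {A : E →ₗ[ℝ] F}
    (hA : Injective A) {ℓ : F →ₗ[ℝ] ℝ} (hℓ : ℓ ≠ 0) (hAℓ : ∀ u, ℓ (A u) = 0)
    (hd : Module.finrank ℝ F = Module.finrank ℝ E + 1) {v : F} (hv : ℓ v = 0) : ∃ u, A u = v := by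
  have h1 : LinearMap.range A ≤ LinearMap.ker ℓ := by
    rintro _ ⟨u, rfl⟩; exact hAℓ u
  have h2 := ℓ.finrank_range_add_finrank_ker
  have h3 : Module.finrank ℝ (LinearMap.range ℓ) = 1 := by
    rw [LinearMap.range_eq_top.2 (LinearMap.surjective hℓ)]; simp
  have h4 := LinearMap.finrank_range_of_inj hA
  have h5 := Submodule.eq_of_le_of_finrank_eq h1 (by omega)
  have h6 : v ∈ LinearMap.range A := by rw [h5]; exact hv
  exact h6

variable {N : Type*} [TopologicalSpace N] [ChartedSpace (EuclideanHalfSpace 4) N]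
  [IsManifold (𝓡∂ 4) ∞ N]
  {L : Type*} [TopologicalSpace L] [ChartedSpace (Euc 3) L] [IsManifold (𝓡 3) ∞ L]
  {j : L → N}

/-- The differential of a map into the boundary: the normal coordinate has a minimum. -/
theorem tmap_boundary_zero (hj : ContMDiff (𝓡 3) (𝓡∂ 4) ∞ j) {p : L}
    (hp : j p ∈ (𝓡∂ 4).boundary N) (u : Euc 3) : tmap (𝓡 3) (𝓡∂ 4) j p u 0 = 0 := by
  rw [tmap_eq_fderivWithin (hj p)]
  set ℓ := localRep (𝓡 3) (𝓡∂ 4) j p (j p) with hℓ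
  have hr : range (𝓡 3) = univ := ModelWithCorners.range_eq_univ _
  have hsymm : (extChartAt (𝓡 3) p).symm (extChartAt (𝓡 3) p p) = p := extChartAt_to_inv p
  have h1 := (contDiffWithinAt_localRep (I := 𝓡 3) (I' := 𝓡∂ 4) (f := j) (x₀ := p) (q := j p)
    (y := extChartAt (𝓡 3) p p) (hj _) (mem_extChartAt_target p)
    (by rw [hsymm]; exact mem_extChartAt_source _)).differentiableWithinAt (by simp)
  rw [hr, differentiableWithinAt_univ] at h1
  rw [hr, fderivWithin_univ]
  have h2 : HasFDerivAt (fun y => ℓ y 0) ((EuclideanSpace.proj (𝕜 := ℝ) (0 : Fin 4)).comp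
      (fderiv ℝ ℓ (extChartAt (𝓡 3) p p))) (extChartAt (𝓡 3) p p) :=
    (EuclideanSpace.proj (𝕜 := ℝ) (0 : Fin 4)).hasFDerivAt.comp _ h1.hasFDerivAt
  have h3 : ∀ y, 0 ≤ ℓ y 0 := fun y => by
    have := mapsTo_localRep (I := 𝓡 3) (I' := 𝓡∂ 4) j p (j p) univ (mem_univ y)
    rw [range_modelWithCornersEuclideanHalfSpace] at this
    exact this
  have h4 : ℓ (extChartAt (𝓡 3) p p) 0 = 0 := by
    rw [hℓ, localRep, hsymm]; exact chart_zero_of_mem_boundary hp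
  have h5 : IsLocalMin (fun y => ℓ y 0) (extChartAt (𝓡 3) p p) :=
    Filter.Eventually.of_forall fun y => h4.le.trans (h3 y)
  exact congrArg (fun T : Euc 3 →L[ℝ] ℝ => T u) (h5.hasFDerivAt_eq_zero h2)

/-- The tangent space of the boundary consists of the vectors with vanishing normal coordinate. -/
theorem exists_tmap_boundary (hj : IsEmbedded (𝓡 3) (𝓡∂ 4) j) {p : L}
    (hp : j p ∈ (𝓡∂ 4).boundary N) {v : Euc 4} (hv : v 0 = 0) :
    ∃ u, tmap (𝓡 3) (𝓡∂ 4) j p u = v := by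
  refine exists_of_injective_of_finrank (A := (tmap (𝓡 3) (𝓡∂ 4) j p).toLinearMap)
    (ℓ := (EuclideanSpace.proj (𝕜 := ℝ) (0 : Fin 4)).toLinearMap) (hj.immersion p) ?_
    (tmap_boundary_zero hj.smooth hp) (by simp) hv
  intro h0
  have := LinearMap.congr_fun h0 (EuclideanSpace.single 0 1)
  simp at this

variable {M : Type*} [TopologicalSpace M] [ChartedSpace (Euc 7) M] [IsManifold (𝓡 7) ∞ M]
  {P : AlmostG2 M} {ι : N → M}

/-- If `n ⌟ η = 0` then `*η` is a multiple of the 1-form dual to `n`. -/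
theorem IsCoassociative.star3_eq_zero (hι : IsCoassociative P ι) {η : DForm (Euc 4) N 3} {x : N}
    {n v : Euc 4} (hn : n ≠ 0) (hη : (η x).curryLeft n = 0) (hv : inducedIp P ι x n v = 0) :
    star3 P ι η x ![v] = 0 := by
  obtain ⟨e, he, c, hc, hnc⟩ := hι.exists_orthonormalFrame x hn
  have hs := hι.vol_sq he
  obtain ⟨s, hs'⟩ : ∃ s, vol P ι x e = s := ⟨_, rfl⟩
  rw [hs'] at hs
  have hs0 : s ≠ 0 := by rintro rfl; norm_num at hs
  rw [hnc] at hη hv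
  have hη0 : (η x).curryLeft (e 0) = 0 := by
    rw [map_smul] at hη
    exact (smul_eq_zero.1 hη).resolve_left hc
  have hv0 : inducedIp P ι x (e 0) v = 0 := by
    rw [inducedIp, map_smul, Metric.ip_smul_left] at hv
    exact (mul_eq_zero.1 hv).resolve_left hc
  rw [hι.star3_eq_inducedIp]
  set X := starVec P ι η x with hX
  have hX1 := he.eq_sum X
  have hvec : ![e 0, e 1, e 2, e 3] = e := by funext i; fin_cases i <;> rfl
  have hcomp : ∀ b d, ∑ a, inducedIp P ι x X (e a) * vol P ι x ![e a, e 0, e b, e d] = 0 := by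
    intro b d
    have h1 := congrArg (fun θ : Euc 4 [⋀^Fin 3]→L[ℝ] ℝ => θ ![e 0, e b, e d])
      (hι.vol_starVec η x)
    have h2 : η x ![e 0, e b, e d] = 0 :=
      congrArg (fun θ : Euc 4 [⋀^Fin 2]→L[ℝ] ℝ => θ ![e b, e d]) hη0
    simp only [← hX, h2] at h1
    rw [hX1, map_sum, ContinuousAlternatingMap.sum_apply] at h1
    refine Eq.trans (Finset.sum_congr rfl fun a _ => ?_) h1
    rw [map_smul]; rfl
  have h23 := hcomp 2 3
  have h13 := hcomp 1 3
  have h12 := hcomp 1 2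
  simp only [four_form_components (vol P ι x) e _ 0, hvec, hs', Fin.sum_univ_four, Fin.val_zero,
    Fin.val_one, Fin.val_two, show ((3 : Fin 4) : ℕ) = 3 from rfl] at h23 h13 h12
  norm_num [hs0] at h23 h13 h12
  have h4 : inducedIp P ι x X v = ∑ a, inducedIp P ι x X (e a) * inducedIp P ι x (e a) v := by
    conv_lhs => rw [hX1]
    exact inducedIp_sum_left _ _ _ _
  rw [h4, Fin.sum_univ_four, h23, h13, h12, hv0]
  ring

end Boundary

/-! ### The boundary in the scaffold -/

section ScaffoldBoundary

theorem tmap_comp {E : Type*} [NormedAddCommGroup E] [NormedSpace ℝ E]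
    {H : Type*} [TopologicalSpace H] {I : ModelWithCorners ℝ E H}
    {X : Type*} [TopologicalSpace X] [ChartedSpace H X]
    {E' : Type*} [NormedAddCommGroup E'] [NormedSpace ℝ E']
    {H' : Type*} [TopologicalSpace H'] {I' : ModelWithCorners ℝ E' H'}
    {X' : Type*} [TopologicalSpace X'] [ChartedSpace H' X']
    {E'' : Type*} [NormedAddCommGroup E''] [NormedSpace ℝ E'']
    {H'' : Type*} [TopologicalSpace H''] {I'' : ModelWithCorners ℝ E'' H''}
    {X'' : Type*} [TopologicalSpace X''] [ChartedSpace H'' X'']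
    {f : X → X'} {g : X' → X''} {x : X} (hg : ContMDiffAt I' I'' ∞ g (f x))
    (hf : ContMDiffAt I I' ∞ f x) (u : E) :
    tmap I I'' (g ∘ f) x u = tmap I' I'' g (f x) (tmap I I' f x u) := by
  have h := mfderiv_comp x (hg.mdifferentiableAt (by simp)) (hf.mdifferentiableAt (by simp))
  exact congrArg (fun T : E →L[ℝ] E'' => T u) h

variable {M : Type*} [TopologicalSpace M] [ChartedSpace (Euc 7) M] [IsManifold (𝓡 7) ∞ M]
  {N : Type*} [TopologicalSpace N] [ChartedSpace (EuclideanHalfSpace 4) N]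
  [IsManifold (𝓡∂ 4) ∞ N]
  {L : Type*} [TopologicalSpace L] [ChartedSpace (Euc 3) L] [IsManifold (𝓡 3) ∞ L]
  {S : Type*} [TopologicalSpace S] [ChartedSpace (Euc 6) S] [IsManifold (𝓡 6) ∞ S]
  {P : AlmostG2 M} {ι : N → M} {j : L → N} {C : Scaffold P ι j S} {h : Metric M}
  {V : Set (TangentBundle (𝓡 7) M)} {α : DForm (Euc 4) N 2}

/-- Near a hypersurface with tubular coordinates, maps into the hypersurface are smooth as soon as
they are smooth as maps into the ambient manifold. -/
theorem IsAdaptedMetric.contMDiff_of_comp (hh : IsAdaptedMetric C h) {b : L → S}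
    (hb : ContMDiff (𝓡 3) (𝓡 7) ∞ (C.κ ∘ b)) : ContMDiff (𝓡 3) (𝓡 6) ∞ b := by
  obtain ⟨D, T, O, η, ηinv, hD, hT, hO, hD0, hκO, hOT, hηT, hinvD, hl, hr, hηs, hinvs, hη0, hη1,
    hip, hout⟩ := hh
  have h1 : b = fun p => (ηinv ((C.κ ∘ b) p)).1 := by
    funext p
    rw [comp, ← hη0, hl (hD0 _)]
  rw [h1]
  exact contMDiff_fst.comp (hinvs.comp_contMDiff hb fun p => hOT (hκO (mem_range_self _)))

/-- Along `S` the field `n_S` is a unit normal field for the adapted metric, too. -/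
theorem IsAdaptedMetric.ip_nS_tmap (hh : IsAdaptedMetric C h) (y : S) (u : Euc 6) :
    h.ip (C.κ y) (C.nS y).snd (tmap (𝓡 6) (𝓡 7) C.κ y u) = 0 ∧
    h.ip (C.κ y) (C.nS y).snd (C.nS y).snd = 1 := by
  obtain ⟨D, T, O, η, ηinv, hD, hT, hO, hD0, hκO, hOT, hηT, hinvD, hl, hr, hηs, hinvs, hη0, hη1,
    hip, hout⟩ := hh
  have hsm : ContMDiffAt ((𝓡 6).prod 𝓘(ℝ, ℝ)) (𝓡 7) ∞ η (y, 0) :=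
    hηs.contMDiffAt (hD.mem_nhds (hD0 y))
  have h1 : tmap (𝓡 6) (𝓡 7) C.κ y u =
      tmap ((𝓡 6).prod 𝓘(ℝ, ℝ)) (𝓡 7) η (y, 0) (u, (0 : ℝ)) := by
    have h2 : C.κ = η ∘ fun y => (y, (0 : ℝ)) := funext fun y => (hη0 y).symm
    have h3 := tmap_comp (I := 𝓡 6) (I' := (𝓡 6).prod 𝓘(ℝ, ℝ)) (I'' := 𝓡 7) (g := η)
      (f := fun y : S => (y, (0 : ℝ))) (x := y) hsm (contMDiffAt_id.prodMk contMDiffAt_const) u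
    rw [← h2] at h3
    rw [h3]
    congr 1
    exact congrArg (fun A : Euc 6 →L[ℝ] Euc 6 × ℝ => A u)
      (mfderiv_prod_left (I := 𝓡 6) (I' := 𝓘(ℝ, ℝ)) (x₀ := y) (y₀ := (0 : ℝ)))
  have h2 := hip (y, 0) (hD0 y) (by rw [hη0]; exact hκO (mem_range_self _))
  have h3 := h2 (0, 1) (u, 0)
  have h4 := h2 (0, 1) (0, 1)
  rw [hη1, hη0] at h3 h4
  rw [← h1] at h3
  have h5 : ∀ z : Euc 7, P.g.ip (C.κ y) 0 z = 0 := fun z => by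
    rw [← zero_smul ℝ (0 : Euc 7), Metric.ip_smul_left, zero_mul]
  simp only [map_zero, h5] at h3 h4
  exact ⟨by simpa using h3, by simpa using h4⟩

/-- Tangent vectors of `M` at points of `S` which are normal to `n_S` for an adapted metric are
tangent to `S`. -/
theorem IsAdaptedMetric.exists_tmap_eq (hh : IsAdaptedMetric C h) (y : S) {v : Euc 7}
    (hv : h.ip (C.κ y) (C.nS y).snd v = 0) : ∃ w, tmap (𝓡 6) (𝓡 7) C.κ y w = v := by
  refine exists_of_injective_of_finrank (A := (tmap (𝓡 6) (𝓡 7) C.κ y).toLinearMap)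
    (ℓ := ((h.inner (C.κ y) (C.nS y).snd : Euc 7 →L[ℝ] ℝ)).toLinearMap) (C.embedded.immersion y) ?_
    (fun u => (hh.ip_nS_tmap y u).1) (by simp) hv
  intro h0
  have h1 : h.ip (C.κ y) (C.nS y).snd (C.nS y).snd = 0 := LinearMap.congr_fun h0 ((C.nS y).snd)
  rw [(hh.ip_nS_tmap y 0).2] at h1
  exact one_ne_zero h1

theorem Scaffold.n_ne_zero (C : Scaffold P ι j S) (p : L) : C.n p ≠ 0 := fun h0 => by
  have := C.n_inward p
  rw [h0] at this
  simp at this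

theorem IsAdaptedMetric.contMDiff_bS (hh : IsAdaptedMetric C h) (hι : IsCoassociative P ι)
    (hj : IsEmbedded (𝓡 3) (𝓡∂ 4) j) : ContMDiff (𝓡 3) (𝓡 6) ∞ C.bS := by
  refine hh.contMDiff_of_comp ?_
  rw [show C.κ ∘ C.bS = ι ∘ j from funext C.bS_eq]
  exact hι.embedded.smooth.comp hj.smooth

theorem IsAdaptedMetric.tmap_bS (hh : IsAdaptedMetric C h) (hι : IsCoassociative P ι)
    (hj : IsEmbedded (𝓡 3) (𝓡∂ 4) j) (p : L) (u : Euc 3) :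
    tmap (𝓡 6) (𝓡 7) C.κ (C.bS p) (tmap (𝓡 3) (𝓡 6) C.bS p u) =
      tmap (𝓡∂ 4) (𝓡 7) ι (j p) (tmap (𝓡 3) (𝓡∂ 4) j p u) := by
  rw [← tmap_comp (C.embedded.smooth _) (hh.contMDiff_bS hι hj p),
    ← tmap_comp (hι.embedded.smooth _) (hj.smooth p),
    show C.κ ∘ C.bS = ι ∘ j from funext C.bS_eq]

/-- The second boundary condition makes `*F̂(α)` vanish on vectors tangent to the boundary. -/
theorem star3_Fhat_boundary (hι : IsCoassociative P ι) (hj : IsEmbedded (𝓡 3) (𝓡∂ 4) j)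
    (hjr : range j = (𝓡∂ 4).boundary N) (hh : IsAdaptedMetric C h) (hα : α ∈ C.GammaBC h V) :
    ∀ x ∈ (𝓡∂ 4).boundary N, ∀ v : Euc 4, v 0 = 0 → star3 P ι (Fhat P ι h α) x ![v] = 0 := by
  intro x hx v hv
  obtain ⟨p, rfl⟩ : x ∈ range j := hjr ▸ hx
  obtain ⟨u, rfl⟩ := exists_tmap_boundary hj hx hv
  refine hι.star3_eq_zero (C.n_ne_zero p) (hα.2.2 p) ?_
  rw [inducedIp, C.n_eq, ← hh.tmap_bS hι hj, ← C.bS_eq]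
  exact C.nS_normal _ _

theorem tangentBundle_eq_mk {w : TangentBundle (𝓡 7) M} {q : M} (hq : w.proj = q) {u : Euc 7}
    (hu : u = w.snd) : w = ⟨q, u⟩ := by
  subst hq hu
  rfl

theorem Scaffold.jL_apply (C : Scaffold P ι j S) (p : L) (w : Euc 6) (u : Euc 3) :
    C.jL p w ![u] = P.φ (C.κ (C.bS p)) ![(C.nS (C.bS p)).snd, tmap (𝓡 6) (𝓡 7) C.κ (C.bS p) w,
      tmap (𝓡 6) (𝓡 7) C.κ (C.bS p) (tmap (𝓡 3) (𝓡 6) C.bS p u)] := by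
  change P.φ _ _ = P.φ _ _
  congr 1
  funext i; fin_cases i <;> rfl

theorem Scaffold.bdryForm_apply (C : Scaffold P ι j S) (α : DForm (Euc 4) N 2) (p : L) (u : Euc 3) :
    C.bdryForm α p ![u] = -α (j p) ![C.n p, tmap (𝓡 3) (𝓡∂ 4) j p u] := by
  change -(α (j p) _) = -(α (j p) _)
  congr 2
  funext i; fin_cases i <;> rfl

/-- The normal field `v` is tangent to `S` along the boundary, where it is `ȷ_{∂N}⁻¹(β)`. -/
theorem tmap_bdryField (hι : IsCoassociative P ι) (hj : IsEmbedded (𝓡 3) (𝓡∂ 4) j)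
    (hjr : range j = (𝓡∂ 4).boundary N) (hh : IsAdaptedMetric C h) (hV : IsTubular C h V)
    (hα : α ∈ GammaU P ι V) (p : L) :
    tmap (𝓡 6) (𝓡 7) C.κ (C.bS p) (C.bdryField h (C.bdryForm α) p) =
      ((normalField P ι h α (j p)).snd : Euc 7) := by
  obtain ⟨-, -, hn, hjN⟩ := normalField_spec hι hV.subset hα (j p)
  obtain ⟨v, hv⟩ : ∃ v : Euc 7, v = (normalField P ι h α (j p)).snd := ⟨_, rfl⟩
  rw [← hv] at hn ⊢
  have hjN' : ∀ a b, P.φ (ι (j p)) ![v, tmap (𝓡∂ 4) (𝓡 7) ι (j p) a,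
      tmap (𝓡∂ 4) (𝓡 7) ι (j p) b] = α (j p) ![a, b] := by
    intro a b
    rw [← hjN, jN_apply, hv]
  have htm := hh.tmap_bS hι hj p
  have hp : j p ∈ (𝓡∂ 4).boundary N := hjr ▸ mem_range_self p
  obtain ⟨w, hw⟩ : ∃ w, tmap (𝓡 6) (𝓡 7) C.κ (C.bS p) w = v := by
    refine hh.exists_tmap_eq _ ?_
    refine (h.ip_comm _ _ _).trans ?_
    rw [← C.n_eq, C.bS_eq]
    exact hn _
  have hw1 : (∀ u : Euc 3, h.ip (C.κ (C.bS p)) (tmap (𝓡 6) (𝓡 7) C.κ (C.bS p) w)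
      (tmap (𝓡 6) (𝓡 7) C.κ (C.bS p) (tmap (𝓡 3) (𝓡 6) C.bS p u)) = 0) ∧
      C.jL p w = C.bdryForm α p := by
    refine ⟨fun u => ?_, ?_⟩
    · rw [hw, htm, C.bS_eq]; exact hn _
    · ext z
      have hz : z = ![z 0] := by funext i; fin_cases i; rfl
      rw [hz, C.jL_apply, C.bdryForm_apply, ← hjN', hw, htm, ← C.n_eq, C.bS_eq,
        three_form_swap_left]
  have hex : ∃ w : Euc 6, (∀ u : Euc 3, h.ip (C.κ (C.bS p)) (tmap (𝓡 6) (𝓡 7) C.κ (C.bS p) w)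
      (tmap (𝓡 6) (𝓡 7) C.κ (C.bS p) (tmap (𝓡 3) (𝓡 6) C.bS p u)) = 0) ∧
      C.jL p w = C.bdryForm α p := ⟨w, hw1⟩
  rw [Scaffold.bdryField, dif_pos hex]
  obtain ⟨h1, h2⟩ := hex.choose_spec
  generalize hex.choose = w' at h1 h2
  rw [← hw]
  -- both solutions are tangent to `S`, so that their difference is normal to `N`
  have h3 : ∀ u : Euc 4, ∃ (r : ℝ) (a : Euc 3), u = r • C.n p + tmap (𝓡 3) (𝓡∂ 4) j p a := by
    intro u
    obtain ⟨a, ha⟩ := exists_tmap_boundary hj hp (v := u - (u 0 / C.n p 0) • C.n p) (by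
      have := (C.n_inward p).ne'
      simp only [PiLp.sub_apply, PiLp.smul_apply, smul_eq_mul]
      field_simp
      ring)
    exact ⟨u 0 / C.n p 0, a, by rw [ha]; abel⟩
  have h4 : tmap (𝓡 6) (𝓡 7) C.κ (C.bS p) w' - tmap (𝓡 6) (𝓡 7) C.κ (C.bS p) w = 0 := by
    refine hι.eq_zero_of_normal h (j p) (C.n_ne_zero p) (fun u => ?_) (fun u => ?_)
    · obtain ⟨r, a, rfl⟩ := h3 u
      have h5 := hw1.1 a
      have h6 := h1 a
      rw [htm, C.bS_eq] at h5 h6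
      have h7 := (h.ip_comm _ _ _).trans (hh.ip_nS_tmap (C.bS p) w).1
      have h8 := (h.ip_comm _ _ _).trans (hh.ip_nS_tmap (C.bS p) w').1
      rw [← C.n_eq, C.bS_eq] at h7 h8
      rw [Metric.ip_comm, map_add, map_smul, Metric.ip_add_left, Metric.ip_smul_left,
        h.ip_comm _ (tmap (𝓡∂ 4) (𝓡 7) ι (j p) (C.n p)), Metric.ip_sub_left,
        h.ip_comm _ (tmap (𝓡∂ 4) (𝓡 7) ι (j p) (tmap (𝓡 3) (𝓡∂ 4) j p a)), Metric.ip_sub_left,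
        h5, h6, h7, h8]
      simp
    · obtain ⟨r, a, rfl⟩ := h3 u
      have h5 := congrArg (fun θ : Euc 3 [⋀^Fin 1]→L[ℝ] ℝ => θ ![a]) (h2.trans hw1.2.symm)
      simp only [C.jL_apply, htm, ← C.n_eq] at h5
      rw [C.bS_eq] at h5
      rw [map_add, map_smul, (three_form_isLinearMap_right _ _ _).map_add,
        (three_form_isLinearMap_right _ _ _).map_smul,
        (P.φ (ι (j p))).map_eq_zero_of_eq ![_, tmap (𝓡∂ 4) (𝓡 7) ι (j p) (C.n p),
          tmap (𝓡∂ 4) (𝓡 7) ι (j p) (C.n p)] (i := 1) (j := 2) rfl (by decide),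
        smul_zero, zero_add, sub_eq_add_neg, ← neg_one_smul ℝ, three_form_add, three_form_smul,
        three_form_swap_left, three_form_swap_left _ _ (tmap (𝓡 6) (𝓡 7) C.κ (C.bS p) w), h5]
      ring
  exact sub_eq_zero.1 h4

/-- The two parametrisations of the deformed boundary agree. -/
theorem kappa_bdryDeform (hι : IsCoassociative P ι) (hj : IsEmbedded (𝓡 3) (𝓡∂ 4) j)
    (hjr : range j = (𝓡∂ 4).boundary N) (hh : IsAdaptedMetric C h) (hV : IsTubular C h V)
    (hα : α ∈ GammaU P ι V) (p : L) :
    C.κ (C.bdryDeform h (C.bdryForm α) p) = deform P ι h α (j p) := by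
  obtain ⟨hmem, hproj, -, -⟩ := normalField_spec hι hV.subset hα (j p)
  have h1 : normalField P ι h α (j p) = ⟨C.κ (C.bS p),
      tmap (𝓡 6) (𝓡 7) C.κ (C.bS p) (C.bdryField h (C.bdryForm α) p)⟩ :=
    tangentBundle_eq_mk (hproj.trans (C.bS_eq p).symm) (tmap_bdryField hι hj hjr hh hV hα p)
  have hex : ∃ y, C.κ y = expMap h ⟨C.κ (C.bS p),
      tmap (𝓡 6) (𝓡 7) C.κ (C.bS p) (C.bdryField h (C.bdryForm α) p)⟩ := by
    rw [← h1]
    exact hV.boundary _ hmem p hproj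
  rw [Scaffold.bdryDeform, dif_pos hex, hex.choose_spec, deform, h1]

/-- The deformed boundary of a coassociative deformation is special Lagrangian. -/
theorem isSpecialLagrangian_bdryDeform [T2Space M] [CompactSpace N] (hι : IsCoassociative P ι)
    (hj : IsEmbedded (𝓡 3) (𝓡∂ 4) j) (hjr : range j = (𝓡∂ 4).boundary N)
    (hh : IsAdaptedMetric C h) (hV : IsTubular C h V) (hα : α ∈ C.GammaBC h V)
    (hF : ∀ x, Fhat P ι h α x = 0) :
    IsSpecialLagrangian C (C.bdryDeform h (C.bdryForm α)) := by
  set b := C.bdryDeform h (C.bdryForm α) with hb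
  have hκ : C.κ ∘ b = deform P ι h α ∘ j := funext (kappa_bdryDeform hι hj hjr hh hV hα.1)
  have hdef := isEmbedded_deform hι hV hα.1
  have hsm : ContMDiff (𝓡 3) (𝓡 6) ∞ b := by
    refine hh.contMDiff_of_comp ?_
    rw [hκ]
    exact hdef.smooth.comp hj.smooth
  have htm : ∀ p u, tmap (𝓡 3) (𝓡 7) (C.κ ∘ b) p u =
      tmap (𝓡∂ 4) (𝓡 7) (deform P ι h α) (j p) (tmap (𝓡 3) (𝓡∂ 4) j p u) := by
    intro p u
    rw [hκ, tmap_comp (hdef.smooth _) (hj.smooth p)]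
  refine ⟨⟨hsm, fun p => ?_, ?_⟩, hα.2.1, fun p => ?_⟩
  · refine injective_tmap_of_comp (s := univ) (hsm p)
      (C.embedded.smooth (b p)).contMDiffWithinAt (fun _ => mem_univ _) rfl ?_
    intro u u' huu
    rw [htm, htm] at huu
    exact hj.immersion p (hdef.immersion _ huu)
  · refine Topology.IsEmbedding.of_comp hsm.continuous C.embedded.smooth.continuous ?_
    rw [hκ]
    exact hdef.embedding.comp hj.embedding
  · ext z
    have h1 : P.φ.pull (𝓡 3) (𝓡 7) (C.κ ∘ b) p z =
        Fhat P ι h α (j p) (tmap (𝓡 3) (𝓡∂ 4) j p ∘ z) := by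
      change P.φ ((C.κ ∘ b) p) (tmap (𝓡 3) (𝓡 7) (C.κ ∘ b) p ∘ z) =
        P.φ (deform P ι h α (j p)) (tmap (𝓡∂ 4) (𝓡 7) (deform P ι h α) (j p) ∘ _ ∘ z)
      rw [show (C.κ ∘ b) p = deform P ι h α (j p) from congrFun hκ p]
      congr 1
      funext i
      exact htm p (z i)
    rw [h1, hF]
    rfl

end ScaffoldBoundary

end CoassocBdry

end

theorem mainTheorem5
    {M : Type*} [TopologicalSpace M] [T2Space M] [SecondCountableTopology M]
    [ChartedSpace (CoassocBdry.Euc 7) M] [IsManifold (𝓡 7) ∞ M]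
    {N : Type*} [TopologicalSpace N] [T2Space N] [CompactSpace N]
    [ChartedSpace (EuclideanHalfSpace 4) N] [IsManifold (𝓡∂ 4) ∞ N]
    {L : Type*} [TopologicalSpace L] [ChartedSpace (CoassocBdry.Euc 3) L] [IsManifold (𝓡 3) ∞ L]
    {S : Type*} [TopologicalSpace S] [ChartedSpace (CoassocBdry.Euc 6) S] [IsManifold (𝓡 6) ∞ S]
    (P : CoassocBdry.AlmostG2 M)
    (ι : N → M) (hι : CoassocBdry.IsCoassociative P ι)
    (j : L → N) (hj : CoassocBdry.IsEmbedded (𝓡 3) (𝓡∂ 4) j)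
    (hjr : Set.range j = (𝓡∂ 4).boundary N)
    (C : CoassocBdry.Scaffold P ι j S)
    (h : CoassocBdry.Metric M) (hh : CoassocBdry.IsAdaptedMetric C h)
    (V : Set (TangentBundle (𝓡 7) M)) (hV : CoassocBdry.IsTubular C h V)
    (α : CoassocBdry.DForm (CoassocBdry.Euc 4) N 2) (hα : α ∈ C.GammaBC h V) :
    ((∀ x, CoassocBdry.Gmap P ι h α x = 0) ↔
      CoassocBdry.IsCoassociative P (CoassocBdry.deform P ι h α)) ∧
    ((∀ x, CoassocBdry.Gmap P ι h α x = 0) →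
      (∀ p, C.κ (C.bdryDeform h (C.bdryForm α) p) = CoassocBdry.deform P ι h α (j p)) ∧
      CoassocBdry.IsSpecialLagrangian C (C.bdryDeform h (C.bdryForm α))) := by
  have hF : (∀ x, CoassocBdry.Gmap P ι h α x = 0) → ∀ x, CoassocBdry.Fhat P ι h α x = 0 :=
    hι.Fhat_eq_zero hV hα.1 (CoassocBdry.star3_Fhat_boundary hι hj hjr hh hα)
  refine ⟨⟨fun hG => ⟨CoassocBdry.isEmbedded_deform hι hV hα.1, hF hG⟩,
    fun hc => hι.Gmap_eq_zero hc.vanishes⟩, fun hG =>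
    ⟨CoassocBdry.kappa_bdryDeform hι hj hjr hh hV hα.1,
      CoassocBdry.isSpecialLagrangian_bdryDeform hι hj hjr hh hV hα (hF hG)⟩⟩
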